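/- \textbf{Theorem (Euler--Poincar\'e theorem for metamorphosis).} Let $G$ be a smooth Lie group and $N$ a smooth manifold (without boundary, modelled on Banach spaces, in particular possibly finite-dimensional), let $G$ act smoothly on $N$ from the left, and let $\mathfrak g=T_{\rm id}G$ with bracket $\mathrm{ad}_u v=[u,v]$ (the derivative of the adjoint representation; the commutator $uv-vu$ for matrix groups). Concatenation denotes the action of $G$ and its tangent lifts, so that $un\in T_nN$ is the infinitesimal action of $u\in\mathfrak g$ at $n\in N$. Let $L:TG\times TN\to\mathbb R$ be of class $C^2$ and invariant under the right action $(g,\eta)h=(gh,h^{-1}\eta)$ of $G$ on $G\times N$. Put $\ell(u,n,\nu):=L({\rm id},u,n,\nu)$, a function on $\mathfrak g\times TN$. Then $$L(g,U_g,\eta,\zeta_\eta)=\ell(U_gg^{-1},g\eta,g\zeta_\eta)\qquad\text{on }TG\times TN .$$ Let $(g_t,\eta_t)\in G\times N$ be curves of class $C^2$ on (a neighbourhood of) $[0,1]$ with $g_0={\rm id}$, and set $u_t=\dot g_tg_t^{-1}$, $n_t=g_t\eta_t$, $\nu_t=g_t\dot\eta_t$. In a chart of $N$, write $\delta\ell/\delta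 u$, $\delta\ell/\delta n$, $\delta\ell/\delta\nu$ for the partial derivatives of $\ell$ at $(u_t,n_t,\nu_t)$ with respect to $u$, to the base coordinate and to the fibre coordinate of $TN$; for $u\in\mathfrak g$ and a tangent vector $\omega$ at $n$ let $u\omega$ denote the derivative in the direction $\omega$ of the chart expression of $n\mapsto un$; and define $\langle \mathrm{ad}^*_u\mu,v\rangle=\langle\mu,\mathrm{ad}_uv\rangle$, $\langle p\diamond n,u\rangle=-\langle p,un\rangle$, $\langle p\diamond\nu,u\rangle=-\langle p,u\nu\rangle$, $\langle u\star p,\omega\rangle=\langle p,u\omega\rangle$. Consider the \emph{Euler--Poincar\'e equations} for $t\in[0,1]$, in every smooth chart of $N$ around $n_t$, $$\frac{\partial}{\partial t}\frac{\delta\ell}{\delta u}+\mathrm{ad}^*_{u_t}\frac{\delta\ell}{\delta u}+\frac{\delta\ell}{\delta n}\diamond n_t+\frac{\delta\ell}{\delta\nu}\diamond\nu_t=0,\qquad \frac{\partial}{\partial t}\frac{\delta\ell}{\delta\nu}+u_t\star\frac{\delta\ell}{\delta\nu}-\frac{\delta\ell}{\delta n}=0, \tag{EP}$$ with the auxiliary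 equation $\dot n_t=\nu_t+u_tn_t$. Consider also variations of $(u,n,\nu)$, i.e. $C^1$ one-parameter families of curves in $\mathfrak g\times TN$ through $(u,n,\nu)$, whose first variation is of the form (in charts of $N$) $$\delta u=\dot\xi_t-\mathrm{ad}_{u_t}\xi_t,\qquad \delta n=\varpi_t+\xi_tn_t,\qquad \delta\nu=\dot\varpi_t+\xi_t\nu_t-u_t\varpi_t \tag{V}$$ with $C^1$ curves $\xi_t\in\mathfrak g$ and $\varpi_t\in T_{n_t}N$. \textbf{(A) Variations of $g$ and $\eta$ vanishing at the endpoints.} The following are equivalent: \begin{enumerate} \item[(i)] $\delta\int_0^1L(g_t,\dot g_t,\eta_t,\dot\eta_t)\,dt=0$ for all $C^2$ one-parameter deformations of $(g,\eta)$ which keep $g$ and $\eta$ fixed at $t=0$ and $t=1$; \item[(ii)] $(g_t,\eta_t)$ satisfies the Euler--Lagrange equations of $L$ on $TG\times TN$ for $t\in[0,1]$ (in all charts); \item[(iii)] $\delta\int_0^1\ell(u_t,n_t,\nu_t)\,dt=0$ for all variations of the form (V) with $\xi_0=\xi_1=0$ and $\varpi_0=\varpi_1=0$; \item[(iv)] the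 equations (EP) and the auxiliary equation hold. \end{enumerate} \textbf{(B) Variations with $g_0={\rm id}$ and the initial and final images $n_0$, $n_1$ fixed.} The following are equivalent: \begin{enumerate} \item[(i)] $\delta\int_0^1L(g_t,\dot g_t,\eta_t,\dot\eta_t)\,dt=0$ for all $C^2$ one-parameter deformations of $(g,\eta)$ which keep $g_0={\rm id}$ and keep $n_0=g_0\eta_0$ and $n_1=g_1\eta_1$ fixed; \item[(ii)] $(g_t,\eta_t)$ satisfies the Euler--Lagrange equations of $L$ on $TG\times TN$ for $t\in[0,1]$, together with the natural boundary condition at $t=1$ belonging to the constraint that $n_1$ is fixed: $\langle\partial L/\partial\dot g,\delta g\rangle+\langle\partial L/\partial\dot\eta,\delta\eta\rangle=0$ at $t=1$ for all $\delta g\in T_{g_1}G$, $\delta\eta\in T_{\eta_1}N$ with $(\delta g)\eta_1+g_1\delta\eta=0$; \item[(iii)] $\delta\int_0^1\ell(u_t,n_t,\nu_t)\,dt=0$ for all variations of the form (V) with $\xi_0=0$, $\varpi_0=0$ and $\varpi_1+\xi_1n_1=0$; \item[(iv)] the equations (EP), the auxiliary equation and the endpoint condition $\dfrac{\delta\ell}{\delta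 u}(1)+\dfrac{\delta\ell}{\delta\nu}(1)\diamond n_1=0$ hold. \end{enumerate} -/

import Mathlib

open Set Filter Topology
open scoped Manifold ContDiff

noncomputable section

namespace Metamorphosis

section Charts

variable {E : Type*} [NormedAddCommGroup E] [NormedSpace ℝ E]
  {M : Type*} [TopologicalSpace M] [ChartedSpace E M]

/-- The velocity lift `t ↦ (c t, ċ t)` of a curve `c` in a manifold. -/
def velocityLift (c : ℝ → M) (t : ℝ) : TangentBundle 𝓘(ℝ, E) M :=
  ⟨c t, mfderiv 𝓘(ℝ, ℝ) 𝓘(ℝ, E) c t (1 : ℝ)⟩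

/-- The tangent vector whose coordinates in the chart `e` are `(x, v)`. -/
def ofCoord (e : OpenPartialHomeomorph M E) (x v : E) : TangentBundle 𝓘(ℝ, E) M :=
  ⟨e.symm x, mfderiv 𝓘(ℝ, E) 𝓘(ℝ, E) e.symm x v⟩

/-- The vector component of a tangent vector, in the model space `E` of the tangent spaces. -/
def vecPart (Y : TangentBundle 𝓘(ℝ, E) M) : E := Y.2

/-- The fibre coordinate, in the chart `e`, of a tangent vector. -/
def fibreCoord (e : OpenPartialHomeomorph M E) (Y : TangentBundle 𝓘(ℝ, E) M) : E :=
  mfderiv 𝓘(ℝ, E) 𝓘(ℝ, E) e Y.1 Y.2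

/-- `e` is a smooth chart of `M` around the point `x`. -/
def IsChartAround (e : OpenPartialHomeomorph M E) (x : M) : Prop :=
  e ∈ IsManifold.maximalAtlas 𝓘(ℝ, E) ∞ M ∧ x ∈ e.source

/-- The curve `c` satisfies on `[0,1]` the Euler-Lagrange equations
`d/dt (∂Λ/∂ẋ) = ∂Λ/∂x` of the time-dependent Lagrangian `Λ t : TM → ℝ`, in every chart. -/
def EulerLagrange (Λ : ℝ → TangentBundle 𝓘(ℝ, E) M → ℝ) (c : ℝ → M) : Prop :=
  ∀ t ∈ Icc (0 : ℝ) 1, ∀ e : OpenPartialHomeomorph M E, IsChartAround e (c t) →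
    HasDerivAt
      (fun s => fderiv ℝ (fun v : E => Λ s (ofCoord e (e (c s)) v)) (deriv (fun r => e (c r)) s))
      (fderiv ℝ (fun x : E => Λ t (ofCoord e x (deriv (fun r => e (c r)) t))) (e (c t))) t

/-- The derivative of `Λ : TM → ℝ` at `X` along the fibre of `TM` through `X`. -/
def fibreDeriv (Λ : TangentBundle 𝓘(ℝ, E) M → ℝ) (X : TangentBundle 𝓘(ℝ, E) M) : E →L[ℝ] ℝ :=
  fderiv ℝ (fun v : E => Λ ⟨X.1, v⟩) X.2

end Charts

section Group

variable {E : Type*} [NormedAddCommGroup E] [NormedSpace ℝ E]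
  (G : Type*) [TopologicalSpace G] [ChartedSpace E G] [Group G]

/-- `ad_u v = [u, v]` on the Lie algebra `T₁G` of `G`, whose underlying vector space is `E`. -/
def lieAd (u v : E) : E :=
  (⁅(show GroupLieAlgebra 𝓘(ℝ, E) G from u), (show GroupLieAlgebra 𝓘(ℝ, E) G from v)⁆ :
    GroupLieAlgebra 𝓘(ℝ, E) G)

/-- `ad*_u μ`, the functional `v ↦ ⟨μ, ad_u v⟩`. -/
def adStar (u : E) (μ : E →L[ℝ] ℝ) : E → ℝ := fun v => μ (lieAd G u v)

variable {G}

/-- `U g⁻¹ ∈ T₁G` for a tangent vector `U` of `G` at `g`. -/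
def rightTriv (X : TangentBundle 𝓘(ℝ, E) G) : E :=
  mfderiv 𝓘(ℝ, E) 𝓘(ℝ, E) (fun h : G => h * X.1⁻¹) X.1 X.2

variable {F : Type*} [NormedAddCommGroup F] [NormedSpace ℝ F]
  {N : Type*} [TopologicalSpace N] [ChartedSpace F N] [MulAction G N]

/-- Invariance of `L : TG × TN → ℝ` under the tangent lift of the right action
`(g, η) h = (g h, h⁻¹ η)` of `G` on `G × N`. -/
def RightInvariant (L : TangentBundle 𝓘(ℝ, E) G × TangentBundle 𝓘(ℝ, F) N → ℝ) : Prop :=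
  ∀ (h : G) (X : TangentBundle 𝓘(ℝ, E) G) (Y : TangentBundle 𝓘(ℝ, F) N),
    L (tangentMap 𝓘(ℝ, E) 𝓘(ℝ, E) (fun g : G => g * h) X,
       tangentMap 𝓘(ℝ, F) 𝓘(ℝ, F) (fun y : N => h⁻¹ • y) Y) = L (X, Y)

/-- The reduced Lagrangian `ℓ : T₁G × TN → ℝ`, the restriction of `L` to `g = 1`. -/
def reduced (L : TangentBundle 𝓘(ℝ, E) G × TangentBundle 𝓘(ℝ, F) N → ℝ) :
    E × TangentBundle 𝓘(ℝ, F) N → ℝ :=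
  fun p => L (⟨(1 : G), p.1⟩, p.2)

/-- `u_t = ġ_t g_t⁻¹`. -/
def uCurve (g : ℝ → G) (t : ℝ) : E := rightTriv (E := E) (velocityLift g t)

/-- `n_t = g_t η_t`. -/
def nCurve (g : ℝ → G) (η : ℝ → N) (t : ℝ) : N := g t • η t

/-- `(n_t, ν_t)`, with `ν_t = g_t η̇_t` (the derivative of `y ↦ g_t y` applied to `η̇_t`). -/
def nuCurve (g : ℝ → G) (η : ℝ → N) (t : ℝ) : TangentBundle 𝓘(ℝ, F) N :=
  tangentMap 𝓘(ℝ, F) 𝓘(ℝ, F) (fun y : N => g t • y) (velocityLift η t)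

/-- The infinitesimal action `u ↦ u n ∈ T_nN` of `T₁G` on `N`. -/
def infAct (E : Type*) [NormedAddCommGroup E] [NormedSpace ℝ E] {F : Type*}
    [NormedAddCommGroup F] [NormedSpace ℝ F] (G : Type*) [TopologicalSpace G]
    [ChartedSpace E G] [Group G] {N : Type*} [TopologicalSpace N] [ChartedSpace F N]
    [MulAction G N] (n : N) : E →L[ℝ] F :=
  mfderiv 𝓘(ℝ, E) 𝓘(ℝ, F) (fun h : G => h • n) 1

/-- The infinitesimal action in the chart `e`: `coordAct E G e x u` is the chart component of
`u n` at the point `n` with coordinate `x`. -/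
def coordAct (E : Type*) [NormedAddCommGroup E] [NormedSpace ℝ E] {F : Type*}
    [NormedAddCommGroup F] [NormedSpace ℝ F] (G : Type*) [TopologicalSpace G]
    [ChartedSpace E G] [Group G] {N : Type*} [TopologicalSpace N] [ChartedSpace F N]
    [MulAction G N] (e : OpenPartialHomeomorph N F) (x : F) : E →L[ℝ] F :=
  mfderiv 𝓘(ℝ, E) 𝓘(ℝ, F) (fun h : G => e (h • e.symm x)) 1

/-- The action of `T₁G` on tangent vectors in the chart `e`: `coordActT E G e x w u` is the
fibre component of `u ω`, for `ω` the tangent vector with coordinates `(x, w)`, that is, the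
derivative of `x ↦ coordAct E G e x u` at `x` in the direction `w`. -/
def coordActT (E : Type*) [NormedAddCommGroup E] [NormedSpace ℝ E] {F : Type*}
    [NormedAddCommGroup F] [NormedSpace ℝ F] (G : Type*) [TopologicalSpace G]
    [ChartedSpace E G] [Group G] {N : Type*} [TopologicalSpace N] [ChartedSpace F N]
    [MulAction G N] (e : OpenPartialHomeomorph N F) (x : F) : F →L[ℝ] E →L[ℝ] F :=
  fderiv ℝ (fun y : F => coordAct E G e y) x

/-- The diamond of a covector `p` with a vector-valued infinitesimal action `A : u ↦ u n`
(or `u ↦ u ν`): `⟨p ⋄ n, u⟩ = -⟨p, u n⟩`. -/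
def diamond (p : F →L[ℝ] ℝ) (A : E →L[ℝ] F) : E →L[ℝ] ℝ := -(p.comp A)

/-- `u ⋆ p` in the chart `e` at the coordinate `x`: `⟨u ⋆ p, ω⟩ = ⟨p, u ω⟩`. -/
def star (G : Type*) [TopologicalSpace G] [ChartedSpace E G] [Group G]
    [MulAction G N] (e : OpenPartialHomeomorph N F) (x : F) (u : E) (p : F →L[ℝ] ℝ) :
    F →L[ℝ] ℝ :=
  p.comp ((coordActT E G e x).flip u)

section Partials

variable (l : E × TangentBundle 𝓘(ℝ, F) N → ℝ)

/-- `δℓ/δu` at `(u, Y)`. -/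
def dlu (u : E) (Y : TangentBundle 𝓘(ℝ, F) N) : E →L[ℝ] ℝ :=
  fderiv ℝ (fun w : E => l (w, Y)) u

/-- `δℓ/δn` at `(u, n, ν)` in the chart `e`, with `(x, v)` the coordinates of `(n, ν)`. -/
def dln (e : OpenPartialHomeomorph N F) (u : E) (x v : F) : F →L[ℝ] ℝ :=
  fderiv ℝ (fun y : F => l (u, ofCoord e y v)) x

/-- `δℓ/δν` at `(u, n, ν)` in the chart `e`, with `(x, v)` the coordinates of `(n, ν)`. -/
def dlnu (e : OpenPartialHomeomorph N F) (u : E) (x v : F) : F →L[ℝ] ℝ :=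
  fderiv ℝ (fun w : F => l (u, ofCoord e x w)) v

end Partials

section Variations

variable (g : ℝ → G) (η : ℝ → N)

/-- A twice continuously differentiable one-parameter deformation `(γ ε, h ε)` of `(g, η)`. -/
structure IsDeformation (γ : ℝ → ℝ → G) (h : ℝ → ℝ → N) : Prop where
  base_g : γ 0 = g
  base_η : h 0 = η
  smooth_g : ∀ t ∈ Icc (0 : ℝ) 1,
    ContMDiffAt 𝓘(ℝ, ℝ × ℝ) 𝓘(ℝ, E) 2 (fun p : ℝ × ℝ => γ p.1 p.2) (0, t)
  smooth_η : ∀ t ∈ Icc (0 : ℝ) 1,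
    ContMDiffAt 𝓘(ℝ, ℝ × ℝ) 𝓘(ℝ, F) 2 (fun p : ℝ × ℝ => h p.1 p.2) (0, t)

/-- The action `∫₀¹ L(g, ġ, η, η̇) dt`. -/
def action (L : TangentBundle 𝓘(ℝ, E) G × TangentBundle 𝓘(ℝ, F) N → ℝ)
    (g : ℝ → G) (η : ℝ → N) : ℝ :=
  ∫ t in (0 : ℝ)..1, L (velocityLift g t, velocityLift η t)

/-- Hamilton's principle `δ∫₀¹ L dt = 0` for deformations that fix `g` and `η` at both ends. -/
def HamiltonFixedEnds (L : TangentBundle 𝓘(ℝ, E) G × TangentBundle 𝓘(ℝ, F) N → ℝ) : Prop :=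
  ∀ (γ : ℝ → ℝ → G) (h : ℝ → ℝ → N), IsDeformation (E := E) (F := F) g η γ h →
    (∀ᶠ ε in 𝓝 (0 : ℝ), γ ε 0 = g 0 ∧ γ ε 1 = g 1 ∧ h ε 0 = η 0 ∧ h ε 1 = η 1) →
    HasDerivAt (fun ε => action L (γ ε) (h ε)) 0 0

/-- Hamilton's principle `δ∫₀¹ L dt = 0` for deformations that keep `g₀ = id` and fix the
initial and the final image `n₀`, `n₁`. -/
def HamiltonFixedImages (L : TangentBundle 𝓘(ℝ, E) G × TangentBundle 𝓘(ℝ, F) N → ℝ) : Prop :=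
  ∀ (γ : ℝ → ℝ → G) (h : ℝ → ℝ → N), IsDeformation (E := E) (F := F) g η γ h →
    (∀ᶠ ε in 𝓝 (0 : ℝ), γ ε 0 = 1 ∧ γ ε 0 • h ε 0 = nCurve g η 0 ∧
      γ ε 1 • h ε 1 = nCurve g η 1) →
    HasDerivAt (fun ε => action L (γ ε) (h ε)) 0 0

/-- The Euler-Lagrange equations of `L` on `TG × TN` for the curve `(g, η)`. -/
def EulerLagrangePair (L : TangentBundle 𝓘(ℝ, E) G × TangentBundle 𝓘(ℝ, F) N → ℝ) : Prop :=
  EulerLagrange (fun t X => L (X, velocityLift η t)) g ∧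
  EulerLagrange (fun t Y => L (velocityLift g t, Y)) η

/-- The natural boundary condition at time `1` for the constraint that `n₁ = g₁η₁` is fixed:
`⟨∂L/∂ġ, δg⟩ + ⟨∂L/∂η̇, δη⟩ = 0` for all `δg`, `δη` at time `1` with
`δ(g₁η₁) = δg η₁ + g₁ δη = 0`. -/
def NaturalBoundary (L : TangentBundle 𝓘(ℝ, E) G × TangentBundle 𝓘(ℝ, F) N → ℝ) : Prop :=
  ∀ (a : TangentSpace 𝓘(ℝ, E) (g 1)) (b : TangentSpace 𝓘(ℝ, F) (η 1)),
    mfderiv 𝓘(ℝ, E) 𝓘(ℝ, F) (fun k : G => k • η 1) (g 1) a +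
      mfderiv 𝓘(ℝ, F) 𝓘(ℝ, F) (fun y : N => g 1 • y) (η 1) b = 0 →
    fibreDeriv (fun X => L (X, velocityLift η 1)) (velocityLift g 1) a +
      fibreDeriv (fun Y => L (velocityLift g 1, Y)) (velocityLift η 1) b = 0

/-- `(U ε, V ε)` is a continuously differentiable one-parameter family of curves in `T₁G × TN`
through `(u, (n, ν))` whose derivative at `ε = 0` has the form
`δu = ξ̇ - ad_u ξ`, `δn = ϖ + ξ n`, `δν = ϖ̇ + ξ ν - u ϖ` (the last two in charts of `N`), for
continuously differentiable `ξ : [0,1] → T₁G` and `ϖ` along `n` (`ϖ t ∈ T_{n t}N`). -/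
structure IsReducedVariation (U : ℝ → ℝ → E) (V : ℝ → ℝ → TangentBundle 𝓘(ℝ, F) N)
    [IsManifold 𝓘(ℝ, F) ∞ N]
    (ξ : ℝ → E) (ϖ : (t : ℝ) → TangentSpace 𝓘(ℝ, F) (nCurve g η t)) : Prop where
  base_u : U 0 = uCurve g
  base_nu : V 0 = nuCurve g η
  smooth_u : ∀ t ∈ Icc (0 : ℝ) 1, ContDiffAt ℝ 1 (fun p : ℝ × ℝ => U p.1 p.2) (0, t)
  smooth_nu : ∀ t ∈ Icc (0 : ℝ) 1,
    ContMDiffAt 𝓘(ℝ, ℝ × ℝ) 𝓘(ℝ, F).tangent 1 (fun p : ℝ × ℝ => V p.1 p.2) (0, t)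
  smooth_ξ : ∀ t ∈ Icc (0 : ℝ) 1, ContDiffAt ℝ 1 ξ t
  smooth_ϖ : ∀ t ∈ Icc (0 : ℝ) 1, ContMDiffAt 𝓘(ℝ, ℝ) 𝓘(ℝ, F).tangent 1
    (fun s => (⟨nCurve g η s, ϖ s⟩ : TangentBundle 𝓘(ℝ, F) N)) t
  var_u : ∀ t ∈ Icc (0 : ℝ) 1,
    HasDerivAt (fun ε => U ε t) (deriv ξ t - lieAd G (uCurve g t) (ξ t)) 0
  var_n : ∀ t ∈ Icc (0 : ℝ) 1, ∀ e : OpenPartialHomeomorph N F,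
    IsChartAround e (nCurve g η t) →
    HasDerivAt (fun ε => e (V ε t).1)
      (fibreCoord e ⟨nCurve g η t, ϖ t⟩ + coordAct E G e (e (nCurve g η t)) (ξ t)) 0
  var_nu : ∀ t ∈ Icc (0 : ℝ) 1, ∀ e : OpenPartialHomeomorph N F,
    IsChartAround e (nCurve g η t) →
    HasDerivAt (fun ε => fibreCoord e (V ε t))
      (deriv (fun s => fibreCoord e ⟨nCurve g η s, ϖ s⟩) t
        + coordActT E G e (e (nCurve g η t)) (fibreCoord e (nuCurve g η t)) (ξ t)
        - coordActT E G e (e (nCurve g η t)) (fibreCoord e ⟨nCurve g η t, ϖ t⟩) (uCurve g t)) 0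

/-- The reduced action `∫₀¹ ℓ(u, n, ν) dt`. -/
def reducedAction (l : E × TangentBundle 𝓘(ℝ, F) N → ℝ) (u : ℝ → E)
    (V : ℝ → TangentBundle 𝓘(ℝ, F) N) : ℝ :=
  ∫ t in (0 : ℝ)..1, l (u t, V t)

/-- The constrained variational principle `δ∫₀¹ ℓ(u, n, ν) dt = 0` for variations with
`ξ` and `ϖ` vanishing at both ends. -/
def ReducedFixedEnds [IsManifold 𝓘(ℝ, F) ∞ N] (l : E × TangentBundle 𝓘(ℝ, F) N → ℝ) : Prop :=
  ∀ (U : ℝ → ℝ → E) (V : ℝ → ℝ → TangentBundle 𝓘(ℝ, F) N) (ξ : ℝ → E)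
    (ϖ : (t : ℝ) → TangentSpace 𝓘(ℝ, F) (nCurve g η t)),
    IsReducedVariation g η U V ξ ϖ →
    ξ 0 = 0 → ϖ 0 = 0 → ξ 1 = 0 → ϖ 1 = 0 →
    HasDerivAt (fun ε => reducedAction l (U ε) (V ε)) 0 0

/-- The constrained variational principle `δ∫₀¹ ℓ(u, n, ν) dt = 0` for variations that keep
`g₀ = id` and fix the images `n₀`, `n₁`: `ξ₀ = 0`, `ϖ₀ = 0` and `ϖ₁ + ξ₁ n₁ = 0`. -/
def ReducedFixedImages [IsManifold 𝓘(ℝ, F) ∞ N] (l : E × TangentBundle 𝓘(ℝ, F) N → ℝ) : Prop :=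
  ∀ (U : ℝ → ℝ → E) (V : ℝ → ℝ → TangentBundle 𝓘(ℝ, F) N) (ξ : ℝ → E)
    (ϖ : (t : ℝ) → TangentSpace 𝓘(ℝ, F) (nCurve g η t)),
    IsReducedVariation g η U V ξ ϖ →
    ξ 0 = 0 → ϖ 0 = 0 → vecPart ⟨nCurve g η 1, ϖ 1⟩ + infAct E G (nCurve g η 1) (ξ 1) = 0 →
    HasDerivAt (fun ε => reducedAction l (U ε) (V ε)) 0 0

/-- The Euler-Poincaré equations on `[0,1]`, in every chart of `N`:
`∂ₜ δℓ/δu + ad*_u δℓ/δu + δℓ/δn ⋄ n + δℓ/δν ⋄ ν = 0` (an identity of functionals on `T₁G`),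
`∂ₜ δℓ/δν + u ⋆ δℓ/δν - δℓ/δn = 0`, and the auxiliary equation `ṅ = ν + u n`. -/
structure EulerPoincare (l : E × TangentBundle 𝓘(ℝ, F) N → ℝ) : Prop where
  diff_u : ∀ t ∈ Icc (0 : ℝ) 1,
    DifferentiableAt ℝ (fun s => dlu l (uCurve g s) (nuCurve g η s)) t
  eq_u : ∀ t ∈ Icc (0 : ℝ) 1, ∀ e : OpenPartialHomeomorph N F,
    IsChartAround e (nCurve g η t) → ∀ ζ : E,
    let u := uCurve (E := E) g t
    let x := e (nCurve g η t)
    let v := fibreCoord e (nuCurve g η t)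
    deriv (fun s => dlu l (uCurve g s) (nuCurve g η s)) t ζ
      + adStar G u (dlu l u (nuCurve g η t)) ζ
      + diamond (dln l e u x v) (coordAct E G e x) ζ
      + diamond (dlnu l e u x v) (coordActT E G e x v) ζ = 0
  eq_nu : ∀ t ∈ Icc (0 : ℝ) 1, ∀ e : OpenPartialHomeomorph N F,
    IsChartAround e (nCurve g η t) →
    let u := uCurve (E := E) g
    let x := fun s => e (nCurve g η s)
    let v := fun s => fibreCoord e (nuCurve g η s)
    DifferentiableAt ℝ (fun s => dlnu l e (u s) (x s) (v s)) t ∧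
    deriv (fun s => dlnu l e (u s) (x s) (v s)) t
      + star G e (x t) (u t) (dlnu l e (u t) (x t) (v t))
      - dln l e (u t) (x t) (v t) = 0
  aux : ∀ t ∈ Icc (0 : ℝ) 1,
    vecPart (velocityLift (E := F) (nCurve g η) t) =
      vecPart (nuCurve g η t) + infAct E G (nCurve g η t) (uCurve g t)

/-- The endpoint condition `δℓ/δu(1) + δℓ/δν(1) ⋄ n₁ = 0`, where `δℓ/δν` is taken along the
fibre `T_{n₁}N`. -/
def EndpointCondition (l : E × TangentBundle 𝓘(ℝ, F) N → ℝ) : Prop :=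
  dlu l (uCurve g 1) (nuCurve g η 1)
    + diamond (fibreDeriv (fun Y => l (uCurve g 1, Y)) (nuCurve g η 1))
        (infAct E G (nCurve g η 1)) = 0

end Variations

end Group

end Metamorphosis

end

set_option linter.unusedSectionVars false

noncomputable section

namespace Metamorphosis

/-! Invariance under `g⁻¹` moves every value of `L` to the fibre over the identity, so `L` along a
pair of curves equals `ℓ` along the reduced curves, and the same is true along every deformation.
The rest is a comparison of two first variation formulas.

For a deformation of `(g, η)`, the time derivative of `⟨∂L/∂ġ, δg⟩ + ⟨∂L/∂η̇, δη⟩` is `δL` plus the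
Euler-Lagrange covectors applied to `(δg, δη)` (`hasDerivAt_boundaryTerm`). For a variation of the
form (V), the time derivative of `⟨δℓ/δu, ξ⟩ + ⟨δℓ/δν, ϖ⟩` is `δℓ` plus the left sides of (EP)
applied to `ξ` and `ϖ` (`IsReducedVariation.hasDerivAt_reducedBoundaryTerm`). A deformation induces
a variation of the form (V) with `ξ = δg g⁻¹`, `ϖ = g δη` (`IsDeformation.isReducedVariation`). This
is where the bracket enters: mixed second derivatives commute in charts, and expressing them through
the right trivialisation leaves the commutator terms (`fderiv_rightTriv_sub`,
`fderiv_fibreCoord_smul_sub`). The two momentum pairings then coincide (`boundaryTerm_eq`).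

Each part is proved as the cycle (i) → (ii) → (iv) → (iii) → (i). Hamilton's principle gives the
Euler-Lagrange equations by the fundamental lemma, applied to deformations supported in a chart.
Comparing the two formulas pointwise gives (EP), because `(δg, δη) ↦ (ξ, ϖ)` is onto at each time.
Integrating the second formula along a solution of (EP) leaves boundary values only, which the
endpoint conditions kill. Finally the reduced principle contains Hamilton's principle, since
deformations are special reduced variations.

For fixed images, the Euler-Lagrange equations come from the smaller class of deformations with
fixed ends. The endpoint condition comes from deformations that move `g₁` while `η` compensates so
that `n` stays constant (`HamiltonFixedImages.endpointCondition`); it is the natural boundary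
condition written in `ξ` (`naturalBoundary_iff_endpointCondition`). -/

theorem two_lt_infty : (2 : ℕ∞ω) < ∞ := by
  exact WithTop.coe_lt_coe.2 (ENat.natCast_lt_top 2)

theorem two_le_infty : (2 : ℕ∞ω) ≤ ∞ := two_lt_infty.le

theorem one_le_infty : (1 : ℕ∞ω) ≤ ∞ := le_trans (by norm_num) two_le_infty

/-! ### Tangent bundle coordinates in an arbitrary smooth chart. -/

section Charts

variable {E : Type*} [NormedAddCommGroup E] [NormedSpace ℝ E]
  {M : Type*} [TopologicalSpace M] [ChartedSpace E M]
  {P : Type*} [NormedAddCommGroup P] [NormedSpace ℝ P]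

/-- The derivative of `Γ : P → M` at `p` in the direction `d`, as a tangent vector of `M`. -/
def dirLift (Γ : P → M) (d p : P) : TangentBundle 𝓘(ℝ, E) M :=
  ⟨Γ p, mfderiv 𝓘(ℝ, P) 𝓘(ℝ, E) Γ p d⟩

variable [IsManifold 𝓘(ℝ, E) ∞ M] {e : OpenPartialHomeomorph M E}

theorem isChartAround_chartAt (x : M) : IsChartAround (chartAt E x) x :=
  ⟨IsManifold.chart_mem_maximalAtlas x, mem_chart_source E x⟩

theorem mdifferentiable_of_mem_maximalAtlas
    (he : e ∈ IsManifold.maximalAtlas 𝓘(ℝ, E) ∞ M) :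
    e.MDifferentiable 𝓘(ℝ, E) 𝓘(ℝ, E) :=
  ⟨(contMDiffOn_of_mem_maximalAtlas he).mdifferentiableOn (by simp),
    (contMDiffOn_symm_of_mem_maximalAtlas he).mdifferentiableOn (by simp)⟩

theorem ofCoord_fibreCoord (he : e ∈ IsManifold.maximalAtlas 𝓘(ℝ, E) ∞ M)
    (X : TangentBundle 𝓘(ℝ, E) M) (hX : X.1 ∈ e.source) :
    ofCoord e (e X.1) (fibreCoord e X) = X := by
  obtain ⟨x, v⟩ := X
  have h := (mdifferentiable_of_mem_maximalAtlas he).symm_comp_deriv hX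
  have h2 := DFunLike.congr_fun h v
  have h1 : e.symm (e x) = x := e.left_inv hX
  unfold ofCoord fibreCoord
  exact Bundle.TotalSpace.ext h1 (heq_of_eq h2)

theorem fibreCoord_ofCoord (he : e ∈ IsManifold.maximalAtlas 𝓘(ℝ, E) ∞ M)
    {x : E} (hx : x ∈ e.target) (v : E) : fibreCoord e (ofCoord e x v) = v :=
  DFunLike.congr_fun ((mdifferentiable_of_mem_maximalAtlas he).comp_symm_deriv hx) v

/-- On the open target this is the tangent map of the smooth `e.symm`, precomposed with the
identification of `E × E` with the tangent bundle of `E`. -/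
theorem contMDiffAt_ofCoord (he : e ∈ IsManifold.maximalAtlas 𝓘(ℝ, E) ∞ M)
    {x : E} (hx : x ∈ e.target) (v : E) :
    ContMDiffAt 𝓘(ℝ, E × E) 𝓘(ℝ, E).tangent ∞ (fun p : E × E => ofCoord e p.1 p.2) (x, v) := by
  have h1 := (contMDiffOn_symm_of_mem_maximalAtlas he).contMDiffOn_tangentMapWithin
    (m := ∞) (by simp) e.open_target.uniqueMDiffOn
  have h2 : ContMDiff 𝓘(ℝ, E × E) 𝓘(ℝ, E).tangent ∞
      (fun p : E × E => (⟨p.1, p.2⟩ : TangentBundle 𝓘(ℝ, E) E)) := by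
    have := contMDiff_tangentBundleModelSpaceHomeomorph_symm (I := 𝓘(ℝ, E)) (n := ∞)
    have h0 : 𝓘(ℝ, E × E) = 𝓘(ℝ, E).prod 𝓘(ℝ, E) := modelWithCornersSelf_prod
    rw [h0]
    exact this
  have h3 : IsOpen (Bundle.TotalSpace.proj ⁻¹' e.target : Set (TangentBundle 𝓘(ℝ, E) E)) :=
    e.open_target.preimage (FiberBundle.continuous_proj E _)
  have h4 := (h1.contMDiffAt (x := (⟨x, v⟩ : TangentBundle 𝓘(ℝ, E) E)) (h3.mem_nhds hx)).comp
    (x, v) h2.contMDiffAt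
  refine h4.congr_of_eventuallyEq ?_
  have : ∀ᶠ p : E × E in 𝓝 (x, v), p.1 ∈ e.target :=
    (e.open_target.preimage continuous_fst).mem_nhds hx
  filter_upwards [this] with p hp
  simp only [Function.comp, tangentMapWithin, ofCoord]
  rw [mfderivWithin_of_isOpen e.open_target hp]

theorem contMDiffAt_fibreCoord (he : e ∈ IsManifold.maximalAtlas 𝓘(ℝ, E) ∞ M)
    {X : TangentBundle 𝓘(ℝ, E) M} (hX : X.1 ∈ e.source) :
    ContMDiffAt 𝓘(ℝ, E).tangent 𝓘(ℝ, E) ∞ (fibreCoord e) X := by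
  have h1 := (contMDiffOn_of_mem_maximalAtlas he).contMDiffOn_tangentMapWithin
    (m := ∞) (by simp) e.open_source.uniqueMDiffOn
  have h2 : ContMDiff 𝓘(ℝ, E).tangent 𝓘(ℝ, E) ∞
      (fun p : TangentBundle 𝓘(ℝ, E) E => (p.2 : E)) := by
    have h0 := contMDiff_tangentBundleModelSpaceHomeomorph (I := 𝓘(ℝ, E)) (n := ∞)
    have h1 : ContMDiff (𝓘(ℝ, E).prod 𝓘(ℝ, E)) 𝓘(ℝ, E) ∞ (fun p : ModelProd E E => p.2) := by
      rw [← modelWithCornersSelf_prod]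
      exact contDiff_snd.contMDiff
    exact h1.comp h0
  have h3 : IsOpen (Bundle.TotalSpace.proj ⁻¹' e.source : Set (TangentBundle 𝓘(ℝ, E) M)) :=
    e.open_source.preimage (FiberBundle.continuous_proj E _)
  have h4 := h2.contMDiffAt.comp X (h1.contMDiffAt (x := X) (h3.mem_nhds hX))
  refine h4.congr_of_eventuallyEq ?_
  filter_upwards [h3.mem_nhds hX] with Y hY
  simp only [Function.comp, tangentMapWithin, fibreCoord]
  rw [mfderivWithin_of_isOpen e.open_source hY]

/-- The tangent space at `x` is the model space read through the preferred chart at `x`. This is how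
identities proved in charts become chart-free ones. -/
theorem mfderiv_chartAt_self (x : M) (v : E) :
    mfderiv 𝓘(ℝ, E) 𝓘(ℝ, E) (chartAt E x) x v = v := by
  have := mfderiv_extChartAt_self (I := 𝓘(ℝ, E)) (x := x)
  simp only [mfld_simps] at this
  exact congrArg (fun T : E →L[ℝ] E => T v) this

theorem fibreCoord_chartAt_self (x : M) (v : E) :
    fibreCoord (chartAt E x) (⟨x, v⟩ : TangentBundle 𝓘(ℝ, E) M) = v :=
  mfderiv_chartAt_self x v

theorem ofCoord_chartAt_self (x : M) (v : E) :
    ofCoord (chartAt E x) (chartAt E x x) v = ⟨x, v⟩ := by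
  have h := ofCoord_fibreCoord (IsManifold.chart_mem_maximalAtlas x)
    (⟨x, v⟩ : TangentBundle 𝓘(ℝ, E) M) (mem_chart_source E x)
  rwa [fibreCoord_chartAt_self] at h

theorem fibreCoord_dirLift (he : e ∈ IsManifold.maximalAtlas 𝓘(ℝ, E) ∞ M) {Γ : P → M} {p : P}
    (hΓ : MDifferentiableAt 𝓘(ℝ, P) 𝓘(ℝ, E) Γ p) (hp : Γ p ∈ e.source) (d : P) :
    fibreCoord e (dirLift Γ d p) = fderiv ℝ (fun q => e (Γ q)) p d := by
  have h := mfderiv_comp p ((mdifferentiable_of_mem_maximalAtlas he).mdifferentiableAt hp) hΓ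
  rw [← mfderiv_eq_fderiv]
  exact (DFunLike.congr_fun h d).symm

theorem dirLift_eq_ofCoord (he : e ∈ IsManifold.maximalAtlas 𝓘(ℝ, E) ∞ M) {Γ : P → M} {p : P}
    (hΓ : MDifferentiableAt 𝓘(ℝ, P) 𝓘(ℝ, E) Γ p) (hp : Γ p ∈ e.source) (d : P) :
    dirLift Γ d p = ofCoord e (e (Γ p)) (fderiv ℝ (fun q => e (Γ q)) p d) := by
  rw [← fibreCoord_dirLift he hΓ hp]
  exact (ofCoord_fibreCoord he (dirLift Γ d p) hp).symm

theorem contDiffAt_chart_comp (he : e ∈ IsManifold.maximalAtlas 𝓘(ℝ, E) ∞ M) {Γ : P → M} {p : P}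
    {n : ℕ∞ω} (hn : n ≤ ∞) (hΓ : ContMDiffAt 𝓘(ℝ, P) 𝓘(ℝ, E) n Γ p) (hp : Γ p ∈ e.source) :
    ContDiffAt ℝ n (fun q => e (Γ q)) p :=
  (((contMDiffAt_of_mem_maximalAtlas he hp).of_le hn).comp p hΓ).contDiffAt

theorem eventually_mem_source {Γ : P → M} {p : P} (hΓ : ContinuousAt Γ p) (hp : Γ p ∈ e.source) :
    ∀ᶠ q in 𝓝 p, Γ q ∈ e.source :=
  hΓ.eventually (e.open_source.mem_nhds hp)

/-- Regularity of finite order at a point spreads to a neighbourhood; for order `∞` it need not,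
hence the strict bound on `n`. -/
theorem eventually_mdifferentiableAt {Γ : P → M} {p : P} {n : ℕ∞ω}
    (hΓ : ContMDiffAt 𝓘(ℝ, P) 𝓘(ℝ, E) n Γ p) (hn : n ≠ 0) (hn' : n < ∞) :
    ∀ᶠ q in 𝓝 p, MDifferentiableAt 𝓘(ℝ, P) 𝓘(ℝ, E) Γ q := by
  have : IsManifold 𝓘(ℝ, E) n M := IsManifold.of_le (n := ∞) hn'.le
  have h : n ≠ ∞ := hn'.ne
  filter_upwards [(contMDiffAt_iff_contMDiffAt_nhds h).1 hΓ] with q hq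
  exact hq.mdifferentiableAt hn

theorem contMDiffAt_ofCoord_comp (he : e ∈ IsManifold.maximalAtlas 𝓘(ℝ, E) ∞ M) {n : ℕ∞ω} (hn : n ≤ ∞)
    {x v : P → E} {p : P}
    (hx : ContDiffAt ℝ n x p) (hv : ContDiffAt ℝ n v p) (hp : x p ∈ e.target) :
    ContMDiffAt 𝓘(ℝ, P) 𝓘(ℝ, E).tangent n (fun q => ofCoord e (x q) (v q)) p :=
  ((contMDiffAt_ofCoord he hp (v p)).of_le hn).comp p (hx.prodMk hv).contMDiffAt

theorem contMDiffAt_dirLift {Γ : P → M} {p : P}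
    (hΓ : ContMDiffAt 𝓘(ℝ, P) 𝓘(ℝ, E) 2 Γ p) (d : P) :
    ContMDiffAt 𝓘(ℝ, P) 𝓘(ℝ, E).tangent 1 (dirLift (E := E) Γ d) p := by
  obtain ⟨he, hp⟩ : IsChartAround (chartAt E (Γ p)) (Γ p) := isChartAround_chartAt _
  have h1 := contDiffAt_chart_comp he two_le_infty hΓ hp
  have h2 : ContDiffAt ℝ 1 (fun q => fderiv ℝ (fun q => chartAt E (Γ p) (Γ q)) q d) p :=
    (h1.fderiv_right (m := 1) (by norm_num)).clm_apply contDiffAt_const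
  refine (contMDiffAt_ofCoord_comp he one_le_infty (h1.of_le (by norm_num)) h2
    ((chartAt E (Γ p)).map_source hp)).congr_of_eventuallyEq ?_
  filter_upwards [eventually_mem_source hΓ.continuousAt hp,
    eventually_mdifferentiableAt hΓ (by simp) two_lt_infty] with q hq hq'
  exact dirLift_eq_ofCoord he hq' hq d

/-- The fibre derivative computed in a chart. -/
theorem fderiv_ofCoord (he : e ∈ IsManifold.maximalAtlas 𝓘(ℝ, E) ∞ M)
    (Λ : TangentBundle 𝓘(ℝ, E) M → ℝ) {X : TangentBundle 𝓘(ℝ, E) M} (hX : X.1 ∈ e.source)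
    (hΛ : DifferentiableAt ℝ (fun v : E => Λ ⟨X.1, v⟩) X.2) (w : E) :
    fderiv ℝ (fun v : E => Λ (ofCoord e (e X.1) v)) (fibreCoord e X)
      (fibreCoord e (⟨X.1, w⟩ : TangentBundle 𝓘(ℝ, E) M)) = fibreDeriv Λ X w := by
  let T : E →L[ℝ] E := mfderiv 𝓘(ℝ, E) 𝓘(ℝ, E) e.symm (e X.1)
  have hT : ∀ v, ofCoord e (e X.1) v = ⟨X.1, T v⟩ := fun v =>
    Bundle.TotalSpace.ext (e.left_inv hX) (heq_of_eq rfl)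
  have hinv : ∀ v : E, T (fibreCoord e (⟨X.1, v⟩ : TangentBundle 𝓘(ℝ, E) M)) = v := fun v =>
    DFunLike.congr_fun ((mdifferentiable_of_mem_maximalAtlas he).symm_comp_deriv hX) v
  have hX2 : T (fibreCoord e X) = X.2 := hinv X.2
  simp only [hT]
  rw [← hX2] at hΛ
  have := (hΛ.hasFDerivAt.comp (fibreCoord e X) T.hasFDerivAt).fderiv
  simp only [Function.comp_def] at this
  rw [this, ContinuousLinearMap.comp_apply, hinv, fibreDeriv, hX2]

end Charts

/-! ### Symmetry of second derivatives in normed spaces. -/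

section Calculus

variable {P E F : Type*} [NormedAddCommGroup P] [NormedSpace ℝ P]
  [NormedAddCommGroup E] [NormedSpace ℝ E] [NormedAddCommGroup F] [NormedSpace ℝ F]

theorem fderiv_fderiv_comm {f : P → F} {p : P} (hf : ContDiffAt ℝ 2 f p) (a b : P) :
    fderiv ℝ (fun q => fderiv ℝ f q a) p b = fderiv ℝ (fun q => fderiv ℝ f q b) p a := by
  have h1 : DifferentiableAt ℝ (fderiv ℝ f) p :=
    (hf.fderiv_right (m := 1) (by norm_num)).differentiableAt (by norm_num)
  have h2 : ∀ c, fderiv ℝ (fun q => fderiv ℝ f q c) p = (fderiv ℝ (fderiv ℝ f) p).flip c := by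
    intro c
    ext d
    rw [fderiv_clm_apply h1 (differentiableAt_const c)]
    simp
  rw [h2, h2]
  exact (hf.isSymmSndFDerivAt (by simp)) b a

theorem fderiv_prodMk_left {f : P × E → F} {a : P} {b : E} (hf : DifferentiableAt ℝ f (a, b))
    (u : P) : fderiv ℝ (fun x => f (x, b)) a u = fderiv ℝ f (a, b) (u, 0) := by
  have := (HasFDerivAt.comp a (f := fun x : P => (x, b)) hf.hasFDerivAt
    (hasFDerivAt_prodMk_left a b)).fderiv
  simp only [Function.comp_def] at this
  rw [this]
  simp

theorem fderiv_prodMk_right {f : P × E → F} {a : P} {b : E} (hf : DifferentiableAt ℝ f (a, b))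
    (w : E) : fderiv ℝ (fun y => f (a, y)) b w = fderiv ℝ f (a, b) (0, w) := by
  have := (HasFDerivAt.comp b (f := fun y : E => (a, y)) hf.hasFDerivAt
    (hasFDerivAt_prodMk_right a b)).fderiv
  simp only [Function.comp_def] at this
  rw [this]
  simp

/-- This is the Leibniz rule in the form used both for `Γ • H`, where group element and point vary
together, and for `L`, where the two velocities do. -/
theorem fderiv_diag {f : P × P → F} {p : P} (hf : DifferentiableAt ℝ f (p, p)) (d : P) :
    fderiv ℝ (fun q => f (q, q)) p d =
      fderiv ℝ (fun q => f (q, p)) p d + fderiv ℝ (fun q => f (p, q)) p d := by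
  rw [fderiv_prodMk_left hf, fderiv_prodMk_right hf, ← map_add]
  have := (HasFDerivAt.comp p (f := fun q : P => (q, q)) hf.hasFDerivAt
    ((hasFDerivAt_id p).prodMk (hasFDerivAt_id p))).fderiv
  simp only [Function.comp_def] at this
  rw [this]
  simp

/-- Mixed partial derivatives of a `C^2` function of two variables commute. -/
theorem fderiv_partial_comm {f : P × E → F} {a : P} {b : E} (hf : ContDiffAt ℝ 2 f (a, b))
    (u : P) (w : E) :
    fderiv ℝ (fun x => fderiv ℝ (fun y => f (x, y)) b w) a u =
      fderiv ℝ (fun y => fderiv ℝ (fun x => f (x, y)) a u) b w := by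
  have hd : DifferentiableAt ℝ (fderiv ℝ f) (a, b) :=
    (hf.fderiv_right (m := 1) (by norm_num)).differentiableAt (by norm_num)
  have hev : ∀ᶠ q in 𝓝 (a, b), DifferentiableAt ℝ f q := by
    filter_upwards [hf.eventually (by simp)] with q hq using hq.differentiableAt (by norm_num)
  have h1 : (fun x => fderiv ℝ (fun y => f (x, y)) b w) =ᶠ[𝓝 a]
      fun x => fderiv ℝ f (x, b) (0, w) := by
    filter_upwards [(Continuous.prodMk_left b).continuousAt.eventually hev] with x hx
    exact fderiv_prodMk_right hx w
  have h2 : (fun y => fderiv ℝ (fun x => f (x, y)) a u) =ᶠ[𝓝 b]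
      fun y => fderiv ℝ f (a, y) (u, 0) := by
    filter_upwards [(Continuous.prodMk_right a).continuousAt.eventually hev] with y hy
    exact fderiv_prodMk_left hy u
  rw [h1.fderiv_eq, h2.fderiv_eq]
  rw [fderiv_prodMk_left (f := fun q => fderiv ℝ f q (0, w))
      (hd.clm_apply (differentiableAt_const _)),
    fderiv_prodMk_right (f := fun q => fderiv ℝ f q (u, 0))
      (hd.clm_apply (differentiableAt_const _))]
  exact fderiv_fderiv_comm hf _ _

/-- If `∂₁x = A(x) T₁ + v₁` and `∂₂x = A(x) T₂ + v₂`, then the symmetry of the second derivative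
of `x` relates the derivatives of `T` and `v`. -/
theorem fderiv_sub_fderiv_of_fderiv_eq {x : P → F} {A : F → E →L[ℝ] F} {T₁ T₂ : P → E}
    {v₁ v₂ : P → F} {p d₁ d₂ : P} (hx : ContDiffAt ℝ 2 x p) (hA : DifferentiableAt ℝ A (x p))
    (hT₁ : DifferentiableAt ℝ T₁ p) (hT₂ : DifferentiableAt ℝ T₂ p)
    (hv₁ : DifferentiableAt ℝ v₁ p) (hv₂ : DifferentiableAt ℝ v₂ p)
    (h₁ : ∀ᶠ q in 𝓝 p, fderiv ℝ x q d₁ = A (x q) (T₁ q) + v₁ q)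
    (h₂ : ∀ᶠ q in 𝓝 p, fderiv ℝ x q d₂ = A (x q) (T₂ q) + v₂ q) :
    fderiv ℝ v₁ p d₂ - fderiv ℝ v₂ p d₁ =
      fderiv ℝ A (x p) (A (x p) (T₁ p) + v₁ p) (T₂ p)
        - fderiv ℝ A (x p) (A (x p) (T₂ p) + v₂ p) (T₁ p)
        - A (x p) (fderiv ℝ T₁ p d₂ - fderiv ℝ T₂ p d₁) := by
  have key : ∀ {T : P → E} {v : P → F} {d : P}, DifferentiableAt ℝ T p →
      DifferentiableAt ℝ v p → (∀ᶠ q in 𝓝 p, fderiv ℝ x q d = A (x q) (T q) + v q) → ∀ d',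
      fderiv ℝ (fun q => fderiv ℝ x q d) p d' =
        fderiv ℝ A (x p) (fderiv ℝ x p d') (T p) + A (x p) (fderiv ℝ T p d') +
          fderiv ℝ v p d' := by
    intro T v d hT hv h d'
    have hxd := hx.differentiableAt (by norm_num)
    have hAx : HasFDerivAt (fun q => A (x q)) ((fderiv ℝ A (x p)).comp (fderiv ℝ x p)) p :=
      hA.hasFDerivAt.comp p hxd.hasFDerivAt
    have h3 := (hAx.clm_apply hT.hasFDerivAt).add hv.hasFDerivAt
    have h4 : HasFDerivAt (fun q => fderiv ℝ x q d) _ p := h3.congr_of_eventuallyEq h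
    rw [h4.fderiv]
    simp only [add_apply, ContinuousLinearMap.comp_apply,
      ContinuousLinearMap.flip_apply]
    abel
  -- The left sides of `e1` and `e2` are the two mixed second derivatives of `x`; equating them
  -- yields the identity.
  have e1 := key hT₁ hv₁ h₁ d₂
  have e2 := key hT₂ hv₂ h₂ d₁
  rw [fderiv_fderiv_comm hx d₁ d₂, e2, h₂.self_of_nhds, h₁.self_of_nhds] at e1
  rw [map_sub]
  rw [← sub_eq_zero] at e1 ⊢
  rw [← neg_eq_zero, ← e1]
  abel

end Calculus

/-! ### Translation by a fixed group element. -/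

section ConstSMul

variable {E : Type*} [NormedAddCommGroup E] [NormedSpace ℝ E]
  {F : Type*} [NormedAddCommGroup F] [NormedSpace ℝ F]
  {G : Type*} [TopologicalSpace G] [ChartedSpace E G] [Group G]
  {N : Type*} [TopologicalSpace N] [ChartedSpace F N] [MulAction G N]
  {P : Type*} [NormedAddCommGroup P] [NormedSpace ℝ P]

variable (E F) in
theorem mdifferentiable_const_smul [ContMDiffSMul 𝓘(ℝ, E) 𝓘(ℝ, F) ∞ G N] (k : G) :
    MDifferentiable 𝓘(ℝ, F) 𝓘(ℝ, F) (fun y : N => k • y) :=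
  (ContMDiffSMul.contMDiff_const_smul (I := 𝓘(ℝ, E)) (n := ∞) k).mdifferentiable (by simp)

variable (E) in
theorem tangentMap_smul_dirLift [ContMDiffSMul 𝓘(ℝ, E) 𝓘(ℝ, F) ∞ G N] (k : G) {H : P → N} {p : P}
    (hH : MDifferentiableAt 𝓘(ℝ, P) 𝓘(ℝ, F) H p) (d : P) :
    tangentMap 𝓘(ℝ, F) 𝓘(ℝ, F) (fun y : N => k • y) (dirLift H d p) =
      dirLift (fun q => k • H q) d p :=
  Bundle.TotalSpace.ext rfl
    (heq_of_eq (mfderiv_comp_apply p (mdifferentiable_const_smul E F k (H p)) hH d).symm)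

end ConstSMul

/-! ### The infinitesimal action and the right trivialisation in coordinates. -/

section Action

variable {E : Type*} [NormedAddCommGroup E] [NormedSpace ℝ E]
  {F : Type*} [NormedAddCommGroup F] [NormedSpace ℝ F]
  {G : Type*} [TopologicalSpace G] [ChartedSpace E G] [Group G] [LieGroup 𝓘(ℝ, E) ∞ G]
  {N : Type*} [TopologicalSpace N] [ChartedSpace F N] [IsManifold 𝓘(ℝ, F) ∞ N]
  [MulAction G N] [ContMDiffSMul 𝓘(ℝ, E) 𝓘(ℝ, F) ∞ G N]
  {P : Type*} [NormedAddCommGroup P] [NormedSpace ℝ P]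

variable (E) in
theorem contMDiffAt_smul {n : ℕ∞ω} (hn : n ≤ ∞) {Γ : P → G} {H : P → N} {p : P}
    (hΓ : ContMDiffAt 𝓘(ℝ, P) 𝓘(ℝ, E) n Γ p) (hH : ContMDiffAt 𝓘(ℝ, P) 𝓘(ℝ, F) n H p) :
    ContMDiffAt 𝓘(ℝ, P) 𝓘(ℝ, F) n (fun q => Γ q • H q) p := by
  have : ContMDiffSMul 𝓘(ℝ, E) 𝓘(ℝ, F) n G N := ContMDiffSMul.of_le hn
  exact hΓ.smul hH

variable (E F) in
theorem mdifferentiable_smul :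
    MDifferentiable (𝓘(ℝ, E).prod 𝓘(ℝ, F)) 𝓘(ℝ, F) (fun p : G × N => p.1 • p.2) :=
  (ContMDiffSMul.contMDiff_smul (n := ∞)).mdifferentiable (by simp)

variable (E F) in
theorem mdifferentiable_smul_const (y : N) :
    MDifferentiable 𝓘(ℝ, E) 𝓘(ℝ, F) (fun k : G => k • y) :=
  (contMDiff_id.smul (I := 𝓘(ℝ, E)) (I' := 𝓘(ℝ, F)) (n := ∞)
    (contMDiff_const (c := y))).mdifferentiable (by simp)

variable (E) in
theorem mdifferentiable_mul_const (k : G) :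
    MDifferentiable 𝓘(ℝ, E) 𝓘(ℝ, E) (fun h : G => h * k) :=
  (contMDiff_mul_right (I := 𝓘(ℝ, E)) (n := ∞)).mdifferentiable (by simp)

theorem coordAct_eq_fderiv {e : OpenPartialHomeomorph N F}
    (he : e ∈ IsManifold.maximalAtlas 𝓘(ℝ, F) ∞ N) {x : F} (hx : x ∈ e.target) :
    coordAct E G e x =
      fderiv ℝ (fun k : E => e ((chartAt E (1 : G)).symm k • e.symm x)) (chartAt E (1 : G) 1) := by
  have h : MDifferentiableAt 𝓘(ℝ, E) 𝓘(ℝ, F) (fun h : G => e (h • e.symm x)) 1 := by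
    have h1 : (1 : G) • e.symm x ∈ e.source := by rw [one_smul]; exact e.map_target hx
    exact ((mdifferentiable_of_mem_maximalAtlas he).mdifferentiableAt h1).comp (1 : G)
      (mdifferentiable_smul_const E F (e.symm x) 1)
  rw [coordAct, h.mfderiv]
  simp only [mfld_simps, fderivWithin_univ]
  rfl

/-- The infinitesimal action is a partial derivative, in the group variable at the identity, of the
`C^2` chart expression of the action, so it keeps one order of regularity in the point. -/
theorem contDiffAt_coordAct {e : OpenPartialHomeomorph N F}
    (he : e ∈ IsManifold.maximalAtlas 𝓘(ℝ, F) ∞ N) {x : F} (hx : x ∈ e.target) :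
    ContDiffAt ℝ 1 (fun y => coordAct E G e y) x := by
  set φ := chartAt E (1 : G)
  have hφ : φ ∈ IsManifold.maximalAtlas 𝓘(ℝ, E) ∞ G := IsManifold.chart_mem_maximalAtlas 1
  have h1 : ContMDiffAt 𝓘(ℝ, F × E) 𝓘(ℝ, F) 2
      (fun p : F × E => φ.symm p.2 • e.symm p.1) (x, φ 1) := by
    refine contMDiffAt_smul E two_le_infty ?_ ?_
    · exact ((contMDiffAt_symm_of_mem_maximalAtlas hφ (φ.map_source (mem_chart_source E 1))).of_le
        two_le_infty).comp (x, φ 1) contDiff_snd.contMDiff.contMDiffAt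
    · exact ((contMDiffAt_symm_of_mem_maximalAtlas he hx).of_le
        two_le_infty).comp (x, φ 1) contDiff_fst.contMDiff.contMDiffAt
  have h2 := contDiffAt_chart_comp he two_le_infty h1 (by
    simp only
    rw [φ.left_inv (mem_chart_source E 1), one_smul]
    exact e.map_target hx)
  refine (ContDiffAt.fderiv (f := fun y k => e (φ.symm k • e.symm y)) (g := fun _ => φ 1) h2
    contDiffAt_const (m := 1) (by norm_num)).congr_of_eventuallyEq ?_
  filter_upwards [e.open_target.mem_nhds hx] with y hy
  exact coordAct_eq_fderiv he hy

/-- Derivative of `q ↦ κ q • y` where `κ` passes through `1`. -/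
theorem fderiv_smul_const_of_eq_one {e : OpenPartialHomeomorph N F}
    (he : e ∈ IsManifold.maximalAtlas 𝓘(ℝ, F) ∞ N) {y : N} (hy : y ∈ e.source) {κ : P → G} {p : P}
    (hκ : MDifferentiableAt 𝓘(ℝ, P) 𝓘(ℝ, E) κ p) (hp : κ p = 1) (d : P) :
    fderiv ℝ (fun q => e (κ q • y)) p d = coordAct E G e (e y) (vecPart (dirLift κ d p)) := by
  have h1 : (1 : G) • y ∈ e.source := by rwa [one_smul]
  have h := mfderiv_comp_apply_of_eq p (((mdifferentiable_of_mem_maximalAtlas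
    he).mdifferentiableAt h1).comp (1 : G) (mdifferentiable_smul_const E F y 1)) hκ hp d
  rw [← mfderiv_eq_fderiv, coordAct, e.left_inv hy]
  exact h

/-- By the chain rule, trivialising a velocity of `Γ` amounts to translating `Γ` itself so that it
passes through the identity at `p`. -/
theorem rightTriv_dirLift {Γ : P → G} {p : P}
    (hΓ : MDifferentiableAt 𝓘(ℝ, P) 𝓘(ℝ, E) Γ p) (d : P) :
    rightTriv (dirLift Γ d p) = vecPart (dirLift (E := E) (fun q => Γ q * (Γ p)⁻¹) d p) :=
  (mfderiv_comp_apply p (mdifferentiable_mul_const E (Γ p)⁻¹ (Γ p)) hΓ d).symm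

/-- The base point is only propositionally equal to `x`; keeping the equation as a hypothesis makes
the lemma applicable to products such as `Γ p * (Γ p)⁻¹`. -/
theorem fibreCoord_chartAt_of_eq {M : Type*} [TopologicalSpace M] [ChartedSpace E M]
    [IsManifold 𝓘(ℝ, E) ∞ M] (X : TangentBundle 𝓘(ℝ, E) M) {x : M} (h : X.1 = x) :
    fibreCoord (chartAt E x) X = vecPart X := by
  subst h
  exact fibreCoord_chartAt_self X.1 (vecPart X)

theorem mdifferentiableAt_mul_const {Γ : P → G} {p : P}
    (hΓ : MDifferentiableAt 𝓘(ℝ, P) 𝓘(ℝ, E) Γ p) (k : G) :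
    MDifferentiableAt 𝓘(ℝ, P) 𝓘(ℝ, E) (fun q => Γ q * k) p :=
  (mdifferentiable_mul_const E k (Γ p)).comp p hΓ

theorem rightTriv_dirLift_eq_fderiv {Γ : P → G} {p : P}
    (hΓ : MDifferentiableAt 𝓘(ℝ, P) 𝓘(ℝ, E) Γ p) (d : P) :
    rightTriv (dirLift (E := E) Γ d p) =
      fderiv ℝ (fun q => chartAt E (1 : G) (Γ q * (Γ p)⁻¹)) p d := by
  have h1 : Γ p * (Γ p)⁻¹ = 1 := mul_inv_cancel _
  rw [rightTriv_dirLift hΓ, ← fibreCoord_dirLift (IsManifold.chart_mem_maximalAtlas 1)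
    (mdifferentiableAt_mul_const hΓ _) (by rw [h1]; exact mem_chart_source E 1)]
  exact (fibreCoord_chartAt_of_eq (dirLift (fun q => Γ q * (Γ p)⁻¹) d p) h1).symm

/-- The translated curve depends on its centre. Regard `Γ r * (Γ q)⁻¹` as a `C^2` function of both
`q` and `r`, and differentiate in `r` on the diagonal. -/
theorem contDiffAt_rightTriv_dirLift {Γ : P → G} {p : P}
    (hΓ : ContMDiffAt 𝓘(ℝ, P) 𝓘(ℝ, E) 2 Γ p) (d : P) :
    ContDiffAt ℝ 1 (fun q => rightTriv (dirLift (E := E) Γ d q)) p := by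
  have : LieGroup 𝓘(ℝ, E) 2 G := LieGroup.of_le two_le_infty
  have h1 : ContMDiffAt 𝓘(ℝ, P × P) 𝓘(ℝ, E) 2 (fun q : P × P => Γ q.2 * (Γ q.1)⁻¹) (p, p) := by
    refine ContMDiffAt.mul ?_ (ContMDiffAt.inv ?_)
    · exact ContMDiffAt.comp (p, p) (g := Γ) (f := fun q : P × P => q.2) hΓ
        contDiff_snd.contMDiff.contMDiffAt
    · exact ContMDiffAt.comp (p, p) (g := Γ) (f := fun q : P × P => q.1) hΓ
        contDiff_fst.contMDiff.contMDiffAt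
  have h2 := contDiffAt_chart_comp (e := chartAt E (1 : G)) (IsManifold.chart_mem_maximalAtlas 1)
    two_le_infty h1 (by simp only [mul_inv_cancel]; exact mem_chart_source E 1)
  have h3 := ContDiffAt.fderiv (f := fun q r => chartAt E (1 : G) (Γ r * (Γ q)⁻¹)) (g := id) h2
    contDiffAt_id (m := 1) (by norm_num)
  refine (h3.clm_apply (contDiffAt_const (c := d))).congr_of_eventuallyEq ?_
  filter_upwards [eventually_mdifferentiableAt hΓ (by simp) two_lt_infty] with q hq
  exact rightTriv_dirLift_eq_fderiv hq d

/-- Derivative of `Γ • H` in a chart. -/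
theorem fderiv_smul {e : OpenPartialHomeomorph N F}
    (he : e ∈ IsManifold.maximalAtlas 𝓘(ℝ, F) ∞ N) {Γ : P → G} {H : P → N} {p : P}
    (hΓ : MDifferentiableAt 𝓘(ℝ, P) 𝓘(ℝ, E) Γ p) (hH : MDifferentiableAt 𝓘(ℝ, P) 𝓘(ℝ, F) H p)
    (hp : Γ p • H p ∈ e.source) (d : P) :
    fderiv ℝ (fun q => e (Γ q • H q)) p d =
      coordAct E G e (e (Γ p • H p)) (rightTriv (dirLift Γ d p)) +
        fibreCoord e (tangentMap 𝓘(ℝ, F) 𝓘(ℝ, F) (fun y : N => Γ p • y) (dirLift H d p)) := by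
  have hm : DifferentiableAt ℝ (fun q : P × P => e (Γ q.1 • H q.2)) (p, p) := by
    refine MDifferentiableAt.differentiableAt ?_
    have h1 : MDifferentiableAt 𝓘(ℝ, P × P) (𝓘(ℝ, E).prod 𝓘(ℝ, F))
        (fun q : P × P => (Γ q.1, H q.2)) (p, p) :=
      (MDifferentiableAt.comp (p, p) (g := Γ) (f := fun q : P × P => q.1) hΓ
        differentiableAt_fst.mdifferentiableAt).prodMk
        (MDifferentiableAt.comp (p, p) (g := H) (f := fun q : P × P => q.2) hH
          differentiableAt_snd.mdifferentiableAt)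
    have h2 := (mdifferentiable_smul E F (Γ p, H p)).comp (p, p) h1
    exact ((mdifferentiable_of_mem_maximalAtlas he).mdifferentiableAt hp).comp (p, p) h2
  rw [fderiv_diag (f := fun q : P × P => e (Γ q.1 • H q.2)) hm]
  -- Freezing `H`, the group slot is `(Γ q * (Γ p)⁻¹) • (Γ p • H p)`, a motion through the identity
  -- at `Γ p • H p`; freezing `Γ` leaves the translated velocity of `H`.
  congr 1
  · rw [rightTriv_dirLift hΓ, ← fderiv_smul_const_of_eq_one he hp
      (mdifferentiableAt_mul_const hΓ _) (mul_inv_cancel _)]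
    simp only [mul_smul, inv_smul_smul]
  · rw [tangentMap_smul_dirLift E _ hH]
    exact (fibreCoord_dirLift he (Γ := fun q => Γ p • H q)
      ((mdifferentiable_const_smul E F (Γ p) (H p)).comp p hH) hp d).symm

end Action

/-! ### The Lie bracket and the structure equations. -/

section Bracket

variable {E : Type*} [NormedAddCommGroup E] [NormedSpace ℝ E]
  {F : Type*} [NormedAddCommGroup F] [NormedSpace ℝ F]
  {G : Type*} [TopologicalSpace G] [ChartedSpace E G] [Group G] [LieGroup 𝓘(ℝ, E) ∞ G]
  {N : Type*} [TopologicalSpace N] [ChartedSpace F N] [IsManifold 𝓘(ℝ, F) ∞ N]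
  [MulAction G N] [ContMDiffSMul 𝓘(ℝ, E) 𝓘(ℝ, F) ∞ G N]
  {P : Type*} [NormedAddCommGroup P] [NormedSpace ℝ P]

/-- For `G` acting on itself by left multiplication, the infinitesimal action at the identity is the
identity map. Hence a relation between infinitesimal actions at that point is a relation in the Lie
algebra. -/
theorem coordAct_chartAt_one (v : E) :
    coordAct E G (chartAt E (1 : G)) (chartAt E (1 : G) 1) v = v := by
  rw [coordAct, (chartAt E (1 : G)).left_inv (mem_chart_source E 1)]
  have h : (fun h : G => chartAt E (1 : G) (h • (1 : G))) = chartAt E (1 : G) := by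
    simp only [smul_eq_mul, mul_one]
  rw [h]
  exact mfderiv_chartAt_self (1 : G) v

/-- The left side is the left-invariant field generated by `v`, pulled back to the chart at the
identity; the right side differentiates multiplication in its second factor. -/
theorem fderiv_chartAt_one_mul {z : E} (hz : z ∈ (chartAt E (1 : G)).target) (v : E) :
    VectorField.mpullbackWithin 𝓘(ℝ, E) 𝓘(ℝ, E) (extChartAt 𝓘(ℝ, E) (1 : G)).symm
        (mulInvariantVectorField (I := 𝓘(ℝ, E)) (G := G) v) (range 𝓘(ℝ, E)) z =
      fderiv ℝ (fun k : E => chartAt E (1 : G)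
        ((chartAt E (1 : G)).symm z * (chartAt E (1 : G)).symm k)) (chartAt E (1 : G) 1) v := by
  set φ := chartAt E (1 : G) with hφ
  have hφm := mdifferentiable_of_mem_maximalAtlas
    (IsManifold.chart_mem_maximalAtlas (I := 𝓘(ℝ, E)) (n := ∞) (1 : G))
  have hs : φ.symm z ∈ φ.source := φ.map_target hz
  have hinv : (mfderiv 𝓘(ℝ, E) 𝓘(ℝ, E) φ.symm z).inverse =
      mfderiv 𝓘(ℝ, E) 𝓘(ℝ, E) φ (φ.symm z) := by
    refine ContinuousLinearMap.inverse_eq ?_ ?_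
    · have := hφm.symm_comp_deriv hs
      rw [← hφ, φ.right_inv hz] at this
      exact this
    · exact hφm.comp_symm_deriv hz
  have hL : MDifferentiableAt 𝓘(ℝ, E) 𝓘(ℝ, E) (fun k : G => φ.symm z * k) 1 :=
    (contMDiff_mul_left (I := 𝓘(ℝ, E)) (n := ∞)).mdifferentiable (by simp) 1
  have hc := mfderiv_comp_apply_of_eq (1 : G) (hφm.mdifferentiableAt hs) hL (mul_one _) v
  have hd : MDifferentiableAt 𝓘(ℝ, E) 𝓘(ℝ, E) (fun k : G => φ (φ.symm z * k)) 1 :=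
    MDifferentiableAt.comp (1 : G) (g := φ)
      (hφm.mdifferentiableAt (by rw [mul_one]; exact hs)) hL
  rw [VectorField.mpullbackWithin_apply]
  simp only [mfld_simps, mfderivWithin_univ]
  refine (DFunLike.congr_fun hinv _).trans (hc.symm.trans ?_)
  change mfderiv 𝓘(ℝ, E) 𝓘(ℝ, E) (fun k : G => φ (φ.symm z * k)) 1 v = _
  rw [hd.mfderiv]
  simp only [mfld_simps, fderivWithin_univ]
  rfl

theorem contDiffAt_chart_mul :
    ContDiffAt ℝ 2 (fun p : E × E => chartAt E (1 : G)
      ((chartAt E (1 : G)).symm p.1 * (chartAt E (1 : G)).symm p.2))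
      (chartAt E (1 : G) 1, chartAt E (1 : G) 1) := by
  set φ := chartAt E (1 : G) with hφ
  have : LieGroup 𝓘(ℝ, E) 2 G := LieGroup.of_le two_le_infty
  have hφa : φ ∈ IsManifold.maximalAtlas 𝓘(ℝ, E) ∞ G := IsManifold.chart_mem_maximalAtlas 1
  have hs : ContMDiffAt 𝓘(ℝ, E) 𝓘(ℝ, E) 2 φ.symm (φ 1) :=
    (contMDiffAt_symm_of_mem_maximalAtlas hφa (φ.map_source (mem_chart_source E 1))).of_le
      two_le_infty
  have h1 : ContMDiffAt 𝓘(ℝ, E × E) 𝓘(ℝ, E) 2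
      (fun p : E × E => φ.symm p.1 * φ.symm p.2) (φ 1, φ 1) :=
    (hs.comp (φ 1, φ 1) contDiff_fst.contMDiff.contMDiffAt).mul
      (hs.comp (φ 1, φ 1) contDiff_snd.contMDiff.contMDiffAt)
  refine contDiffAt_chart_comp hφa two_le_infty h1 ?_
  simp only
  rw [φ.left_inv (mem_chart_source E 1), mul_one]
  exact mem_chart_source E 1

theorem coordActT_apply {e : OpenPartialHomeomorph N F}
    (he : e ∈ IsManifold.maximalAtlas 𝓘(ℝ, F) ∞ N) {x : F} (hx : x ∈ e.target) (w : F) (u : E) :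
    coordActT E G e x w u = fderiv ℝ (fun y => coordAct E G e y u) x w := by
  have h := (contDiffAt_coordAct (G := G) (E := E) he hx).differentiableAt (by norm_num)
  rw [coordActT, fderiv_clm_apply h (differentiableAt_const u)]
  simp

/-- The bracket is the Lie bracket of left-invariant fields, that is, the antisymmetrised mixed
derivative of multiplication at the identity. Interchanging the two partial derivatives turns it
into derivatives of the infinitesimal left action, the form in which it appears in variations. -/
theorem lieAd_eq (u w : E) :
    lieAd G u w = coordActT E G (chartAt E (1 : G)) (chartAt E (1 : G) 1) w u
      - coordActT E G (chartAt E (1 : G)) (chartAt E (1 : G) 1) u w := by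
  set φ := chartAt E (1 : G) with hφ
  have hφa : φ ∈ IsManifold.maximalAtlas 𝓘(ℝ, E) ∞ G := IsManifold.chart_mem_maximalAtlas 1
  have ht : φ 1 ∈ φ.target := φ.map_source (mem_chart_source E 1)
  let V : E → E → E := fun v => VectorField.mpullbackWithin 𝓘(ℝ, E) 𝓘(ℝ, E)
      (extChartAt 𝓘(ℝ, E) (1 : G)).symm
      (mulInvariantVectorField (I := 𝓘(ℝ, E)) (G := G) v) (range 𝓘(ℝ, E))
  have hev : ∀ v : E, V v =ᶠ[𝓝 (φ 1)]
      fun z => fderiv ℝ (fun k : E => φ (φ.symm z * φ.symm k)) (φ 1) v := fun v => by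
    filter_upwards [φ.open_target.mem_nhds ht] with z hz
    exact fderiv_chartAt_one_mul hz v
  have hval : ∀ v : E, fderiv ℝ (fun k : E => φ (φ.symm (φ 1) * φ.symm k)) (φ 1) v = v := by
    intro v
    have : (fun k : E => φ (φ.symm (φ 1) * φ.symm k)) =ᶠ[𝓝 (φ 1)] id := by
      filter_upwards [φ.open_target.mem_nhds ht] with k hk
      rw [φ.left_inv (mem_chart_source E 1), one_mul, φ.right_inv hk, id]
    rw [this.fderiv_eq, fderiv_id]
    rfl
  have hT : ∀ v v' : E, coordActT E G φ (φ 1) v v' =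
      fderiv ℝ (fun z => fderiv ℝ (fun k : E => φ (φ.symm z * φ.symm k)) (φ 1) v) (φ 1) v' := by
    intro v v'
    rw [coordActT_apply hφa ht, fderiv_partial_comm (f := fun p : E × E => φ (φ.symm p.1 *
      φ.symm p.2)) contDiffAt_chart_mul]
    refine congrArg (fun T : E →L[ℝ] E => T v) (EventuallyEq.fderiv_eq ?_)
    filter_upwards [φ.open_target.mem_nhds ht] with y hy
    rw [coordAct_eq_fderiv hφa hy]
    rfl
  rw [hT, hT]
  -- The bracket of fields on `G` is defined through the preferred chart, whose derivative at its
  -- centre is the identity, so no correction arises in passing to coordinates.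
  have hI : ∀ z : E, ((mfderiv 𝓘(ℝ, E) 𝓘(ℝ, E) (extChartAt 𝓘(ℝ, E) (1 : G)) 1).inverse z : E) = z :=
    fun z => (congrArg (fun T : E →L[ℝ] E => T.inverse z)
      (mfderiv_extChartAt_self (I := 𝓘(ℝ, E)) (x := (1 : G)))).trans
      (congrArg (fun T : E →L[ℝ] E => T z) ContinuousLinearMap.inverse_id)
  have h0 : lieAd G u w = VectorField.lieBracketWithin ℝ (V u) (V w)
      ((extChartAt 𝓘(ℝ, E) (1 : G)).symm ⁻¹' univ ∩ range 𝓘(ℝ, E)) (φ 1) := hI _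
  rw [h0, preimage_univ, univ_inter, modelWithCornersSelf_coe, range_id,
    VectorField.lieBracketWithin_univ, VectorField.lieBracket,
    (hev u).self_of_nhds.trans (hval u), (hev w).self_of_nhds.trans (hval w),
    (hev u).fderiv_eq, (hev w).fderiv_eq]

theorem lieAd_swap (u w : E) : lieAd G u w = -lieAd G w u := by
  rw [lieAd_eq, lieAd_eq, neg_sub]

/-- Structure equation of the right trivialisation, for the infinitesimal action of `G` on `N`. -/
theorem coordAct_fderiv_rightTriv_sub {e : OpenPartialHomeomorph N F}
    (he : e ∈ IsManifold.maximalAtlas 𝓘(ℝ, F) ∞ N) {Γ : P → G} {p : P}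
    (hΓ : ContMDiffAt 𝓘(ℝ, P) 𝓘(ℝ, E) 2 Γ p) {n : N} (hn : n ∈ e.source) (d₁ d₂ : P) :
    coordAct E G e (e n) (fderiv ℝ (fun q => rightTriv (dirLift (E := E) Γ d₁ q)) p d₂ -
        fderiv ℝ (fun q => rightTriv (dirLift (E := E) Γ d₂ q)) p d₁) =
      coordActT E G e (e n) (coordAct E G e (e n) (rightTriv (dirLift Γ d₁ p)))
          (rightTriv (dirLift Γ d₂ p)) -
        coordActT E G e (e n) (coordAct E G e (e n) (rightTriv (dirLift Γ d₂ p)))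
          (rightTriv (dirLift Γ d₁ p)) := by
  -- The orbit map `q ↦ Γ q • y` passes through `n` at `p`, and its derivative is purely an
  -- infinitesimal action. Symmetry of its second derivative, with the `v` terms zero, is the claim.
  set y : N := (Γ p)⁻¹ • n with hy
  have hpy : Γ p • y = n := smul_inv_smul _ _
  have hc : ContMDiffAt 𝓘(ℝ, P) 𝓘(ℝ, F) 2 (fun q => Γ q • y) p :=
    contMDiffAt_smul E two_le_infty hΓ contMDiffAt_const
  have hs : Γ p • y ∈ e.source := by rwa [hpy]
  have hF : ∀ d, ∀ᶠ q in 𝓝 p, fderiv ℝ (fun q => e (Γ q • y)) q d =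
      coordAct E G e (e (Γ q • y)) (rightTriv (dirLift Γ d q)) + (0 : P → F) q := by
    intro d
    filter_upwards [eventually_mem_source hc.continuousAt hs,
      eventually_mdifferentiableAt hΓ (by simp) two_lt_infty] with q hq hq'
    rw [fderiv_smul he (H := fun _ => y) hq' mdifferentiableAt_const hq d,
      tangentMap_smul_dirLift E _ mdifferentiableAt_const,
      fibreCoord_dirLift he mdifferentiableAt_const hq]
    simp
  have hT := fun d => (contDiffAt_rightTriv_dirLift hΓ d).differentiableAt (by norm_num)
  have hA := (contDiffAt_coordAct (E := E) (G := G) he (e.map_source hs)).differentiableAt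
    (by norm_num)
  have h := fderiv_sub_fderiv_of_fderiv_eq (contDiffAt_chart_comp he two_le_infty hc hs) hA
    (hT d₁) (hT d₂) (differentiableAt_const 0) (differentiableAt_const 0) (hF d₁) (hF d₂)
  simp only [hpy, add_zero] at h
  rw [← sub_eq_zero, ← neg_eq_zero, coordActT, neg_sub, ← h]
  simp

/-- Structure equation of the right trivialisation. -/
theorem fderiv_rightTriv_sub {Γ : P → G} {p : P}
    (hΓ : ContMDiffAt 𝓘(ℝ, P) 𝓘(ℝ, E) 2 Γ p) (d₁ d₂ : P) :
    fderiv ℝ (fun q => rightTriv (dirLift (E := E) Γ d₁ q)) p d₂ -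
        fderiv ℝ (fun q => rightTriv (dirLift (E := E) Γ d₂ q)) p d₁ =
      lieAd G (rightTriv (dirLift (E := E) Γ d₂ p)) (rightTriv (dirLift (E := E) Γ d₁ p)) := by
  -- Apply the action version to `G` acting on itself, at the identity, where the infinitesimal
  -- action can be stripped off.
  have h := coordAct_fderiv_rightTriv_sub (N := G) (IsManifold.chart_mem_maximalAtlas (1 : G)) hΓ
    (mem_chart_source E (1 : G)) d₁ d₂
  simp only [coordAct_chartAt_one] at h
  rw [h, lieAd_eq]

/-- The curve of fibre components of `Γ • ∂H` in a chart is `C^1`. -/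
theorem contDiffAt_fibreCoord_smul {e : OpenPartialHomeomorph N F}
    (he : e ∈ IsManifold.maximalAtlas 𝓘(ℝ, F) ∞ N) {Γ : P → G} {H : P → N} {p : P}
    (hΓ : ContMDiffAt 𝓘(ℝ, P) 𝓘(ℝ, E) 2 Γ p) (hH : ContMDiffAt 𝓘(ℝ, P) 𝓘(ℝ, F) 2 H p)
    (hp : Γ p • H p ∈ e.source) (d : P) :
    ContDiffAt ℝ 1 (fun q => fibreCoord e
      (tangentMap 𝓘(ℝ, F) 𝓘(ℝ, F) (fun y : N => Γ q • y) (dirLift H d q))) p := by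
  have hc : ContMDiffAt 𝓘(ℝ, P) 𝓘(ℝ, F) 2 (fun q => Γ q • H q) p :=
    contMDiffAt_smul E two_le_infty hΓ hH
  have hx := contDiffAt_chart_comp he two_le_infty hc hp
  have hA := contDiffAt_coordAct (E := E) (G := G) he (e.map_source hp)
  refine (((hx.fderiv_right (m := 1) (by norm_num)).clm_apply (contDiffAt_const (c := d))).sub
    ((hA.comp p (hx.of_le (by norm_num))).clm_apply
      (contDiffAt_rightTriv_dirLift hΓ d))).congr_of_eventuallyEq ?_
  filter_upwards [eventually_mem_source hc.continuousAt hp,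
    eventually_mdifferentiableAt hΓ (by simp) two_lt_infty,
    eventually_mdifferentiableAt hH (by simp) two_lt_infty] with q hq hq' hq''
  rw [fderiv_smul he hq' hq'' hq d]
  simp

theorem contMDiffAt_tangentMap_smul {Γ : P → G} {H : P → N} {p : P}
    (hΓ : ContMDiffAt 𝓘(ℝ, P) 𝓘(ℝ, E) 2 Γ p) (hH : ContMDiffAt 𝓘(ℝ, P) 𝓘(ℝ, F) 2 H p) (d : P) :
    ContMDiffAt 𝓘(ℝ, P) 𝓘(ℝ, F).tangent 1
      (fun q => tangentMap 𝓘(ℝ, F) 𝓘(ℝ, F) (fun y : N => Γ q • y) (dirLift H d q)) p := by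
  obtain ⟨he, hp⟩ : IsChartAround (chartAt F (Γ p • H p)) (Γ p • H p) := isChartAround_chartAt _
  have hc : ContMDiffAt 𝓘(ℝ, P) 𝓘(ℝ, F) 2 (fun q => Γ q • H q) p :=
    contMDiffAt_smul E two_le_infty hΓ hH
  refine (contMDiffAt_ofCoord_comp he one_le_infty
    ((contDiffAt_chart_comp he two_le_infty hc hp).of_le (by norm_num))
    (contDiffAt_fibreCoord_smul he hΓ hH hp d)
    ((chartAt F (Γ p • H p)).map_source hp)).congr_of_eventuallyEq ?_
  filter_upwards [eventually_mem_source hc.continuousAt hp] with q hq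
  exact (ofCoord_fibreCoord he _ hq).symm

/-- Structure equation for `Γ • ∂H` in a chart. -/
theorem fderiv_fibreCoord_smul_sub {e : OpenPartialHomeomorph N F}
    (he : e ∈ IsManifold.maximalAtlas 𝓘(ℝ, F) ∞ N) {Γ : P → G} {H : P → N} {p : P}
    (hΓ : ContMDiffAt 𝓘(ℝ, P) 𝓘(ℝ, E) 2 Γ p) (hH : ContMDiffAt 𝓘(ℝ, P) 𝓘(ℝ, F) 2 H p)
    (hp : Γ p • H p ∈ e.source) (d₁ d₂ : P) :
    let v := fun d q => fibreCoord e
      (tangentMap 𝓘(ℝ, F) 𝓘(ℝ, F) (fun y : N => Γ q • y) (dirLift H d q))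
    fderiv ℝ (v d₁) p d₂ - fderiv ℝ (v d₂) p d₁ =
      coordActT E G e (e (Γ p • H p)) (v d₁ p) (rightTriv (dirLift Γ d₂ p)) -
        coordActT E G e (e (Γ p • H p)) (v d₂ p) (rightTriv (dirLift Γ d₁ p)) := by
  intro v
  have hc : ContMDiffAt 𝓘(ℝ, P) 𝓘(ℝ, F) 2 (fun q => Γ q • H q) p :=
    contMDiffAt_smul E two_le_infty hΓ hH
  have hF : ∀ d, ∀ᶠ q in 𝓝 p, fderiv ℝ (fun q => e (Γ q • H q)) q d =
      coordAct E G e (e (Γ q • H q)) (rightTriv (dirLift Γ d q)) + v d q := by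
    intro d
    filter_upwards [eventually_mem_source hc.continuousAt hp,
      eventually_mdifferentiableAt hΓ (by simp) two_lt_infty,
      eventually_mdifferentiableAt hH (by simp) two_lt_infty] with q hq hq' hq''
    exact fderiv_smul he hq' hq'' hq d
  have hT := fun d => (contDiffAt_rightTriv_dirLift hΓ d).differentiableAt (by norm_num)
  have hv : ∀ d, DifferentiableAt ℝ (v d) p := fun d =>
    (contDiffAt_fibreCoord_smul he hΓ hH hp d).differentiableAt (by norm_num)
  have hA := (contDiffAt_coordAct (E := E) (G := G) he (e.map_source hp)).differentiableAt
    (by norm_num)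
  -- The terms quadratic in the trivialised velocities of `Γ` cancel by the structure equation at
  -- the same point; only those involving `v` remain.
  rw [fderiv_sub_fderiv_of_fderiv_eq (contDiffAt_chart_comp he two_le_infty hc hp) hA
    (hT d₁) (hT d₂) (hv d₁) (hv d₂) (hF d₁) (hF d₂), coordAct_fderiv_rightTriv_sub he hΓ hp]
  simp only [coordActT, map_add, add_apply]
  abel

end Bracket

/-! ### Functions of `(ε, t)` and differentiation under the integral. -/

section TwoParameters

variable {F : Type*} [NormedAddCommGroup F] [NormedSpace ℝ F]

theorem hasDerivAt_slice_left {f : ℝ × ℝ → F} {s t : ℝ} (hf : DifferentiableAt ℝ f (s, t)) :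
    HasDerivAt (fun ε => f (ε, t)) (fderiv ℝ f (s, t) (1, 0)) s :=
  HasFDerivAt.comp_hasDerivAt s (f := fun ε => (ε, t)) hf.hasFDerivAt
    ((hasDerivAt_id s).prodMk (hasDerivAt_const s t))

theorem hasDerivAt_slice_right {f : ℝ × ℝ → F} {s t : ℝ} (hf : DifferentiableAt ℝ f (s, t)) :
    HasDerivAt (fun r => f (s, r)) (fderiv ℝ f (s, t) (0, 1)) t :=
  HasFDerivAt.comp_hasDerivAt t (f := fun r => (s, r)) hf.hasFDerivAt
    ((hasDerivAt_const t s).prodMk (hasDerivAt_id t))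

theorem continuousOn_fderiv_slice {f : ℝ × ℝ → F}
    (hf : ∀ t ∈ Icc (0 : ℝ) 1, ContDiffAt ℝ 1 f (0, t)) (d : ℝ × ℝ) :
    ContinuousOn (fun t => fderiv ℝ f (0, t) d) (Icc 0 1) := by
  intro t ht
  have h : ContinuousAt (fun t : ℝ => fderiv ℝ f (0, t)) t :=
    ContinuousAt.comp (g := fderiv ℝ f) (f := fun t : ℝ => ((0 : ℝ), t))
      ((hf t ht).continuousAt_fderiv (by norm_num)) (Continuous.prodMk_right 0).continuousAt
  exact (h.clm_apply continuousAt_const).continuousWithinAt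

/-- Differentiation under the integral sign for a function that is `C^1` near `{0} × [0,1]`. -/
theorem hasDerivAt_integral_of_contDiffAt [CompleteSpace F] {f : ℝ × ℝ → F}
    (hf : ∀ t ∈ Icc (0 : ℝ) 1, ContDiffAt ℝ 1 f (0, t)) :
    HasDerivAt (fun ε => ∫ t in (0 : ℝ)..1, f (ε, t))
      (∫ t in (0 : ℝ)..1, fderiv ℝ f (0, t) (1, 0)) 0 := by
  have hW : IsOpen {q : ℝ × ℝ | ContDiffAt ℝ 1 f q} := by
    rw [isOpen_iff_eventually]
    intro q hq
    exact ContDiffAt.eventually (n := 1) (show ContDiffAt ℝ 1 f q from hq) (by simp)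
  -- The hypothesis concerns `ε = 0` only. Being `C^1` is an open condition, so compactness of
  -- `[0,1]` gives one closed ball of `ε` valid for all times, and on the compact product the
  -- derivative is bounded.
  obtain ⟨u, v, hu, -, h0u, hv, huv⟩ := generalized_tube_lemma (isCompact_singleton (x := (0 : ℝ)))
    (isCompact_Icc (a := (0 : ℝ)) (b := 1)) hW (by
      rintro ⟨s, t⟩ ⟨hs, ht⟩
      rw [mem_singleton_iff] at hs
      subst hs
      exact hf t ht)
  obtain ⟨δ, hδ, hδu⟩ := Metric.nhds_basis_closedBall.mem_iff.1 (hu.mem_nhds (h0u rfl))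
  have hC : ∀ ε ∈ Metric.closedBall (0 : ℝ) δ, ∀ t ∈ Icc (0 : ℝ) 1, ContDiffAt ℝ 1 f (ε, t) :=
    fun ε hε t ht => huv ⟨hδu hε, hv ht⟩
  have hcont : ContinuousOn (fderiv ℝ f) (Metric.closedBall (0 : ℝ) δ ×ˢ Icc (0 : ℝ) 1) := by
    rintro ⟨ε, t⟩ ⟨hε, ht⟩
    exact ((hC ε hε t ht).continuousAt_fderiv (by norm_num)).continuousWithinAt
  obtain ⟨C, hCb⟩ := ((isCompact_closedBall (0 : ℝ) δ).prod isCompact_Icc).exists_bound_of_continuousOn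
    hcont
  have hI : uIoc (0 : ℝ) 1 ⊆ Icc 0 1 := by
    rw [uIoc_of_le zero_le_one]
    exact Ioc_subset_Icc_self
  have hslice : ∀ ε ∈ Metric.closedBall (0 : ℝ) δ, ContinuousOn (fun t => f (ε, t)) (Icc 0 1) :=
    fun ε hε t ht => ((hasDerivAt_slice_right
      ((hC ε hε t ht).differentiableAt (by norm_num))).continuousAt).continuousWithinAt
  have h0 : (0 : ℝ) ∈ Metric.closedBall (0 : ℝ) δ := Metric.mem_closedBall_self hδ.le
  refine (intervalIntegral.hasDerivAt_integral_of_dominated_loc_of_deriv_le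
    (F := fun ε t => f (ε, t)) (F' := fun ε t => fderiv ℝ f (ε, t) (1, 0))
    (bound := fun _ => C * ‖((1 : ℝ), (0 : ℝ))‖) (Metric.closedBall_mem_nhds 0 hδ)
    ?_ ?_ ?_ ?_ ?_ ?_).2
  · filter_upwards [Metric.closedBall_mem_nhds 0 hδ] with ε hε
    exact ((hslice ε hε).mono hI).aestronglyMeasurable measurableSet_uIoc
  · exact ContinuousOn.intervalIntegrable (by rw [uIcc_of_le zero_le_one]; exact hslice 0 h0)
  · exact ((continuousOn_fderiv_slice hf (1, 0)).mono hI).aestronglyMeasurable measurableSet_uIoc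
  · refine Eventually.of_forall fun t ht ε hε => ?_
    exact (ContinuousLinearMap.le_opNorm _ _).trans
      (mul_le_mul_of_nonneg_right (hCb (ε, t) ⟨hε, hI ht⟩) (norm_nonneg _))
  · exact intervalIntegrable_const
  · refine Eventually.of_forall fun t ht ε hε => ?_
    exact hasDerivAt_slice_left ((hC ε hε t (hI ht)).differentiableAt (by norm_num))

end TwoParameters

/-! ### From deformations to reduced variations, and invariance of `L`. -/

section Deformations

variable {E : Type*} [NormedAddCommGroup E] [NormedSpace ℝ E]
  {F : Type*} [NormedAddCommGroup F] [NormedSpace ℝ F]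
  {P : Type*} [NormedAddCommGroup P] [NormedSpace ℝ P]

theorem velocityLift_comp {M : Type*} [TopologicalSpace M] [ChartedSpace E M]
    {Γ : P → M} {f : ℝ → P} {d : P} {t : ℝ}
    (hΓ : MDifferentiableAt 𝓘(ℝ, P) 𝓘(ℝ, E) Γ (f t)) (hf : HasDerivAt f d t) :
    velocityLift (E := E) (fun s => Γ (f s)) t = dirLift Γ d (f t) := by
  refine Bundle.TotalSpace.ext rfl (heq_of_eq ?_)
  have h := mfderiv_comp_apply t hΓ hf.differentiableAt.mdifferentiableAt (1 : ℝ)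
  refine h.trans ?_
  rw [mfderiv_eq_fderiv]
  have : fderiv ℝ f t (1 : ℝ) = d := by rw [← hf.deriv]; simp
  exact congrArg (mfderiv 𝓘(ℝ, P) 𝓘(ℝ, E) Γ (f t)) this

theorem velocityLift_right {M : Type*} [TopologicalSpace M] [ChartedSpace E M]
    {Γ : ℝ × ℝ → M} {s t : ℝ} (hΓ : MDifferentiableAt 𝓘(ℝ, ℝ × ℝ) 𝓘(ℝ, E) Γ (s, t)) :
    velocityLift (E := E) (fun r => Γ (s, r)) t = dirLift Γ (0, 1) (s, t) :=
  velocityLift_comp (f := fun r => (s, r)) hΓ ((hasDerivAt_const t s).prodMk (hasDerivAt_id t))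

theorem velocityLift_left {M : Type*} [TopologicalSpace M] [ChartedSpace E M]
    {Γ : ℝ × ℝ → M} {s t : ℝ} (hΓ : MDifferentiableAt 𝓘(ℝ, ℝ × ℝ) 𝓘(ℝ, E) Γ (s, t)) :
    velocityLift (E := E) (fun r => Γ (r, t)) s = dirLift Γ (1, 0) (s, t) :=
  velocityLift_comp (f := fun r => (r, t)) hΓ ((hasDerivAt_id s).prodMk (hasDerivAt_const s t))

theorem eventually_slice_right {p : ℝ × ℝ → Prop} {s t : ℝ} (h : ∀ᶠ q in 𝓝 (s, t), p q) :
    ∀ᶠ r in 𝓝 t, p (s, r) :=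
  (Continuous.prodMk_right s).continuousAt.eventually h

theorem eventually_slice_left {p : ℝ × ℝ → Prop} {s t : ℝ} (h : ∀ᶠ q in 𝓝 (s, t), p q) :
    ∀ᶠ r in 𝓝 s, p (r, t) :=
  (Continuous.prodMk_left t).continuousAt.eventually h

variable
  {G : Type*} [TopologicalSpace G] [ChartedSpace E G] [Group G] [LieGroup 𝓘(ℝ, E) ∞ G]
  {N : Type*} [TopologicalSpace N] [ChartedSpace F N] [IsManifold 𝓘(ℝ, F) ∞ N]
  [MulAction G N] [ContMDiffSMul 𝓘(ℝ, E) 𝓘(ℝ, F) ∞ G N]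

/-- The variation `ξ = δg g⁻¹` of a deformation of `g`. -/
def xiCurve (γ : ℝ → ℝ → G) (t : ℝ) : E := rightTriv (E := E) (velocityLift (fun ε => γ ε t) 0)

/-- The variation `ϖ = g δη` of a deformation of `(g, η)`. -/
def varpiCurve (γ : ℝ → ℝ → G) (h : ℝ → ℝ → N) (t : ℝ) :
    TangentSpace 𝓘(ℝ, F) (nCurve (γ 0) (h 0) t) :=
  mfderiv 𝓘(ℝ, F) 𝓘(ℝ, F) (fun y : N => γ 0 t • y) (h 0 t)
    (mfderiv 𝓘(ℝ, ℝ) 𝓘(ℝ, F) (fun ε => h ε t) 0 (1 : ℝ))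

theorem mk_varpiCurve (γ : ℝ → ℝ → G) (h : ℝ → ℝ → N) (t : ℝ) :
    (⟨nCurve (γ 0) (h 0) t, varpiCurve γ h t⟩ : TangentBundle 𝓘(ℝ, F) N) =
      tangentMap 𝓘(ℝ, F) 𝓘(ℝ, F) (fun y : N => γ 0 t • y) (velocityLift (fun ε => h ε t) 0) := rfl

/-- A deformation of `(g, η)` induces a reduced variation of `(u, n, ν)`. -/
theorem IsDeformation.isReducedVariation {γ : ℝ → ℝ → G} {h : ℝ → ℝ → N}
    (hd : IsDeformation (E := E) (F := F) (γ 0) (h 0) γ h) :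
    IsReducedVariation (γ 0) (h 0) (fun ε => uCurve (E := E) (γ ε))
      (fun ε => nuCurve (F := F) (γ ε) (h ε)) (xiCurve γ) (varpiCurve γ h) := by
  set Γ : ℝ × ℝ → G := fun p => γ p.1 p.2 with hΓdef
  set H : ℝ × ℝ → N := fun p => h p.1 p.2 with hHdef
  have hΓ : ∀ t ∈ Icc (0 : ℝ) 1, ContMDiffAt 𝓘(ℝ, ℝ × ℝ) 𝓘(ℝ, E) 2 Γ (0, t) := hd.smooth_g
  have hH : ∀ t ∈ Icc (0 : ℝ) 1, ContMDiffAt 𝓘(ℝ, ℝ × ℝ) 𝓘(ℝ, F) 2 H (0, t) := hd.smooth_η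
  -- With `(0, 1)` the time direction and `(1, 0)` the direction of `ε`, `T` gives `u` and `ξ`, and
  -- `V` gives `ν` and `ϖ`; (V) is then the structure equation for these two directions.
  let T : ℝ × ℝ → ℝ × ℝ → E := fun d q => rightTriv (dirLift Γ d q)
  let V : ℝ × ℝ → ℝ × ℝ → TangentBundle 𝓘(ℝ, F) N := fun d q =>
    tangentMap 𝓘(ℝ, F) 𝓘(ℝ, F) (fun y : N => Γ q • y) (dirLift H d q)
  have evΓ : ∀ t ∈ Icc (0 : ℝ) 1, ∀ᶠ q in 𝓝 ((0 : ℝ), t), MDifferentiableAt 𝓘(ℝ, ℝ × ℝ) 𝓘(ℝ, E) Γ q :=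
    fun t ht => eventually_mdifferentiableAt (hΓ t ht) (by simp) two_lt_infty
  have evH : ∀ t ∈ Icc (0 : ℝ) 1, ∀ᶠ q in 𝓝 ((0 : ℝ), t), MDifferentiableAt 𝓘(ℝ, ℝ × ℝ) 𝓘(ℝ, F) H q :=
    fun t ht => eventually_mdifferentiableAt (hH t ht) (by simp) two_lt_infty
  have eU : ∀ t ∈ Icc (0 : ℝ) 1, (fun p : ℝ × ℝ => uCurve (E := E) (γ p.1) p.2) =ᶠ[𝓝 (0, t)]
      T (0, 1) := by
    intro t ht
    filter_upwards [evΓ t ht] with q hq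
    exact congrArg rightTriv (velocityLift_right (s := q.1) (t := q.2) hq)
  have eV : ∀ t ∈ Icc (0 : ℝ) 1, (fun p : ℝ × ℝ => nuCurve (F := F) (γ p.1) (h p.1) p.2) =ᶠ[𝓝 (0, t)]
      V (0, 1) := by
    intro t ht
    filter_upwards [evH t ht] with q hq
    exact congrArg (tangentMap 𝓘(ℝ, F) 𝓘(ℝ, F) (fun y : N => Γ q • y))
      (velocityLift_right (s := q.1) (t := q.2) hq)
  have eξ : ∀ t ∈ Icc (0 : ℝ) 1, xiCurve (E := E) γ =ᶠ[𝓝 t] fun s => T (1, 0) (0, s) := by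
    intro t ht
    filter_upwards [eventually_slice_right (evΓ t ht)] with s hs
    exact congrArg rightTriv (velocityLift_left hs)
  have eϖ : ∀ t ∈ Icc (0 : ℝ) 1, (fun s => (⟨nCurve (γ 0) (h 0) s, varpiCurve γ h s⟩ :
      TangentBundle 𝓘(ℝ, F) N)) =ᶠ[𝓝 t] fun s => V (1, 0) (0, s) := by
    intro t ht
    filter_upwards [eventually_slice_right (evH t ht)] with s hs
    rw [mk_varpiCurve]
    exact congrArg (tangentMap 𝓘(ℝ, F) 𝓘(ℝ, F) (fun y : N => Γ (0, s) • y)) (velocityLift_left hs)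
  have hT : ∀ t ∈ Icc (0 : ℝ) 1, ∀ d, ContDiffAt ℝ 1 (T d) (0, t) := fun t ht d =>
    contDiffAt_rightTriv_dirLift (hΓ t ht) d
  have hV : ∀ t ∈ Icc (0 : ℝ) 1, ∀ d, ContMDiffAt 𝓘(ℝ, ℝ × ℝ) 𝓘(ℝ, F).tangent 1 (V d) (0, t) :=
    fun t ht d => contMDiffAt_tangentMap_smul (hΓ t ht) (hH t ht) d
  have hr : ∀ t : ℝ, ContDiffAt ℝ 1 (fun s : ℝ => ((0 : ℝ), s)) t := fun t =>
    contDiffAt_const.prodMk contDiffAt_id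
  refine ⟨rfl, rfl, ?_, ?_, ?_, ?_, ?_, ?_, ?_⟩
  · intro t ht
    exact (hT t ht _).congr_of_eventuallyEq (eU t ht)
  · intro t ht
    exact (hV t ht _).congr_of_eventuallyEq (eV t ht)
  · intro t ht
    exact (ContDiffAt.comp t (g := T (1, 0)) (hT t ht _) (hr t)).congr_of_eventuallyEq (eξ t ht)
  · intro t ht
    exact (ContMDiffAt.comp t (g := V (1, 0)) (hV t ht _) (hr t).contMDiffAt).congr_of_eventuallyEq
      (eϖ t ht)
  · intro t ht
    have hd := fun d => (hT t ht d).differentiableAt (by norm_num)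
    have h1 := (hasDerivAt_slice_left (hd (0, 1))).congr_of_eventuallyEq
      (eventually_slice_left (eU t ht))
    convert! h1 using 1
    rw [(eξ t ht).deriv_eq, (hasDerivAt_slice_right (hd (1, 0))).deriv, (eξ t ht).self_of_nhds]
    have hu : uCurve (E := E) (γ 0) t = T (0, 1) (0, t) := (eU t ht).self_of_nhds
    rw [hu, lieAd_swap, ← fderiv_rightTriv_sub (hΓ t ht) (0, 1) (1, 0)]
    abel
  · intro t ht e he
    have hp : Γ (0, t) • H (0, t) ∈ e.source := he.2
    have hc := contDiffAt_chart_comp he.1 two_le_infty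
      (contMDiffAt_smul E two_le_infty (hΓ t ht) (hH t ht)) hp
    have h1 := hasDerivAt_slice_left (hc.differentiableAt (by norm_num))
    rw [fderiv_smul he.1 (evΓ t ht).self_of_nhds (evH t ht).self_of_nhds hp] at h1
    rw [(eξ t ht).self_of_nhds]
    have hw : (⟨nCurve (γ 0) (h 0) t, varpiCurve γ h t⟩ : TangentBundle 𝓘(ℝ, F) N) = V (1, 0) (0, t) :=
      (eϖ t ht).self_of_nhds
    rw [hw, add_comm]
    exact h1
  · intro t ht e he
    have hp : Γ (0, t) • H (0, t) ∈ e.source := he.2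
    have hd := fun d => (contDiffAt_fibreCoord_smul he.1 (hΓ t ht) (hH t ht) hp d).differentiableAt
      (by norm_num)
    have h1 := (hasDerivAt_slice_left (hd (0, 1))).congr_of_eventuallyEq
      (eventually_slice_left ((eV t ht).fun_comp (fibreCoord e)))
    have hw : (⟨nCurve (γ 0) (h 0) t, varpiCurve γ h t⟩ : TangentBundle 𝓘(ℝ, F) N) = V (1, 0) (0, t) :=
      (eϖ t ht).self_of_nhds
    have hν : nuCurve (F := F) (γ 0) (h 0) t = V (0, 1) (0, t) := (eV t ht).self_of_nhds
    have hu : uCurve (E := E) (γ 0) t = T (0, 1) (0, t) := (eU t ht).self_of_nhds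
    have h2 : deriv (fun s => fibreCoord e (⟨nCurve (γ 0) (h 0) s, varpiCurve γ h s⟩ :
        TangentBundle 𝓘(ℝ, F) N)) t = _ :=
      (((eϖ t ht).fun_comp (fibreCoord e)).deriv_eq).trans (hasDerivAt_slice_right (hd (1, 0))).deriv
    convert! h1 using 1
    rw [h2, hw, hν, hu, (eξ t ht).self_of_nhds]
    have h3 := fderiv_fibreCoord_smul_sub he.1 (hΓ t ht) (hH t ht) hp (0, 1) (1, 0)
    simp only at h3
    rw [add_sub_assoc]
    exact (eq_add_of_sub_eq' h3).symm

/-- Act by `h = g⁻¹`: the group point moves to the identity, while the action on `N` by `h⁻¹`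
becomes the action of `g`. -/
theorem apply_eq_reduced {L : TangentBundle 𝓘(ℝ, E) G × TangentBundle 𝓘(ℝ, F) N → ℝ}
    (hinv : RightInvariant L) (X : TangentBundle 𝓘(ℝ, E) G) (Y : TangentBundle 𝓘(ℝ, F) N) :
    L (X, Y) = reduced L (rightTriv X,
      tangentMap 𝓘(ℝ, F) 𝓘(ℝ, F) (fun y : N => X.1 • y) Y) := by
  rw [← hinv X.1⁻¹ X Y, reduced, inv_inv]
  have : tangentMap 𝓘(ℝ, E) 𝓘(ℝ, E) (fun g : G => g * X.1⁻¹) X = ⟨1, (rightTriv X : E)⟩ :=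
    Bundle.TotalSpace.ext (mul_inv_cancel X.1) HEq.rfl
  rw [this]

theorem action_eq_reducedAction {L : TangentBundle 𝓘(ℝ, E) G × TangentBundle 𝓘(ℝ, F) N → ℝ}
    (hinv : RightInvariant L) (g : ℝ → G) (η : ℝ → N) :
    action L g η = reducedAction (reduced L) (uCurve g) (nuCurve g η) := by
  simp only [action, reducedAction, apply_eq_reduced hinv]
  rfl

end Deformations

/-! ### First variation on one manifold with a time-dependent Lagrangian. -/

section Lagrangian

variable {E : Type*} [NormedAddCommGroup E] [NormedSpace ℝ E]
  {F : Type*} [NormedAddCommGroup F] [NormedSpace ℝ F]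

section OneFactor

variable {M : Type*} [TopologicalSpace M] [ChartedSpace E M] [IsManifold 𝓘(ℝ, E) ∞ M]
  {Z : Type*} [NormedAddCommGroup Z] [NormedSpace ℝ Z]

/-- The momentum `∂Λ/∂ẋ` along the curve `c` in the chart `e`. -/
def momentum (Λ : ℝ → TangentBundle 𝓘(ℝ, E) M → ℝ) (e : OpenPartialHomeomorph M E) (c : ℝ → M)
    (s : ℝ) : E →L[ℝ] ℝ :=
  fderiv ℝ (fun v : E => Λ s (ofCoord e (e (c s)) v)) (deriv (fun r => e (c r)) s)

/-- The force `∂Λ/∂x` along the curve `c` in the chart `e`. -/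
def force (Λ : ℝ → TangentBundle 𝓘(ℝ, E) M → ℝ) (e : OpenPartialHomeomorph M E) (c : ℝ → M)
    (s : ℝ) : E →L[ℝ] ℝ :=
  fderiv ℝ (fun x : E => Λ s (ofCoord e x (deriv (fun r => e (c r)) s))) (e (c s))

/-- The Euler-Lagrange covector `d/dt (∂Λ/∂ẋ) - ∂Λ/∂x` in the chart `e`. -/
def eulerLagrangeCovector (Λ : ℝ → TangentBundle 𝓘(ℝ, E) M → ℝ) (e : OpenPartialHomeomorph M E)
    (c : ℝ → M) (t : ℝ) : E →L[ℝ] ℝ :=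
  deriv (momentum Λ e c) t - force Λ e c t

variable {Λ : ℝ → TangentBundle 𝓘(ℝ, E) M → ℝ} {e : OpenPartialHomeomorph M E} {c : ℝ → M}
  {f : (E × E) × Z → ℝ} {z : ℝ → Z} {t : ℝ}

theorem contDiffAt_deriv_chart (he : IsChartAround e (c t))
    (hc : ContMDiffAt 𝓘(ℝ, ℝ) 𝓘(ℝ, E) 2 c t) :
    ContDiffAt ℝ 1 (deriv (fun r => e (c r))) t := by
  have h := contDiffAt_chart_comp he.1 two_le_infty hc he.2
  exact ((h.fderiv_right (m := 1) (by norm_num)).clm_apply (contDiffAt_const (c := (1 : ℝ))))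

/-- The data `f` and `z` describe how the other factor enters: `f` is the `C^2` chart expression of
the full Lagrangian, and `z` the `C^1` curve of coordinates of the other velocity. Time dependence
of `Λ` passes through `z` alone, so the momentum is `C^1` in time. -/
theorem momentum_eventuallyEq (he : IsChartAround e (c t))
    (hc : ContMDiffAt 𝓘(ℝ, ℝ) 𝓘(ℝ, E) 2 c t) (hz : ContDiffAt ℝ 1 z t)
    (hf : ContDiffAt ℝ 2 f ((e (c t), deriv (fun r => e (c r)) t), z t))
    (hΛ : ∀ᶠ s in 𝓝 t, ∀ x ∈ e.target, ∀ v, Λ s (ofCoord e x v) = f ((x, v), z s)) :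
    momentum Λ e c =ᶠ[𝓝 t] fun s =>
      (fderiv ℝ f ((e (c s), deriv (fun r => e (c r)) s), z s)).comp
        ((ContinuousLinearMap.inl ℝ (E × E) Z).comp (ContinuousLinearMap.inr ℝ E E)) := by
  have hx := contDiffAt_chart_comp he.1 two_le_infty hc he.2
  have hv := contDiffAt_deriv_chart he hc
  have hcont : ContinuousAt (fun s => ((e (c s), deriv (fun r => e (c r)) s), z s)) t :=
    (hx.continuousAt.prodMk hv.continuousAt).prodMk hz.continuousAt
  filter_upwards [hΛ, eventually_mem_source hc.continuousAt he.2,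
    hcont.eventually (hf.eventually (by simp))] with s hs hs' hs''
  have h1 : (fun v : E => Λ s (ofCoord e (e (c s)) v)) = fun v => f ((e (c s), v), z s) :=
    funext fun v => hs _ (e.map_source hs') v
  rw [momentum, h1]
  exact (HasFDerivAt.comp (deriv (fun r => e (c r)) s) (f := fun v : E => ((e (c s), v), z s))
    (hs''.differentiableAt (by norm_num)).hasFDerivAt
    (HasFDerivAt.comp _ (g := fun q : E × E => (q, z s)) (f := fun v : E => (e (c s), v))
      (hasFDerivAt_prodMk_left _ _) (hasFDerivAt_prodMk_right _ _))).fderiv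

theorem contDiffAt_momentum (he : IsChartAround e (c t))
    (hc : ContMDiffAt 𝓘(ℝ, ℝ) 𝓘(ℝ, E) 2 c t) (hz : ContDiffAt ℝ 1 z t)
    (hf : ContDiffAt ℝ 2 f ((e (c t), deriv (fun r => e (c r)) t), z t))
    (hΛ : ∀ᶠ s in 𝓝 t, ∀ x ∈ e.target, ∀ v, Λ s (ofCoord e x v) = f ((x, v), z s)) :
    ContDiffAt ℝ 1 (momentum Λ e c) t := by
  have hx := (contDiffAt_chart_comp he.1 two_le_infty hc he.2).of_le (m := 1) (by norm_num)
  have hv := contDiffAt_deriv_chart he hc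
  refine ContDiffAt.congr_of_eventuallyEq ?_ (momentum_eventuallyEq he hc hz hf hΛ)
  exact (ContDiffAt.comp t (f := fun s => ((e (c s), deriv (fun r => e (c r)) s), z s))
    (hf.fderiv_right (m := 1) (by norm_num)) ((hx.prodMk hv).prodMk hz)).clm_comp contDiffAt_const

theorem force_eventuallyEq (he : IsChartAround e (c t))
    (hc : ContMDiffAt 𝓘(ℝ, ℝ) 𝓘(ℝ, E) 2 c t) (hz : ContDiffAt ℝ 1 z t)
    (hf : ContDiffAt ℝ 2 f ((e (c t), deriv (fun r => e (c r)) t), z t))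
    (hΛ : ∀ᶠ s in 𝓝 t, ∀ x ∈ e.target, ∀ v, Λ s (ofCoord e x v) = f ((x, v), z s)) :
    force Λ e c =ᶠ[𝓝 t] fun s =>
      (fderiv ℝ f ((e (c s), deriv (fun r => e (c r)) s), z s)).comp
        ((ContinuousLinearMap.inl ℝ (E × E) Z).comp (ContinuousLinearMap.inl ℝ E E)) := by
  have hx := contDiffAt_chart_comp he.1 two_le_infty hc he.2
  have hv := contDiffAt_deriv_chart he hc
  have hcont : ContinuousAt (fun s => ((e (c s), deriv (fun r => e (c r)) s), z s)) t :=
    (hx.continuousAt.prodMk hv.continuousAt).prodMk hz.continuousAt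
  filter_upwards [hΛ, eventually_mem_source hc.continuousAt he.2,
    hcont.eventually (hf.eventually (by simp))] with s hs hs' hs''
  have h1 : (fun x : E => Λ s (ofCoord e x (deriv (fun r => e (c r)) s))) =ᶠ[𝓝 (e (c s))]
      fun x => f ((x, deriv (fun r => e (c r)) s), z s) := by
    filter_upwards [e.open_target.mem_nhds (e.map_source hs')] with x hx
    exact hs x hx _
  rw [force, h1.fderiv_eq]
  exact (HasFDerivAt.comp (e (c s)) (f := fun x : E => ((x, deriv (fun r => e (c r)) s), z s))
    (hs''.differentiableAt (by norm_num)).hasFDerivAt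
    (HasFDerivAt.comp _ (g := fun q : E × E => (q, z s))
      (f := fun x : E => (x, deriv (fun r => e (c r)) s))
      (hasFDerivAt_prodMk_left _ _) (hasFDerivAt_prodMk_left _ _))).fderiv

theorem continuousAt_force (he : IsChartAround e (c t))
    (hc : ContMDiffAt 𝓘(ℝ, ℝ) 𝓘(ℝ, E) 2 c t) (hz : ContDiffAt ℝ 1 z t)
    (hf : ContDiffAt ℝ 2 f ((e (c t), deriv (fun r => e (c r)) t), z t))
    (hΛ : ∀ᶠ s in 𝓝 t, ∀ x ∈ e.target, ∀ v, Λ s (ofCoord e x v) = f ((x, v), z s)) :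
    ContinuousAt (force Λ e c) t := by
  have hx := (contDiffAt_chart_comp he.1 two_le_infty hc he.2).of_le (m := 1) (by norm_num)
  have hv := contDiffAt_deriv_chart he hc
  refine ContinuousAt.congr ?_ (force_eventuallyEq he hc hz hf hΛ).symm
  exact ((ContDiffAt.comp t (f := fun s => ((e (c s), deriv (fun r => e (c r)) s), z s))
    (hf.fderiv_right (m := 1) (by norm_num)) ((hx.prodMk hv).prodMk hz)).clm_comp
      contDiffAt_const).continuousAt

theorem continuousAt_eulerLagrangeCovector (he : IsChartAround e (c t))
    (hc : ContMDiffAt 𝓘(ℝ, ℝ) 𝓘(ℝ, E) 2 c t) (hz : ContDiffAt ℝ 1 z t)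
    (hf : ContDiffAt ℝ 2 f ((e (c t), deriv (fun r => e (c r)) t), z t))
    (hΛ : ∀ᶠ s in 𝓝 t, ∀ x ∈ e.target, ∀ v, Λ s (ofCoord e x v) = f ((x, v), z s)) :
    ContinuousAt (eulerLagrangeCovector Λ e c) t :=
  (((contDiffAt_momentum he hc hz hf hΛ).continuousAt_fderiv (by norm_num)).clm_apply
    continuousAt_const).sub (continuousAt_force he hc hz hf hΛ)

/-- Derivative of the momentum paired with the variation of a deformation `Γ`. -/
theorem hasDerivAt_fibreDeriv {Γ : ℝ × ℝ → M} (hΓ : ContMDiffAt 𝓘(ℝ, ℝ × ℝ) 𝓘(ℝ, E) 2 Γ (0, t))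
    (he : IsChartAround e (Γ (0, t))) (hz : ContDiffAt ℝ 1 z t)
    (hf : ContDiffAt ℝ 2 f ((e (Γ (0, t)), deriv (fun r => e (Γ (0, r))) t), z t))
    (hΛ : ∀ᶠ s in 𝓝 t, ∀ x ∈ e.target, ∀ v, Λ s (ofCoord e x v) = f ((x, v), z s))
    (hd : ∀ s, ∀ X : TangentBundle 𝓘(ℝ, E) M, DifferentiableAt ℝ (fun v : E => Λ s ⟨X.1, v⟩) X.2) :
    HasDerivAt (fun s => fibreDeriv (Λ s) (velocityLift (fun r => Γ (0, r)) s)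
        (vecPart (velocityLift (fun ε => Γ (ε, s)) 0)))
      (deriv (fun ε => Λ t (velocityLift (fun r => Γ (ε, r)) t)) 0 +
        eulerLagrangeCovector Λ e (fun r => Γ (0, r)) t
          (fderiv ℝ (fun q => e (Γ q)) (0, t) (1, 0))) t := by
  have hc : ContMDiffAt 𝓘(ℝ, ℝ) 𝓘(ℝ, E) 2 (fun r => Γ (0, r)) t :=
    hΓ.comp t (contDiffAt_const.prodMk contDiffAt_id).contMDiffAt
  set x : ℝ × ℝ → E := fun q => e (Γ q) with hxdef
  have hx : ContDiffAt ℝ 2 x (0, t) := contDiffAt_chart_comp he.1 two_le_infty hΓ he.2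
  have hx1 : ∀ d, ContDiffAt ℝ 1 (fun q => fderiv ℝ x q d) (0, t) := fun d =>
    (hx.fderiv_right (m := 1) (by norm_num)).clm_apply contDiffAt_const
  have hxd : ∀ᶠ q in 𝓝 ((0 : ℝ), t), DifferentiableAt ℝ x q := by
    filter_upwards [hx.eventually (by simp)] with q hq using hq.differentiableAt (by norm_num)
  have evS := eventually_mem_source hΓ.continuousAt he.2
  have evM := eventually_mdifferentiableAt hΓ (by simp) two_lt_infty
  -- The chart-free pairing equals, near `t`, the momentum in the fixed chart applied to the
  -- coordinate of the variation, and can be differentiated as a product.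
  have h1 : (fun s => fibreDeriv (Λ s) (velocityLift (fun r => Γ (0, r)) s)
        (vecPart (velocityLift (fun ε => Γ (ε, s)) 0))) =ᶠ[𝓝 t]
      fun s => momentum Λ e (fun r => Γ (0, r)) s (fderiv ℝ x (0, s) (1, 0)) := by
    filter_upwards [eventually_slice_right evS, eventually_slice_right evM,
      eventually_slice_right hxd] with s hs hs' hs''
    have h2 := fderiv_ofCoord he.1 (Λ s) (X := velocityLift (fun r => Γ (0, r)) s) hs (hd s _)
      (vecPart (velocityLift (fun ε => Γ (ε, s)) 0))
    rw [← h2, momentum]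
    congr 1
    · congr 1
      rw [velocityLift_right hs', fibreCoord_dirLift he.1 hs' hs]
      exact (hasDerivAt_slice_right hs'').deriv.symm
    · rw [← fibreCoord_dirLift he.1 hs' hs, ← velocityLift_left hs']
      rfl
  have hp := (contDiffAt_momentum he hc hz hf hΛ).differentiableAt (by norm_num)
  have h3 := hp.hasDerivAt.clm_apply (hasDerivAt_slice_right
    ((hx1 (1, 0)).differentiableAt (by norm_num)))
  have h4 := h3.congr_of_eventuallyEq h1
  convert! h4 using 1
  have hv0 : deriv (fun r => e (Γ (0, r))) t = fderiv ℝ x (0, t) (0, 1) :=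
    (hasDerivAt_slice_right hxd.self_of_nhds).deriv
  have h5 : (fun ε => Λ t (velocityLift (fun r => Γ (ε, r)) t)) =ᶠ[𝓝 0]
      fun ε => f ((x (ε, t), fderiv ℝ x (ε, t) (0, 1)), z t) := by
    filter_upwards [eventually_slice_left evS, eventually_slice_left evM] with ε hε hε'
    rw [velocityLift_right hε', dirLift_eq_ofCoord he.1 hε' hε]
    exact hΛ.self_of_nhds _ (e.map_source hε) _
  have h6 : HasDerivAt (fun ε => f ((x (ε, t), fderiv ℝ x (ε, t) (0, 1)), z t)) _ 0 :=
    HasFDerivAt.comp_hasDerivAt (0 : ℝ)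
      (f := fun ε => ((x (ε, t), fderiv ℝ x (ε, t) (0, 1)), z t))
      (by rw [← hv0]; exact (hf.differentiableAt (by norm_num)).hasFDerivAt)
      (((hasDerivAt_slice_left hxd.self_of_nhds).prodMk
        (hasDerivAt_slice_left ((hx1 (0, 1)).differentiableAt (by norm_num)))).prodMk
        (hasDerivAt_const 0 (z t)))
  -- Momentum times `∂ₜ∂_ε x` from the product rule matches momentum times `∂_ε∂ₜ x` from the
  -- variation of `Λ`; the force terms cancel.
  rw [h5.deriv_eq, h6.deriv, eulerLagrangeCovector, (momentum_eventuallyEq he hc hz hf hΛ).self_of_nhds,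
    (force_eventuallyEq he hc hz hf hΛ).self_of_nhds, sub_apply, fderiv_fderiv_comm hx (1, 0) (0, 1)]
  simp only [ContinuousLinearMap.comp_apply, ContinuousLinearMap.inl_apply,
    ContinuousLinearMap.inr_apply]
  rw [add_sub, add_comm, ← add_sub, add_right_inj, sub_eq_iff_eq_add', ← map_add]
  simp

end OneFactor

end Lagrangian

/-! ### Smoothness along fibres and along velocity lifts. -/

section FibreSmoothness

variable {E : Type*} [NormedAddCommGroup E] [NormedSpace ℝ E]
  {M : Type*} [TopologicalSpace M] [ChartedSpace E M] [IsManifold 𝓘(ℝ, E) ∞ M]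

theorem contMDiff_mk (x : M) :
    ContMDiff 𝓘(ℝ, E) 𝓘(ℝ, E).tangent ∞ (fun v : E => (⟨x, v⟩ : TangentBundle 𝓘(ℝ, E) M)) := by
  obtain ⟨he, hx⟩ : IsChartAround (chartAt E x) x := isChartAround_chartAt _
  intro v
  have h := contMDiffAt_ofCoord_comp (P := E) he le_rfl (x := fun _ => chartAt E x x) (v := id)
    (p := v) contDiffAt_const contDiffAt_id ((chartAt E x).map_source hx)
  simpa only [ofCoord_chartAt_self, id] using h

theorem velocityLift_eventuallyEq_ofCoord {e : OpenPartialHomeomorph M E} {c : ℝ → M} {t : ℝ}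
    (he : IsChartAround e (c t)) (hc : ContMDiffAt 𝓘(ℝ, ℝ) 𝓘(ℝ, E) 2 c t) :
    ∀ᶠ s in 𝓝 t, velocityLift (E := E) c s =
      ofCoord e (e (c s)) (deriv (fun r => e (c r)) s) := by
  filter_upwards [eventually_mem_source hc.continuousAt he.2,
    eventually_mdifferentiableAt hc (by simp) two_lt_infty] with s hs hs'
  exact dirLift_eq_ofCoord he.1 hs' hs 1

end FibreSmoothness

/-! ### First variation of `L` on `TG × TN`. -/

section FullLagrangian

variable {E : Type*} [NormedAddCommGroup E] [NormedSpace ℝ E]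
  {F : Type*} [NormedAddCommGroup F] [NormedSpace ℝ F]
  {G : Type*} [TopologicalSpace G] [ChartedSpace E G] [IsManifold 𝓘(ℝ, E) ∞ G]
  {N : Type*} [TopologicalSpace N] [ChartedSpace F N] [IsManifold 𝓘(ℝ, F) ∞ N]
  {L : TangentBundle 𝓘(ℝ, E) G × TangentBundle 𝓘(ℝ, F) N → ℝ}

theorem contDiffAt_comp_ofCoord
    (hL : ContMDiff (𝓘(ℝ, E).tangent.prod 𝓘(ℝ, F).tangent) 𝓘(ℝ, ℝ) 2 L)
    {e₁ : OpenPartialHomeomorph G E} {e₂ : OpenPartialHomeomorph N F}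
    (he₁ : e₁ ∈ IsManifold.maximalAtlas 𝓘(ℝ, E) ∞ G)
    (he₂ : e₂ ∈ IsManifold.maximalAtlas 𝓘(ℝ, F) ∞ N) {x : E} (hx : x ∈ e₁.target) (v : E)
    {y : F} (hy : y ∈ e₂.target) (w : F) :
    ContDiffAt ℝ 2 (fun q : (E × E) × (F × F) =>
      L (ofCoord e₁ q.1.1 q.1.2, ofCoord e₂ q.2.1 q.2.2)) ((x, v), (y, w)) := by
  have h1 := contMDiffAt_ofCoord_comp (P := (E × E) × (F × F)) he₁ two_le_infty
    (x := fun q => q.1.1) (v := fun q => q.1.2) (p := ((x, v), (y, w))) (by fun_prop) (by fun_prop) hx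
  have h2 := contMDiffAt_ofCoord_comp (P := (E × E) × (F × F)) he₂ two_le_infty
    (x := fun q => q.2.1) (v := fun q => q.2.2) (p := ((x, v), (y, w))) (by fun_prop) (by fun_prop) hy
  exact (hL.contMDiffAt.comp _ (h1.prodMk h2)).contDiffAt

theorem contDiffAt_comp_ofCoord_swap
    (hL : ContMDiff (𝓘(ℝ, E).tangent.prod 𝓘(ℝ, F).tangent) 𝓘(ℝ, ℝ) 2 L)
    {e₁ : OpenPartialHomeomorph G E} {e₂ : OpenPartialHomeomorph N F}
    (he₁ : e₁ ∈ IsManifold.maximalAtlas 𝓘(ℝ, E) ∞ G)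
    (he₂ : e₂ ∈ IsManifold.maximalAtlas 𝓘(ℝ, F) ∞ N) {x : E} (hx : x ∈ e₁.target) (v : E)
    {y : F} (hy : y ∈ e₂.target) (w : F) :
    ContDiffAt ℝ 2 (fun q : (F × F) × (E × E) =>
      L (ofCoord e₁ q.2.1 q.2.2, ofCoord e₂ q.1.1 q.1.2)) ((y, w), (x, v)) :=
  ContDiffAt.comp ((y, w), (x, v)) (f := fun q : (F × F) × (E × E) => (q.2, q.1))
    (contDiffAt_comp_ofCoord hL he₁ he₂ hx v hy w) (contDiffAt_snd.prodMk contDiffAt_fst)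

theorem differentiableAt_fibre_left
    (hL : ContMDiff (𝓘(ℝ, E).tangent.prod 𝓘(ℝ, F).tangent) 𝓘(ℝ, ℝ) 2 L)
    (x : G) (Y : TangentBundle 𝓘(ℝ, F) N) (v : E) :
    DifferentiableAt ℝ (fun w : E => L (⟨x, w⟩, Y)) v := by
  have h : ContMDiff 𝓘(ℝ, E) 𝓘(ℝ, ℝ) 2 (fun w : E => L (⟨x, w⟩, Y)) :=
    hL.comp (((contMDiff_mk x).of_le two_le_infty).prodMk contMDiff_const)
  exact h.contDiff.contDiffAt.differentiableAt (by norm_num)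

theorem differentiableAt_fibre_right
    (hL : ContMDiff (𝓘(ℝ, E).tangent.prod 𝓘(ℝ, F).tangent) 𝓘(ℝ, ℝ) 2 L)
    (X : TangentBundle 𝓘(ℝ, E) G) (y : N) (v : F) :
    DifferentiableAt ℝ (fun w : F => L (X, ⟨y, w⟩)) v := by
  have h : ContMDiff 𝓘(ℝ, F) 𝓘(ℝ, ℝ) 2 (fun w : F => L (X, ⟨y, w⟩)) :=
    hL.comp (contMDiff_const.prodMk ((contMDiff_mk y).of_le two_le_infty))
  exact h.contDiff.contDiffAt.differentiableAt (by norm_num)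

/-- The momentum of `L` paired with the variation of a deformation. -/
def boundaryTerm (L : TangentBundle 𝓘(ℝ, E) G × TangentBundle 𝓘(ℝ, F) N → ℝ)
    (γ : ℝ → ℝ → G) (h : ℝ → ℝ → N) (s : ℝ) : ℝ :=
  fibreDeriv (fun X => L (X, velocityLift (h 0) s)) (velocityLift (γ 0) s)
      (vecPart (velocityLift (fun ε => γ ε s) 0)) +
    fibreDeriv (fun Y => L (velocityLift (γ 0) s, Y)) (velocityLift (h 0) s)
      (vecPart (velocityLift (fun ε => h ε s) 0))

variable {t : ℝ} {e₁ : OpenPartialHomeomorph G E} {e₂ : OpenPartialHomeomorph N F}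

section Curves

variable {g : ℝ → G} {η : ℝ → N}

theorem differentiableAt_momentum_left
    (hL : ContMDiff (𝓘(ℝ, E).tangent.prod 𝓘(ℝ, F).tangent) 𝓘(ℝ, ℝ) 2 L)
    (hg : ContMDiffAt 𝓘(ℝ, ℝ) 𝓘(ℝ, E) 2 g t) (hη : ContMDiffAt 𝓘(ℝ, ℝ) 𝓘(ℝ, F) 2 η t)
    (he₁ : IsChartAround e₁ (g t)) :
    DifferentiableAt ℝ (momentum (fun s X => L (X, velocityLift η s)) e₁ g) t := by
  have he₂ : IsChartAround (chartAt F (η t)) (η t) := isChartAround_chartAt _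
  refine ContDiffAt.differentiableAt (n := 1) (contDiffAt_momentum he₁ hg
    (((contDiffAt_chart_comp he₂.1 two_le_infty hη he₂.2).of_le (by norm_num)).prodMk
      (contDiffAt_deriv_chart he₂ hη))
    (contDiffAt_comp_ofCoord hL he₁.1 he₂.1 (e₁.map_source he₁.2) _
      ((chartAt F (η t)).map_source he₂.2) _) ?_) (by norm_num)
  filter_upwards [velocityLift_eventuallyEq_ofCoord he₂ hη] with s hs x _ v
  rw [hs]

theorem differentiableAt_momentum_right
    (hL : ContMDiff (𝓘(ℝ, E).tangent.prod 𝓘(ℝ, F).tangent) 𝓘(ℝ, ℝ) 2 L)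
    (hg : ContMDiffAt 𝓘(ℝ, ℝ) 𝓘(ℝ, E) 2 g t) (hη : ContMDiffAt 𝓘(ℝ, ℝ) 𝓘(ℝ, F) 2 η t)
    (he₂ : IsChartAround e₂ (η t)) :
    DifferentiableAt ℝ (momentum (fun s Y => L (velocityLift g s, Y)) e₂ η) t := by
  have he₁ : IsChartAround (chartAt E (g t)) (g t) := isChartAround_chartAt _
  refine ContDiffAt.differentiableAt (n := 1) (contDiffAt_momentum he₂ hη
    (((contDiffAt_chart_comp he₁.1 two_le_infty hg he₁.2).of_le (by norm_num)).prodMk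
      (contDiffAt_deriv_chart he₁ hg))
    (contDiffAt_comp_ofCoord_swap hL he₁.1 he₂.1 ((chartAt E (g t)).map_source he₁.2) _
      (e₂.map_source he₂.2) _) ?_) (by norm_num)
  filter_upwards [velocityLift_eventuallyEq_ofCoord he₁ hg] with s hs x _ v
  rw [hs]

theorem continuousAt_eulerLagrangeCovector_left
    (hL : ContMDiff (𝓘(ℝ, E).tangent.prod 𝓘(ℝ, F).tangent) 𝓘(ℝ, ℝ) 2 L)
    (hg : ContMDiffAt 𝓘(ℝ, ℝ) 𝓘(ℝ, E) 2 g t) (hη : ContMDiffAt 𝓘(ℝ, ℝ) 𝓘(ℝ, F) 2 η t)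
    (he₁ : IsChartAround e₁ (g t)) :
    ContinuousAt (eulerLagrangeCovector (fun s X => L (X, velocityLift η s)) e₁ g) t := by
  have he₂ : IsChartAround (chartAt F (η t)) (η t) := isChartAround_chartAt _
  refine continuousAt_eulerLagrangeCovector he₁ hg
    (((contDiffAt_chart_comp he₂.1 two_le_infty hη he₂.2).of_le (by norm_num)).prodMk
      (contDiffAt_deriv_chart he₂ hη))
    (contDiffAt_comp_ofCoord hL he₁.1 he₂.1 (e₁.map_source he₁.2) _
      ((chartAt F (η t)).map_source he₂.2) _) ?_
  filter_upwards [velocityLift_eventuallyEq_ofCoord he₂ hη] with s hs x _ v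
  rw [hs]

theorem continuousAt_eulerLagrangeCovector_right
    (hL : ContMDiff (𝓘(ℝ, E).tangent.prod 𝓘(ℝ, F).tangent) 𝓘(ℝ, ℝ) 2 L)
    (hg : ContMDiffAt 𝓘(ℝ, ℝ) 𝓘(ℝ, E) 2 g t) (hη : ContMDiffAt 𝓘(ℝ, ℝ) 𝓘(ℝ, F) 2 η t)
    (he₂ : IsChartAround e₂ (η t)) :
    ContinuousAt (eulerLagrangeCovector (fun s Y => L (velocityLift g s, Y)) e₂ η) t := by
  have he₁ : IsChartAround (chartAt E (g t)) (g t) := isChartAround_chartAt _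
  refine continuousAt_eulerLagrangeCovector he₂ hη
    (((contDiffAt_chart_comp he₁.1 two_le_infty hg he₁.2).of_le (by norm_num)).prodMk
      (contDiffAt_deriv_chart he₁ hg))
    (contDiffAt_comp_ofCoord_swap hL he₁.1 he₂.1 ((chartAt E (g t)).map_source he₁.2) _
      (e₂.map_source he₂.2) _) ?_
  filter_upwards [velocityLift_eventuallyEq_ofCoord he₁ hg] with s hs x _ v
  rw [hs]

end Curves

theorem eventually_velocityLift_slice {M : Type*} [TopologicalSpace M] [ChartedSpace E M]
    [IsManifold 𝓘(ℝ, E) ∞ M] {c : ℝ → ℝ → M}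
    (hc : ContMDiffAt 𝓘(ℝ, ℝ × ℝ) 𝓘(ℝ, E) 2 (fun p : ℝ × ℝ => c p.1 p.2) (0, t)) :
    (fun p : ℝ × ℝ => velocityLift (E := E) (c p.1) p.2) =ᶠ[𝓝 (0, t)]
      dirLift (fun p : ℝ × ℝ => c p.1 p.2) (0, 1) := by
  filter_upwards [eventually_mdifferentiableAt hc (by simp) two_lt_infty] with q hq
  exact velocityLift_right (s := q.1) (t := q.2) hq

theorem contMDiffAt_velocityLift_slice {M : Type*} [TopologicalSpace M] [ChartedSpace E M]
    [IsManifold 𝓘(ℝ, E) ∞ M] {c : ℝ → ℝ → M}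
    (hc : ContMDiffAt 𝓘(ℝ, ℝ × ℝ) 𝓘(ℝ, E) 2 (fun p : ℝ × ℝ => c p.1 p.2) (0, t)) :
    ContMDiffAt 𝓘(ℝ, ℝ × ℝ) 𝓘(ℝ, E).tangent 1
      (fun p : ℝ × ℝ => velocityLift (E := E) (c p.1) p.2) (0, t) :=
  (contMDiffAt_dirLift hc (0, 1)).congr_of_eventuallyEq (eventually_velocityLift_slice hc)

theorem contDiffAt_lagrangian_deformation
    (hL : ContMDiff (𝓘(ℝ, E).tangent.prod 𝓘(ℝ, F).tangent) 𝓘(ℝ, ℝ) 2 L)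
    {γ : ℝ → ℝ → G} {h : ℝ → ℝ → N}
    (hγ : ContMDiffAt 𝓘(ℝ, ℝ × ℝ) 𝓘(ℝ, E) 2 (fun p : ℝ × ℝ => γ p.1 p.2) (0, t))
    (hh : ContMDiffAt 𝓘(ℝ, ℝ × ℝ) 𝓘(ℝ, F) 2 (fun p : ℝ × ℝ => h p.1 p.2) (0, t)) :
    ContDiffAt ℝ 1 (fun p : ℝ × ℝ => L (velocityLift (γ p.1) p.2, velocityLift (h p.1) p.2))
      (0, t) :=
  ((hL.of_le (by norm_num)).contMDiffAt.comp ((0 : ℝ), t)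
    ((contMDiffAt_velocityLift_slice hγ).prodMk (contMDiffAt_velocityLift_slice hh))).contDiffAt

/-- First variation formula for `L`. -/
theorem hasDerivAt_boundaryTerm
    (hL : ContMDiff (𝓘(ℝ, E).tangent.prod 𝓘(ℝ, F).tangent) 𝓘(ℝ, ℝ) 2 L)
    {γ : ℝ → ℝ → G} {h : ℝ → ℝ → N}
    (hγ : ContMDiffAt 𝓘(ℝ, ℝ × ℝ) 𝓘(ℝ, E) 2 (fun p : ℝ × ℝ => γ p.1 p.2) (0, t))
    (hh : ContMDiffAt 𝓘(ℝ, ℝ × ℝ) 𝓘(ℝ, F) 2 (fun p : ℝ × ℝ => h p.1 p.2) (0, t))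
    (he₁ : IsChartAround e₁ (γ 0 t)) (he₂ : IsChartAround e₂ (h 0 t)) :
    HasDerivAt (boundaryTerm L γ h)
      (fderiv ℝ (fun p : ℝ × ℝ => L (velocityLift (γ p.1) p.2, velocityLift (h p.1) p.2))
          (0, t) (1, 0) +
        (eulerLagrangeCovector (fun s X => L (X, velocityLift (h 0) s)) e₁ (γ 0) t
            (fderiv ℝ (fun p : ℝ × ℝ => e₁ (γ p.1 p.2)) (0, t) (1, 0)) +
          eulerLagrangeCovector (fun s Y => L (velocityLift (γ 0) s, Y)) e₂ (h 0) t
            (fderiv ℝ (fun p : ℝ × ℝ => e₂ (h p.1 p.2)) (0, t) (1, 0)))) t := by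
  have hr : ContMDiffAt 𝓘(ℝ, ℝ) 𝓘(ℝ, ℝ × ℝ) 2 (fun s : ℝ => ((0 : ℝ), s)) t :=
    (contDiffAt_const.prodMk contDiffAt_id).contMDiffAt
  have hl : ContMDiffAt 𝓘(ℝ, ℝ) 𝓘(ℝ, ℝ × ℝ) 1 (fun s : ℝ => (s, t)) 0 :=
    (contDiffAt_id.prodMk contDiffAt_const).contMDiffAt
  have hg : ContMDiffAt 𝓘(ℝ, ℝ) 𝓘(ℝ, E) 2 (γ 0) t := hγ.comp t hr
  have hη : ContMDiffAt 𝓘(ℝ, ℝ) 𝓘(ℝ, F) 2 (h 0) t := hh.comp t hr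
  have h1 := hasDerivAt_fibreDeriv (Λ := fun s X => L (X, velocityLift (h 0) s)) hγ he₁
    (((contDiffAt_chart_comp he₂.1 two_le_infty hη he₂.2).of_le (m := 1) (by norm_num)).prodMk
      (contDiffAt_deriv_chart he₂ hη))
    (contDiffAt_comp_ofCoord hL he₁.1 he₂.1 (e₁.map_source he₁.2) _ (e₂.map_source he₂.2) _)
    (by
      filter_upwards [velocityLift_eventuallyEq_ofCoord he₂ hη] with s hs x _ v
      rw [hs])
    (fun s X => differentiableAt_fibre_left hL X.1 _ X.2)
  have h2 := hasDerivAt_fibreDeriv (Λ := fun s Y => L (velocityLift (γ 0) s, Y)) hh he₂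
    (((contDiffAt_chart_comp he₁.1 two_le_infty hg he₁.2).of_le (m := 1) (by norm_num)).prodMk
      (contDiffAt_deriv_chart he₁ hg))
    (contDiffAt_comp_ofCoord_swap hL he₁.1 he₂.1 (e₁.map_source he₁.2) _ (e₂.map_source he₂.2) _)
    (by
      filter_upwards [velocityLift_eventuallyEq_ofCoord he₁ hg] with s hs x _ v
      rw [hs])
    (fun s Y => differentiableAt_fibre_right hL _ Y.1 Y.2)
  have h3 := h1.add h2
  convert! h3 using 1
  have hX : ContMDiffAt 𝓘(ℝ, ℝ) 𝓘(ℝ, E).tangent 1 (fun ε => velocityLift (E := E) (γ ε) t) 0 :=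
    ContMDiffAt.comp (0 : ℝ) (f := fun s : ℝ => (s, t)) (contMDiffAt_velocityLift_slice hγ) hl
  have hY : ContMDiffAt 𝓘(ℝ, ℝ) 𝓘(ℝ, F).tangent 1 (fun ε => velocityLift (E := F) (h ε) t) 0 :=
    ContMDiffAt.comp (0 : ℝ) (f := fun s : ℝ => (s, t)) (contMDiffAt_velocityLift_slice hh) hl
  -- Separate the parameter of the group curve from that of the curve in `N`: the variation of `L`
  -- on the diagonal is the sum of the two one-factor variations.
  have hm : DifferentiableAt ℝ (fun q : ℝ × ℝ => L (velocityLift (γ q.1) t, velocityLift (h q.2) t))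
      (0, 0) := by
    have h4 : ContMDiffAt 𝓘(ℝ, ℝ × ℝ) (𝓘(ℝ, E).tangent.prod 𝓘(ℝ, F).tangent) 1
        (fun q : ℝ × ℝ => (velocityLift (E := E) (γ q.1) t, velocityLift (E := F) (h q.2) t))
        (0, 0) :=
      (ContMDiffAt.comp (0, 0) (f := fun q : ℝ × ℝ => q.1) hX contDiffAt_fst.contMDiffAt).prodMk
        (ContMDiffAt.comp (0, 0) (f := fun q : ℝ × ℝ => q.2) hY contDiffAt_snd.contMDiffAt)
    exact ((hL.of_le (by norm_num)).contMDiffAt.comp (0, 0) h4).contDiffAt.differentiableAt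
      (by norm_num)
  have h5 := (hasDerivAt_slice_left ((contDiffAt_lagrangian_deformation hL hγ hh).differentiableAt
    (by norm_num))).deriv
  have h6 := fderiv_diag hm 1
  simp only [fderiv_apply_one_eq_deriv] at h6
  rw [← h5, h6]
  ring

end FullLagrangian

/-! ### First variation of `ℓ` under variations of the form (V). -/

section ReducedLagrangian

variable {E : Type*} [NormedAddCommGroup E] [NormedSpace ℝ E]
  {F : Type*} [NormedAddCommGroup F] [NormedSpace ℝ F]
  {N : Type*} [TopologicalSpace N] [ChartedSpace F N] [IsManifold 𝓘(ℝ, F) ∞ N]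

section Partials

variable {l : E × TangentBundle 𝓘(ℝ, F) N → ℝ} {e : OpenPartialHomeomorph N F}

theorem contDiffAt_reduced_chart
    (hl : ContMDiff (𝓘(ℝ, E).prod 𝓘(ℝ, F).tangent) 𝓘(ℝ, ℝ) 2 l)
    (he : e ∈ IsManifold.maximalAtlas 𝓘(ℝ, F) ∞ N) (u : E) {x : F} (hx : x ∈ e.target) (v : F) :
    ContDiffAt ℝ 2 (fun q : E × (F × F) => l (q.1, ofCoord e q.2.1 q.2.2)) (u, (x, v)) := by
  have h := contMDiffAt_ofCoord_comp (P := E × (F × F)) he two_le_infty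
    (x := fun q => q.2.1) (v := fun q => q.2.2) (p := (u, (x, v))) (by fun_prop) (by fun_prop) hx
  exact (hl.contMDiffAt.comp _ (contDiffAt_fst.contMDiffAt.prodMk h)).contDiffAt

theorem differentiableAt_reduced_left
    (hl : ContMDiff (𝓘(ℝ, E).prod 𝓘(ℝ, F).tangent) 𝓘(ℝ, ℝ) 2 l)
    (u : E) (Y : TangentBundle 𝓘(ℝ, F) N) : DifferentiableAt ℝ (fun w : E => l (w, Y)) u := by
  have h : ContMDiff 𝓘(ℝ, E) 𝓘(ℝ, ℝ) 2 (fun w : E => l (w, Y)) :=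
    hl.comp (contMDiff_id.prodMk contMDiff_const)
  exact h.contDiff.contDiffAt.differentiableAt (by norm_num)

theorem differentiableAt_reduced_fibre
    (hl : ContMDiff (𝓘(ℝ, E).prod 𝓘(ℝ, F).tangent) 𝓘(ℝ, ℝ) 2 l)
    (u : E) (y : N) (v : F) : DifferentiableAt ℝ (fun w : F => l (u, ⟨y, w⟩)) v := by
  have h : ContMDiff 𝓘(ℝ, F) 𝓘(ℝ, ℝ) 2 (fun w : F => l (u, ⟨y, w⟩)) :=
    hl.comp (contMDiff_const.prodMk ((contMDiff_mk y).of_le two_le_infty))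
  exact h.contDiff.contDiffAt.differentiableAt (by norm_num)

/-- Together with `dln_eq` and `dlnu_eq` this exhibits the three partial derivatives as restrictions
of one total derivative, from which both their regularity in time and the splitting of `δℓ` are read
off. -/
theorem dlu_ofCoord
    (hl : ContMDiff (𝓘(ℝ, E).prod 𝓘(ℝ, F).tangent) 𝓘(ℝ, ℝ) 2 l)
    (he : e ∈ IsManifold.maximalAtlas 𝓘(ℝ, F) ∞ N) (u : E) {x : F} (hx : x ∈ e.target) (v : F) :
    dlu l u (ofCoord e x v) =
      (fderiv ℝ (fun q : E × (F × F) => l (q.1, ofCoord e q.2.1 q.2.2)) (u, (x, v))).comp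
        (ContinuousLinearMap.inl ℝ E (F × F)) :=
  (HasFDerivAt.comp u (f := fun w : E => (w, (x, v)))
    ((contDiffAt_reduced_chart hl he u hx v).differentiableAt (by norm_num)).hasFDerivAt
    (hasFDerivAt_prodMk_left _ _)).fderiv

theorem dln_eq
    (hl : ContMDiff (𝓘(ℝ, E).prod 𝓘(ℝ, F).tangent) 𝓘(ℝ, ℝ) 2 l)
    (he : e ∈ IsManifold.maximalAtlas 𝓘(ℝ, F) ∞ N) (u : E) {x : F} (hx : x ∈ e.target) (v : F) :
    dln l e u x v =
      (fderiv ℝ (fun q : E × (F × F) => l (q.1, ofCoord e q.2.1 q.2.2)) (u, (x, v))).comp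
        ((ContinuousLinearMap.inr ℝ E (F × F)).comp (ContinuousLinearMap.inl ℝ F F)) :=
  (HasFDerivAt.comp x (f := fun y : F => (u, (y, v)))
    ((contDiffAt_reduced_chart hl he u hx v).differentiableAt (by norm_num)).hasFDerivAt
    (HasFDerivAt.comp x (g := fun q : F × F => (u, q)) (f := fun y : F => (y, v))
      (hasFDerivAt_prodMk_right _ _) (hasFDerivAt_prodMk_left _ _))).fderiv

theorem dlnu_eq
    (hl : ContMDiff (𝓘(ℝ, E).prod 𝓘(ℝ, F).tangent) 𝓘(ℝ, ℝ) 2 l)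
    (he : e ∈ IsManifold.maximalAtlas 𝓘(ℝ, F) ∞ N) (u : E) {x : F} (hx : x ∈ e.target) (v : F) :
    dlnu l e u x v =
      (fderiv ℝ (fun q : E × (F × F) => l (q.1, ofCoord e q.2.1 q.2.2)) (u, (x, v))).comp
        ((ContinuousLinearMap.inr ℝ E (F × F)).comp (ContinuousLinearMap.inr ℝ F F)) :=
  (HasFDerivAt.comp v (f := fun w : F => (u, (x, w)))
    ((contDiffAt_reduced_chart hl he u hx v).differentiableAt (by norm_num)).hasFDerivAt
    (HasFDerivAt.comp v (g := fun q : F × F => (u, q)) (f := fun w : F => (x, w))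
      (hasFDerivAt_prodMk_right _ _) (hasFDerivAt_prodMk_right _ _))).fderiv

variable {u : ℝ → E} {ν : ℝ → TangentBundle 𝓘(ℝ, F) N} {t : ℝ}

theorem continuousAt_base (hν : ContMDiffAt 𝓘(ℝ, ℝ) 𝓘(ℝ, F).tangent 1 ν t) :
    ContinuousAt (fun s => (ν s).1) t :=
  (FiberBundle.continuous_proj F (TangentSpace 𝓘(ℝ, F))).continuousAt.comp hν.continuousAt

theorem contDiffAt_coord_base (he : e ∈ IsManifold.maximalAtlas 𝓘(ℝ, F) ∞ N)
    (hν : ContMDiffAt 𝓘(ℝ, ℝ) 𝓘(ℝ, F).tangent 1 ν t) (hs : (ν t).1 ∈ e.source) :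
    ContDiffAt ℝ 1 (fun s => e (ν s).1) t := by
  refine contDiffAt_chart_comp he one_le_infty ?_ hs
  exact (Bundle.contMDiff_proj (TangentSpace 𝓘(ℝ, F))).contMDiffAt.comp t hν

theorem contDiffAt_coord_fibre (he : e ∈ IsManifold.maximalAtlas 𝓘(ℝ, F) ∞ N)
    (hν : ContMDiffAt 𝓘(ℝ, ℝ) 𝓘(ℝ, F).tangent 1 ν t) (hs : (ν t).1 ∈ e.source) :
    ContDiffAt ℝ 1 (fun s => fibreCoord e (ν s)) t :=
  (((contMDiffAt_fibreCoord he hs).of_le one_le_infty).comp t hν).contDiffAt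

theorem contDiffAt_fderiv_reduced_chart
    (hl : ContMDiff (𝓘(ℝ, E).prod 𝓘(ℝ, F).tangent) 𝓘(ℝ, ℝ) 2 l)
    (he : e ∈ IsManifold.maximalAtlas 𝓘(ℝ, F) ∞ N) (hu : ContDiffAt ℝ 1 u t)
    (hν : ContMDiffAt 𝓘(ℝ, ℝ) 𝓘(ℝ, F).tangent 1 ν t) (hs : (ν t).1 ∈ e.source) :
    ContDiffAt ℝ 1 (fun s => fderiv ℝ (fun q : E × (F × F) => l (q.1, ofCoord e q.2.1 q.2.2))
      (u s, (e (ν s).1, fibreCoord e (ν s)))) t :=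
  ContDiffAt.comp t (f := fun s => (u s, (e (ν s).1, fibreCoord e (ν s))))
    ((contDiffAt_reduced_chart hl he _ (e.map_source hs) _).fderiv_right (m := 1) (by norm_num))
    (hu.prodMk ((contDiffAt_coord_base he hν hs).prodMk (contDiffAt_coord_fibre he hν hs)))

theorem differentiableAt_dlu
    (hl : ContMDiff (𝓘(ℝ, E).prod 𝓘(ℝ, F).tangent) 𝓘(ℝ, ℝ) 2 l) (hu : ContDiffAt ℝ 1 u t)
    (hν : ContMDiffAt 𝓘(ℝ, ℝ) 𝓘(ℝ, F).tangent 1 ν t) :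
    DifferentiableAt ℝ (fun s => dlu l (u s) (ν s)) t := by
  obtain ⟨he, hs⟩ : IsChartAround (chartAt F (ν t).1) (ν t).1 := isChartAround_chartAt _
  refine DifferentiableAt.congr_of_eventuallyEq
    ((contDiffAt_fderiv_reduced_chart hl he hu hν hs).clm_comp
      (contDiffAt_const (c := ContinuousLinearMap.inl ℝ E (F × F)))
      |>.differentiableAt (by norm_num)) ?_
  filter_upwards [eventually_mem_source (continuousAt_base hν) hs] with s hs'
  rw [← dlu_ofCoord hl he (u s) ((chartAt F (ν t).1).map_source hs'), ofCoord_fibreCoord he _ hs']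

theorem differentiableAt_dlnu
    (hl : ContMDiff (𝓘(ℝ, E).prod 𝓘(ℝ, F).tangent) 𝓘(ℝ, ℝ) 2 l)
    (he : e ∈ IsManifold.maximalAtlas 𝓘(ℝ, F) ∞ N) (hu : ContDiffAt ℝ 1 u t)
    (hν : ContMDiffAt 𝓘(ℝ, ℝ) 𝓘(ℝ, F).tangent 1 ν t) (hs : (ν t).1 ∈ e.source) :
    DifferentiableAt ℝ (fun s => dlnu l e (u s) (e (ν s).1) (fibreCoord e (ν s))) t := by
  refine DifferentiableAt.congr_of_eventuallyEq
    ((contDiffAt_fderiv_reduced_chart hl he hu hν hs).clm_comp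
      (contDiffAt_const (c := (ContinuousLinearMap.inr ℝ E (F × F)).comp
        (ContinuousLinearMap.inr ℝ F F))) |>.differentiableAt (by norm_num)) ?_
  filter_upwards [eventually_mem_source (continuousAt_base hν) hs] with s hs'
  exact dlnu_eq hl he (u s) (e.map_source hs') _

/-- The base point is fixed, so the change of chart is linear in the fibre and the pairing does not
depend on the chart. It makes `reducedBoundaryTerm` a chart-free quantity. -/
theorem dlnu_fibreCoord
    (hl : ContMDiff (𝓘(ℝ, E).prod 𝓘(ℝ, F).tangent) 𝓘(ℝ, ℝ) 2 l)
    (he : e ∈ IsManifold.maximalAtlas 𝓘(ℝ, F) ∞ N) (w : E) {Y : TangentBundle 𝓘(ℝ, F) N}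
    (hY : Y.1 ∈ e.source) (z : F) :
    dlnu l e w (e Y.1) (fibreCoord e Y) (fibreCoord e (⟨Y.1, z⟩ : TangentBundle 𝓘(ℝ, F) N)) =
      fibreDeriv (fun Y => l (w, Y)) Y z :=
  fderiv_ofCoord he (fun Y => l (w, Y)) hY (differentiableAt_reduced_fibre hl w Y.1 Y.2) z

end Partials

variable {G : Type*} [TopologicalSpace G] [ChartedSpace E G] [Group G] [LieGroup 𝓘(ℝ, E) ∞ G]
  [MulAction G N] [ContMDiffSMul 𝓘(ℝ, E) 𝓘(ℝ, F) ∞ G N]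
  {l : E × TangentBundle 𝓘(ℝ, F) N → ℝ} {e : OpenPartialHomeomorph N F}
  {g : ℝ → G} {η : ℝ → N}

/-- The functional on `T₁G` in the first Euler-Poincaré equation. -/
def eulerPoincareU (l : E × TangentBundle 𝓘(ℝ, F) N → ℝ) (g : ℝ → G) (η : ℝ → N)
    (e : OpenPartialHomeomorph N F) (t : ℝ) (ζ : E) : ℝ :=
  deriv (fun s => dlu l (uCurve g s) (nuCurve g η s)) t ζ
    + adStar G (uCurve (E := E) g t) (dlu l (uCurve g t) (nuCurve g η t)) ζ
    + diamond (dln l e (uCurve g t) (e (nCurve g η t)) (fibreCoord e (nuCurve g η t)))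
        (coordAct E G e (e (nCurve g η t))) ζ
    + diamond (dlnu l e (uCurve g t) (e (nCurve g η t)) (fibreCoord e (nuCurve g η t)))
        (coordActT E G e (e (nCurve g η t)) (fibreCoord e (nuCurve g η t))) ζ

/-- The covector in the second Euler-Poincaré equation. -/
def eulerPoincareNu (l : E × TangentBundle 𝓘(ℝ, F) N → ℝ) (g : ℝ → G) (η : ℝ → N)
    (e : OpenPartialHomeomorph N F) (t : ℝ) : F →L[ℝ] ℝ :=
  deriv (fun s => dlnu l e (uCurve g s) (e (nCurve g η s)) (fibreCoord e (nuCurve g η s))) t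
    + star G e (e (nCurve g η t)) (uCurve (E := E) g t)
        (dlnu l e (uCurve g t) (e (nCurve g η t)) (fibreCoord e (nuCurve g η t)))
    - dln l e (uCurve g t) (e (nCurve g η t)) (fibreCoord e (nuCurve g η t))

/-- The pairing `⟨δℓ/δu, ξ⟩ + ⟨δℓ/δν, ϖ⟩`. -/
def reducedBoundaryTerm (l : E × TangentBundle 𝓘(ℝ, F) N → ℝ) (g : ℝ → G) (η : ℝ → N)
    (ξ : ℝ → E) (ϖ : (t : ℝ) → TangentSpace 𝓘(ℝ, F) (nCurve g η t)) (s : ℝ) : ℝ :=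
  dlu l (uCurve g s) (nuCurve g η s) (ξ s) +
    fibreDeriv (fun Y => l (uCurve g s, Y)) (nuCurve g η s) (vecPart ⟨nCurve g η s, ϖ s⟩)

variable {U : ℝ → ℝ → E} {V : ℝ → ℝ → TangentBundle 𝓘(ℝ, F) N}
  {ξ : ℝ → E} {ϖ : (t : ℝ) → TangentSpace 𝓘(ℝ, F) (nCurve g η t)} {t : ℝ}

theorem IsReducedVariation.contDiffAt_comp (hv : IsReducedVariation g η U V ξ ϖ)
    (hl : ContMDiff (𝓘(ℝ, E).prod 𝓘(ℝ, F).tangent) 𝓘(ℝ, ℝ) 2 l) (ht : t ∈ Icc (0 : ℝ) 1) :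
    ContDiffAt ℝ 1 (fun p : ℝ × ℝ => l (U p.1 p.2, V p.1 p.2)) (0, t) :=
  ((hl.of_le (by norm_num)).contMDiffAt.comp ((0 : ℝ), t)
    ((hv.smooth_u t ht).contMDiffAt.prodMk (hv.smooth_nu t ht))).contDiffAt

/-- First variation formula for `ℓ`. -/
theorem IsReducedVariation.hasDerivAt_reducedBoundaryTerm
    (hv : IsReducedVariation g η U V ξ ϖ)
    (hl : ContMDiff (𝓘(ℝ, E).prod 𝓘(ℝ, F).tangent) 𝓘(ℝ, ℝ) 2 l) (ht : t ∈ Icc (0 : ℝ) 1)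
    (he : IsChartAround e (nCurve g η t)) :
    HasDerivAt (reducedBoundaryTerm l g η ξ ϖ)
      (fderiv ℝ (fun p : ℝ × ℝ => l (U p.1 p.2, V p.1 p.2)) (0, t) (1, 0) +
        (eulerPoincareU l g η e t (ξ t) +
          eulerPoincareNu l g η e t
            (fibreCoord e (⟨nCurve g η t, ϖ t⟩ : TangentBundle 𝓘(ℝ, F) N)))) t := by
  have hr : ContDiffAt ℝ 1 (fun s : ℝ => ((0 : ℝ), s)) t := contDiffAt_const.prodMk contDiffAt_id
  have hleft : ContDiffAt ℝ 1 (fun s : ℝ => (s, t)) 0 := contDiffAt_id.prodMk contDiffAt_const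
  have hu : ContDiffAt ℝ 1 (uCurve (E := E) g) t := by
    rw [← hv.base_u]
    exact ContDiffAt.comp t (g := fun p : ℝ × ℝ => U p.1 p.2) (f := fun s : ℝ => ((0 : ℝ), s))
      (hv.smooth_u t ht) hr
  have hν : ContMDiffAt 𝓘(ℝ, ℝ) 𝓘(ℝ, F).tangent 1 (nuCurve (F := F) g η) t := by
    rw [← hv.base_nu]
    exact ContMDiffAt.comp t (g := fun p : ℝ × ℝ => V p.1 p.2) (f := fun s : ℝ => ((0 : ℝ), s))
      (hv.smooth_nu t ht) hr.contMDiffAt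
  have hs : (nuCurve (F := F) g η t).1 ∈ e.source := he.2
  have hϖ := hv.smooth_ϖ t ht
  have hw := (contDiffAt_coord_fibre he.1 hϖ he.2).differentiableAt (by norm_num)
  have h1 := (differentiableAt_dlu hl hu hν).hasDerivAt.clm_apply
    ((hv.smooth_ξ t ht).differentiableAt (by norm_num)).hasDerivAt
  have hm : DifferentiableAt ℝ (fun s => dlnu l e (uCurve g s) (e (nCurve g η s))
      (fibreCoord e (nuCurve g η s))) t := differentiableAt_dlnu hl he.1 hu hν hs
  have h2 := hm.hasDerivAt.clm_apply hw.hasDerivAt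
  have h3 := (h1.add h2).congr_of_eventuallyEq (f₁ := reducedBoundaryTerm l g η ξ ϖ) (by
    filter_upwards [eventually_mem_source (continuousAt_base hν) hs] with s hs'
    rw [reducedBoundaryTerm, ← dlnu_fibreCoord hl he.1 _ hs']
    rfl)
  convert! h3 using 1
  have hVs : ∀ᶠ ε in 𝓝 (0 : ℝ), (V ε t).1 ∈ e.source := by
    have hV : ContMDiffAt 𝓘(ℝ, ℝ) 𝓘(ℝ, F).tangent 1 (fun ε => V ε t) 0 :=
      ContMDiffAt.comp (0 : ℝ) (f := fun s : ℝ => (s, t)) (hv.smooth_nu t ht) hleft.contMDiffAt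
    refine eventually_mem_source (continuousAt_base hV) ?_
    rw [hv.base_nu]
    exact hs
  have h4 := ((hv.contDiffAt_comp hl ht).differentiableAt (by norm_num))
  have h5 := (hasDerivAt_slice_left h4).deriv
  have hU0 : U 0 t = uCurve g t := congrFun hv.base_u t
  have hV0 : V 0 t = nuCurve g η t := congrFun hv.base_nu t
  have h6 : (fun ε => l (U ε t, V ε t)) =ᶠ[𝓝 0] fun ε =>
      l (U ε t, ofCoord e (e (V ε t).1) (fibreCoord e (V ε t))) := by
    filter_upwards [hVs] with ε hε
    rw [ofCoord_fibreCoord he.1 _ hε]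
  have hx : e (nCurve g η t) ∈ e.target := e.map_source he.2
  have h7 : HasDerivAt (fun ε => l (U ε t, ofCoord e (e (V ε t).1) (fibreCoord e (V ε t)))) _ 0 :=
    HasFDerivAt.comp_hasDerivAt (0 : ℝ)
      (l := fun q : E × (F × F) => l (q.1, ofCoord e q.2.1 q.2.2))
      (f := fun ε => (U ε t, (e (V ε t).1, fibreCoord e (V ε t))))
      (by
        rw [hU0, hV0]
        exact ((contDiffAt_reduced_chart hl he.1 _ hx _).differentiableAt (by norm_num)).hasFDerivAt)
      ((hv.var_u t ht).prodMk ((hv.var_n t ht e he).prodMk (hv.var_nu t ht e he)))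
  have hsplit : ∀ (T : E × (F × F) →L[ℝ] ℝ) (a : E) (b c : F), T (a, (b, c)) =
      T.comp (ContinuousLinearMap.inl ℝ E (F × F)) a +
      T.comp ((ContinuousLinearMap.inr ℝ E (F × F)).comp (ContinuousLinearMap.inl ℝ F F)) b +
      T.comp ((ContinuousLinearMap.inr ℝ E (F × F)).comp (ContinuousLinearMap.inr ℝ F F)) c := by
    intro T a b c
    simp only [ContinuousLinearMap.comp_apply, ContinuousLinearMap.inl_apply,
      ContinuousLinearMap.inr_apply]
    rw [← map_add, ← map_add]
    simp
  have hdlu : dlu l (uCurve g t) (nuCurve g η t) =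
      dlu l (uCurve g t) (ofCoord e (e (nCurve g η t)) (fibreCoord e (nuCurve g η t))) :=
    congrArg _ (ofCoord_fibreCoord he.1 _ hs).symm
  -- Substituting (V) into `δℓ`, the terms with `ξ̇` and `ϖ̇` combine with the time derivatives of
  -- the momenta into total derivatives; what remains, linear in `ξ` and `ϖ`, is the pairing with
  -- (EP).
  rw [← h5, h6.deriv_eq, h7.deriv, hsplit, eulerPoincareU, eulerPoincareNu, adStar, diamond, diamond,
    star, hdlu, dlu_ofCoord hl he.1 _ hx, ← dln_eq hl he.1 _ hx, ← dlnu_eq hl he.1 _ hx,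
    ← dlu_ofCoord hl he.1 _ hx, ← hdlu]
  simp only [map_add, map_sub, add_apply, sub_apply, neg_apply, ContinuousLinearMap.comp_apply,
    ContinuousLinearMap.flip_apply]
  ring

end ReducedLagrangian

/-! ### Momenta and endpoint conditions of `L` expressed through `ℓ`. -/

section Reduction

variable {E : Type*} [NormedAddCommGroup E] [NormedSpace ℝ E]
  {F : Type*} [NormedAddCommGroup F] [NormedSpace ℝ F]
  {G : Type*} [TopologicalSpace G] [ChartedSpace E G] [Group G] [LieGroup 𝓘(ℝ, E) ∞ G]
  {N : Type*} [TopologicalSpace N] [ChartedSpace F N] [IsManifold 𝓘(ℝ, F) ∞ N]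
  [MulAction G N] [ContMDiffSMul 𝓘(ℝ, E) 𝓘(ℝ, F) ∞ G N]

/-- The preimage is `ζ x`: right translation by `x` is undone by right translation by `x⁻¹`. -/
theorem exists_rightTriv_eq (x : G) (ζ : E) :
    ∃ a : E, rightTriv (⟨x, a⟩ : TangentBundle 𝓘(ℝ, E) G) = ζ := by
  refine ⟨mfderiv 𝓘(ℝ, E) 𝓘(ℝ, E) (fun h : G => h * x) 1 ζ, ?_⟩
  have h := mfderiv_comp_apply (1 : G) (mdifferentiable_mul_const E x⁻¹ (1 * x))
    (mdifferentiable_mul_const E x 1) ζ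
  have hid : (fun h : G => h * x⁻¹) ∘ (fun h : G => h * x) = id := by
    funext k
    simp
  rw [hid, mfderiv_id] at h
  have hx : ∀ z : G, z = x → ∀ v : E, mfderiv 𝓘(ℝ, E) 𝓘(ℝ, E) (fun h : G => h * x⁻¹) z v =
      rightTriv (⟨x, v⟩ : TangentBundle 𝓘(ℝ, E) G) := by
    rintro _ rfl v
    rfl
  exact (h.trans (hx _ (one_mul x) _)).symm

/-- Factor `h • y` as `(h * k⁻¹) • (k • y)`: moving `k` acts on `k • y` through the
right-trivialised velocity. -/
theorem mfderiv_smul_const (k : G) (y : N) (a : E) :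
    mfderiv 𝓘(ℝ, E) 𝓘(ℝ, F) (fun h : G => h • y) k a =
      infAct E (F := F) G (k • y) (rightTriv (⟨k, a⟩ : TangentBundle 𝓘(ℝ, E) G)) := by
  have hcomp : (fun h : G => h • y) = (fun h : G => h • k • y) ∘ (fun h : G => h * k⁻¹) := by
    funext h
    simp [smul_smul]
  have h := mfderiv_comp_apply k (mdifferentiable_smul_const E F (k • y) (k * k⁻¹))
    (mdifferentiable_mul_const E k⁻¹ k) a
  have hz : ∀ z : G, z = 1 → ∀ v : E, mfderiv 𝓘(ℝ, E) 𝓘(ℝ, F) (fun h : G => h • k • y) z v =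
      infAct E (F := F) G (k • y) v := by
    rintro _ rfl v
    rfl
  rw [hcomp]
  exact h.trans (hz _ (mul_inv_cancel k) _)

theorem exists_mfderiv_const_smul_eq
    (hd : ∀ k : G, MDifferentiable 𝓘(ℝ, F) 𝓘(ℝ, F) (fun z : N => k • z)) (k : G) (y : N) (w : F) :
    ∃ b : F, mfderiv 𝓘(ℝ, F) 𝓘(ℝ, F) (fun z : N => k • z) y b = w := by
  refine ⟨mfderiv 𝓘(ℝ, F) 𝓘(ℝ, F) (fun z : N => k⁻¹ • z) (k • y) w, ?_⟩
  have h := mfderiv_comp_apply (k • y) (hd k (k⁻¹ • k • y))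
    (hd k⁻¹ (k • y)) w
  have hid : (fun z : N => k • z) ∘ (fun z : N => k⁻¹ • z) = id := by
    funext z
    simp
  rw [hid, mfderiv_id] at h
  have hz : ∀ z : N, z = y → ∀ v : F, mfderiv 𝓘(ℝ, F) 𝓘(ℝ, F) (fun z : N => k • z) z v =
      mfderiv 𝓘(ℝ, F) 𝓘(ℝ, F) (fun z : N => k • z) y v := by
    rintro _ rfl v
    rfl
  exact ((h.trans (hz _ (inv_smul_smul k y) _))).symm

theorem coordAct_chartAt_self (y : N) (u : E) :
    coordAct E G (chartAt F y) (chartAt F y y) u = infAct E G y u := by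
  obtain ⟨he, hs⟩ : IsChartAround (chartAt F y) y := isChartAround_chartAt _
  have h := mfderiv_comp_apply_of_eq (1 : G)
    ((mdifferentiable_of_mem_maximalAtlas he).mdifferentiableAt hs)
    (mdifferentiable_smul_const E F y 1) (one_smul G y) u
  rw [coordAct, (chartAt F y).left_inv hs]
  exact h.trans (mfderiv_chartAt_self y _)

variable {L : TangentBundle 𝓘(ℝ, E) G × TangentBundle 𝓘(ℝ, F) N → ℝ}

theorem contMDiff_reduced
    (hL : ContMDiff (𝓘(ℝ, E).tangent.prod 𝓘(ℝ, F).tangent) 𝓘(ℝ, ℝ) 2 L) :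
    ContMDiff (𝓘(ℝ, E).prod 𝓘(ℝ, F).tangent) 𝓘(ℝ, ℝ) 2 (reduced L) :=
  hL.comp ((((contMDiff_mk (1 : G)).of_le two_le_infty).comp contMDiff_fst).prodMk contMDiff_snd)

/-- With the base points held fixed, `apply_eq_reduced` writes the restriction of `L` to the fibre
as `ℓ` composed with the linear right trivialisation; differentiate it. -/
theorem fibreDeriv_left (hL : ContMDiff (𝓘(ℝ, E).tangent.prod 𝓘(ℝ, F).tangent) 𝓘(ℝ, ℝ) 2 L)
    (hinv : RightInvariant L) (X : TangentBundle 𝓘(ℝ, E) G) (Y : TangentBundle 𝓘(ℝ, F) N) (a : E) :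
    fibreDeriv (fun X => L (X, Y)) X a =
      dlu (reduced L) (rightTriv X) (tangentMap 𝓘(ℝ, F) 𝓘(ℝ, F) (fun y : N => X.1 • y) Y)
        (rightTriv (⟨X.1, a⟩ : TangentBundle 𝓘(ℝ, E) G)) := by
  let A : E →L[ℝ] E := mfderiv 𝓘(ℝ, E) 𝓘(ℝ, E) (fun h : G => h * X.1⁻¹) X.1
  have h1 : (fun v : E => L (⟨X.1, v⟩, Y)) = fun v => reduced L (A v,
      tangentMap 𝓘(ℝ, F) 𝓘(ℝ, F) (fun y : N => X.1 • y) Y) := by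
    funext v
    exact apply_eq_reduced hinv ⟨X.1, v⟩ Y
  have h2 := HasFDerivAt.comp (f := A) (show E from X.2) (differentiableAt_reduced_left (contMDiff_reduced hL) (A X.2)
    (tangentMap 𝓘(ℝ, F) 𝓘(ℝ, F) (fun y : N => X.1 • y) Y)).hasFDerivAt A.hasFDerivAt
  rw [fibreDeriv, h1]
  exact congrArg (fun T : E →L[ℝ] ℝ => T a) h2.fderiv

theorem fibreDeriv_right (hL : ContMDiff (𝓘(ℝ, E).tangent.prod 𝓘(ℝ, F).tangent) 𝓘(ℝ, ℝ) 2 L)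
    (hinv : RightInvariant L) (X : TangentBundle 𝓘(ℝ, E) G) (Y : TangentBundle 𝓘(ℝ, F) N) (b : F) :
    fibreDeriv (fun Y => L (X, Y)) Y b =
      fibreDeriv (fun Z => reduced L (rightTriv X, Z))
        (tangentMap 𝓘(ℝ, F) 𝓘(ℝ, F) (fun y : N => X.1 • y) Y)
        (mfderiv 𝓘(ℝ, F) 𝓘(ℝ, F) (fun y : N => X.1 • y) Y.1 b) := by
  let A : F →L[ℝ] F := mfderiv 𝓘(ℝ, F) 𝓘(ℝ, F) (fun y : N => X.1 • y) Y.1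
  have h1 : (fun v : F => L (X, ⟨Y.1, v⟩)) = fun v => reduced L (rightTriv X, ⟨X.1 • Y.1, A v⟩) := by
    funext v
    exact apply_eq_reduced hinv X ⟨Y.1, v⟩
  have h2 := HasFDerivAt.comp (f := A) (show F from Y.2) (differentiableAt_reduced_fibre (contMDiff_reduced hL)
    (rightTriv X) (X.1 • Y.1) (A Y.2)).hasFDerivAt A.hasFDerivAt
  rw [fibreDeriv, h1]
  exact congrArg (fun T : F →L[ℝ] ℝ => T b) h2.fderiv

/-- The momentum pairing is itself invariant: it may be computed with `(δg, δη)` or with `(ξ, ϖ)`.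
This identity links the two first variation formulas. -/
theorem boundaryTerm_eq (hL : ContMDiff (𝓘(ℝ, E).tangent.prod 𝓘(ℝ, F).tangent) 𝓘(ℝ, ℝ) 2 L)
    (hinv : RightInvariant L) (γ : ℝ → ℝ → G) (h : ℝ → ℝ → N) :
    boundaryTerm L γ h =
      reducedBoundaryTerm (reduced L) (γ 0) (h 0) (xiCurve γ) (varpiCurve γ h) := by
  funext s
  rw [boundaryTerm, fibreDeriv_left hL hinv, fibreDeriv_right hL hinv]
  rfl

variable {g : ℝ → G} {η : ℝ → N}

/-- The constraint reads `g δη = -ξ n` with `ξ = δg g⁻¹`, so on admissible pairs the momentum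
pairing is the endpoint functional evaluated at `ξ`. Every `ξ` occurs, since translation by `g₁` is
onto on tangent vectors and the constraint can be solved for `δη`. -/
theorem naturalBoundary_iff_endpointCondition
    (hL : ContMDiff (𝓘(ℝ, E).tangent.prod 𝓘(ℝ, F).tangent) 𝓘(ℝ, ℝ) 2 L)
    (hinv : RightInvariant L) :
    NaturalBoundary g η L ↔ EndpointCondition g η (reduced L) := by
  have key : ∀ (a : E) (b : F),
      mfderiv 𝓘(ℝ, E) 𝓘(ℝ, F) (fun k : G => k • η 1) (g 1) a +
        mfderiv 𝓘(ℝ, F) 𝓘(ℝ, F) (fun y : N => g 1 • y) (η 1) b = (0 : F) →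
      fibreDeriv (fun X => L (X, velocityLift η 1)) (velocityLift g 1) a +
        fibreDeriv (fun Y => L (velocityLift g 1, Y)) (velocityLift η 1) b =
      (dlu (reduced L) (uCurve g 1) (nuCurve g η 1)
        + diamond (fibreDeriv (fun Y => reduced L (uCurve g 1, Y)) (nuCurve g η 1))
          (infAct E G (nCurve g η 1))) (rightTriv (⟨g 1, a⟩ : TangentBundle 𝓘(ℝ, E) G)) := by
    intro a b hab
    rw [fibreDeriv_left hL hinv, fibreDeriv_right hL hinv, add_apply, diamond, neg_apply,
      ContinuousLinearMap.comp_apply]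
    rw [mfderiv_smul_const] at hab
    have hb := eq_neg_of_add_eq_zero_right hab
    have h1 : fibreDeriv (fun Y => reduced L (uCurve g 1, Y)) (nuCurve g η 1)
        (mfderiv 𝓘(ℝ, F) 𝓘(ℝ, F) (fun y : N => g 1 • y) (η 1) b) =
        -fibreDeriv (fun Y => reduced L (uCurve g 1, Y)) (nuCurve g η 1) (infAct E G (nCurve g η 1)
          (rightTriv (⟨g 1, a⟩ : TangentBundle 𝓘(ℝ, E) G))) := by
      rw [← map_neg]
      exact congrArg _ hb
    exact congrArg₂ (· + ·) rfl h1
  constructor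
  · intro hNB
    refine ContinuousLinearMap.ext fun ζ => ?_
    obtain ⟨a, rfl⟩ := exists_rightTriv_eq (g 1) ζ
    obtain ⟨b, hb⟩ := exists_mfderiv_const_smul_eq (mdifferentiable_const_smul E F) (g 1) (η 1)
      (-(show F from mfderiv 𝓘(ℝ, E) 𝓘(ℝ, F) (fun k : G => k • η 1) (g 1) a))
    have hab : mfderiv 𝓘(ℝ, E) 𝓘(ℝ, F) (fun k : G => k • η 1) (g 1) a +
        mfderiv 𝓘(ℝ, F) 𝓘(ℝ, F) (fun y : N => g 1 • y) (η 1) b = (0 : F) := by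
      rw [hb]
      exact add_neg_cancel _
    exact (key a b hab).symm.trans (hNB a b hab)
  · intro hEC a b hab
    have hEC' : _ = (0 : E →L[ℝ] ℝ) := hEC
    refine (key a b hab).trans ?_
    rw [hEC']
    rfl

theorem contDiffAt_uCurve {t : ℝ} (hg : ContMDiffAt 𝓘(ℝ, ℝ) 𝓘(ℝ, E) 2 g t) :
    ContDiffAt ℝ 1 (uCurve (E := E) g) t :=
  contDiffAt_rightTriv_dirLift hg 1

theorem contMDiffAt_nuCurve {t : ℝ} (hg : ContMDiffAt 𝓘(ℝ, ℝ) 𝓘(ℝ, E) 2 g t)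
    (hη : ContMDiffAt 𝓘(ℝ, ℝ) 𝓘(ℝ, F) 2 η t) :
    ContMDiffAt 𝓘(ℝ, ℝ) 𝓘(ℝ, F).tangent 1 (nuCurve (F := F) g η) t :=
  contMDiffAt_tangentMap_smul hg hη 1

/-- The auxiliary equation `ṅ = ν + u n`. -/
theorem velocityLift_nCurve {t : ℝ} (hg : ContMDiffAt 𝓘(ℝ, ℝ) 𝓘(ℝ, E) 2 g t)
    (hη : ContMDiffAt 𝓘(ℝ, ℝ) 𝓘(ℝ, F) 2 η t) :
    vecPart (velocityLift (E := F) (nCurve g η) t) =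
      vecPart (nuCurve g η t) + infAct E G (nCurve g η t) (uCurve g t) := by
  have hg' := hg.mdifferentiableAt (by norm_num)
  have hη' := hη.mdifferentiableAt (by norm_num)
  obtain ⟨he, hs⟩ : IsChartAround (chartAt F (nCurve g η t)) (nCurve g η t) :=
    isChartAround_chartAt _
  have hn : MDifferentiableAt 𝓘(ℝ, ℝ) 𝓘(ℝ, F) (nCurve g η) t :=
    (contMDiffAt_smul E two_le_infty hg hη).mdifferentiableAt (by norm_num)
  have h := fderiv_smul he hg' hη' hs 1
  rw [← fibreCoord_chartAt_of_eq (velocityLift (E := F) (nCurve g η) t) rfl,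
    ← fibreCoord_chartAt_of_eq (nuCurve (F := F) g η t) rfl, add_comm]
  refine (fibreCoord_dirLift he hn hs 1).trans (h.trans (congrArg (· + _) ?_))
  exact coordAct_chartAt_self _ _

end Reduction

/-! ### From (EP) to the reduced principles, and from these to Hamilton's principles. -/

section Principles

variable {E : Type*} [NormedAddCommGroup E] [NormedSpace ℝ E]
  {F : Type*} [NormedAddCommGroup F] [NormedSpace ℝ F]
  {G : Type*} [TopologicalSpace G] [ChartedSpace E G] [Group G] [LieGroup 𝓘(ℝ, E) ∞ G]
  {N : Type*} [TopologicalSpace N] [ChartedSpace F N] [IsManifold 𝓘(ℝ, F) ∞ N]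
  [MulAction G N] [ContMDiffSMul 𝓘(ℝ, E) 𝓘(ℝ, F) ∞ G N]
  {L : TangentBundle 𝓘(ℝ, E) G × TangentBundle 𝓘(ℝ, F) N → ℝ}
  {l : E × TangentBundle 𝓘(ℝ, F) N → ℝ} {g : ℝ → G} {η : ℝ → N}

theorem integral_eq_sub_of_hasDerivAt_Icc {ψ δ : ℝ → ℝ}
    (hψ : ∀ t ∈ Icc (0 : ℝ) 1, HasDerivAt ψ (δ t) t) (hδ : ContinuousOn δ (Icc 0 1)) :
    ∫ t in (0 : ℝ)..1, δ t = ψ 1 - ψ 0 := by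
  rw [← uIcc_of_le zero_le_one] at hψ hδ
  exact intervalIntegral.integral_eq_sub_of_hasDerivAt hψ hδ.intervalIntegrable

theorem EulerPoincare.eulerPoincareU_eq (h : EulerPoincare g η l) {t : ℝ}
    (ht : t ∈ Icc (0 : ℝ) 1) {e : OpenPartialHomeomorph N F} (he : IsChartAround e (nCurve g η t))
    (ζ : E) : eulerPoincareU l g η e t ζ = 0 :=
  h.eq_u t ht e he ζ

theorem EulerPoincare.eulerPoincareNu_eq (h : EulerPoincare (E := E) g η l) {t : ℝ}
    (ht : t ∈ Icc (0 : ℝ) 1) {e : OpenPartialHomeomorph N F}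
    (he : IsChartAround e (nCurve g η t)) : eulerPoincareNu l g η e t = 0 :=
  (h.eq_nu t ht e he).2

/-- Along a solution of the Euler-Poincaré equations, the first variation of the reduced action
is a boundary term. -/
theorem EulerPoincare.hasDerivAt_reducedAction (h : EulerPoincare g η l)
    (hl : ContMDiff (𝓘(ℝ, E).prod 𝓘(ℝ, F).tangent) 𝓘(ℝ, ℝ) 2 l)
    {U : ℝ → ℝ → E} {V : ℝ → ℝ → TangentBundle 𝓘(ℝ, F) N}
    {ξ : ℝ → E} {ϖ : (t : ℝ) → TangentSpace 𝓘(ℝ, F) (nCurve g η t)}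
    (hv : IsReducedVariation g η U V ξ ϖ) :
    HasDerivAt (fun ε => reducedAction l (U ε) (V ε))
      (reducedBoundaryTerm l g η ξ ϖ 1 - reducedBoundaryTerm l g η ξ ϖ 0) 0 := by
  have hf : ∀ t ∈ Icc (0 : ℝ) 1, ContDiffAt ℝ 1 (fun p : ℝ × ℝ => l (U p.1 p.2, V p.1 p.2)) (0, t) :=
    fun t ht => hv.contDiffAt_comp hl ht
  rw [← integral_eq_sub_of_hasDerivAt_Icc (fun t ht => ?_) (continuousOn_fderiv_slice hf (1, 0))]
  · exact hasDerivAt_integral_of_contDiffAt hf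
  · have he : IsChartAround (chartAt F (nCurve g η t)) (nCurve g η t) := isChartAround_chartAt _
    have h1 := hv.hasDerivAt_reducedBoundaryTerm hl ht he
    rwa [h.eulerPoincareU_eq ht he, h.eulerPoincareNu_eq ht he, zero_apply,
      add_zero, add_zero] at h1

theorem reducedBoundaryTerm_eq_zero {ξ : ℝ → E} {ϖ : (t : ℝ) → TangentSpace 𝓘(ℝ, F) (nCurve g η t)}
    {s : ℝ} (hξ : ξ s = 0) (hϖ : ϖ s = 0) : reducedBoundaryTerm l g η ξ ϖ s = 0 := by
  have h1 : vecPart (⟨nCurve g η s, ϖ s⟩ : TangentBundle 𝓘(ℝ, F) N) = 0 := hϖ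
  rw [reducedBoundaryTerm, hξ, h1, map_zero, map_zero, add_zero]

theorem reducedBoundaryTerm_eq_of_add_eq_zero {ξ : ℝ → E}
    {ϖ : (t : ℝ) → TangentSpace 𝓘(ℝ, F) (nCurve g η t)}
    (h : vecPart (⟨nCurve g η 1, ϖ 1⟩ : TangentBundle 𝓘(ℝ, F) N) +
      infAct E G (nCurve g η 1) (ξ 1) = 0) :
    reducedBoundaryTerm l g η ξ ϖ 1 = (dlu l (uCurve g 1) (nuCurve g η 1)
      + diamond (fibreDeriv (fun Y => l (uCurve g 1, Y)) (nuCurve g η 1))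
        (infAct E G (nCurve g η 1))) (ξ 1) := by
  rw [reducedBoundaryTerm, eq_neg_of_add_eq_zero_left h, map_neg]
  rfl

theorem EulerPoincare.reducedFixedEnds (h : EulerPoincare g η l)
    (hl : ContMDiff (𝓘(ℝ, E).prod 𝓘(ℝ, F).tangent) 𝓘(ℝ, ℝ) 2 l) : ReducedFixedEnds g η l := by
  intro U V ξ ϖ hv hξ0 hϖ0 hξ1 hϖ1
  have h1 := h.hasDerivAt_reducedAction hl hv
  rwa [reducedBoundaryTerm_eq_zero hξ0 hϖ0, reducedBoundaryTerm_eq_zero hξ1 hϖ1, sub_zero] at h1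

theorem EulerPoincare.reducedFixedImages (h : EulerPoincare g η l) (h' : EndpointCondition g η l)
    (hl : ContMDiff (𝓘(ℝ, E).prod 𝓘(ℝ, F).tangent) 𝓘(ℝ, ℝ) 2 l) : ReducedFixedImages g η l := by
  intro U V ξ ϖ hv hξ0 hϖ0 h1
  have h2 := h.hasDerivAt_reducedAction hl hv
  have h3 : _ = (0 : E →L[ℝ] ℝ) := h'
  rwa [reducedBoundaryTerm_eq_zero hξ0 hϖ0, reducedBoundaryTerm_eq_of_add_eq_zero h1, h3,
    zero_apply, sub_zero] at h2

theorem vecPart_velocityLift_eq_zero {M : Type*} [TopologicalSpace M] [ChartedSpace E M]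
    {c : ℝ → M} {x : M} {s : ℝ} (h : ∀ᶠ r in 𝓝 s, c r = x) :
    vecPart (velocityLift (E := E) c s) = 0 := by
  have h1 : c =ᶠ[𝓝 s] fun _ => x := h
  have h2 := h1.mfderiv_eq (I := 𝓘(ℝ, ℝ)) (I' := 𝓘(ℝ, E))
  rw [mfderiv_const] at h2
  exact congrArg (fun T : ℝ →L[ℝ] E => T 1) h2

theorem rightTriv_eq_zero {X : TangentBundle 𝓘(ℝ, E) G} (h : vecPart X = 0) : rightTriv X = 0 := by
  have h1 : X.2 = 0 := h
  rw [rightTriv, h1]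
  exact map_zero _

variable {γ : ℝ → ℝ → G} {h : ℝ → ℝ → N} {s : ℝ}

theorem xiCurve_eq_zero {k : G} (hγ : ∀ᶠ ε in 𝓝 (0 : ℝ), γ ε s = k) :
    xiCurve (E := E) γ s = 0 :=
  rightTriv_eq_zero (vecPart_velocityLift_eq_zero hγ)

theorem varpiCurve_eq_zero {y : N} (hh : ∀ᶠ ε in 𝓝 (0 : ℝ), h ε s = y) :
    varpiCurve (F := F) γ h s = 0 := by
  have h2 : mfderiv 𝓘(ℝ, ℝ) 𝓘(ℝ, F) (fun ε => h ε s) 0 (1 : ℝ) = 0 :=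
    vecPart_velocityLift_eq_zero (E := F) hh
  rw [varpiCurve, h2]
  exact map_zero _

/-- The sum is `δn` in the preferred chart, the derivative of a quantity locally constant in `ε`. -/
theorem IsDeformation.varpiCurve_add_infAct
    (hd : IsDeformation (E := E) (F := F) (γ 0) (h 0) γ h) (hs : s ∈ Icc (0 : ℝ) 1)
    (hn : ∀ᶠ ε in 𝓝 (0 : ℝ), γ ε s • h ε s = nCurve (γ 0) (h 0) s) :
    vecPart (⟨nCurve (γ 0) (h 0) s, varpiCurve γ h s⟩ : TangentBundle 𝓘(ℝ, F) N) +
      infAct E G (nCurve (γ 0) (h 0) s) (xiCurve γ s) = 0 := by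
  have he : IsChartAround (chartAt F (nCurve (γ 0) (h 0) s)) (nCurve (γ 0) (h 0) s) :=
    isChartAround_chartAt _
  have h1 := hd.isReducedVariation.var_n s hs _ he
  have h2 : fibreCoord (chartAt F (nCurve (γ 0) (h 0) s))
      (⟨nCurve (γ 0) (h 0) s, varpiCurve γ h s⟩ : TangentBundle 𝓘(ℝ, F) N) =
      vecPart (⟨nCurve (γ 0) (h 0) s, varpiCurve γ h s⟩ : TangentBundle 𝓘(ℝ, F) N) :=
    fibreCoord_chartAt_self _ _
  rw [h2, coordAct_chartAt_self] at h1
  refine h1.unique ((hasDerivAt_const (0 : ℝ)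
    (chartAt F (nCurve (γ 0) (h 0) s) (nCurve (γ 0) (h 0) s))).congr_of_eventuallyEq ?_)
  filter_upwards [hn] with ε hε
  exact congrArg _ hε

theorem ReducedFixedEnds.hamiltonFixedEnds (hR : ReducedFixedEnds g η (reduced L))
    (hinv : RightInvariant L) : HamiltonFixedEnds g η L := by
  intro γ h hd hfix
  obtain rfl := hd.base_g
  obtain rfl := hd.base_η
  simp only [action_eq_reducedAction hinv]
  exact hR _ _ _ _ hd.isReducedVariation
    (xiCurve_eq_zero (hfix.mono fun ε hε => hε.1))
    (varpiCurve_eq_zero (hfix.mono fun ε hε => hε.2.2.1))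
    (xiCurve_eq_zero (hfix.mono fun ε hε => hε.2.1))
    (varpiCurve_eq_zero (hfix.mono fun ε hε => hε.2.2.2))

theorem ReducedFixedImages.hamiltonFixedImages (hR : ReducedFixedImages g η (reduced L))
    (hinv : RightInvariant L) : HamiltonFixedImages g η L := by
  intro γ h hd hfix
  obtain rfl := hd.base_g
  obtain rfl := hd.base_η
  simp only [action_eq_reducedAction hinv]
  refine hR _ _ _ _ hd.isReducedVariation
    (xiCurve_eq_zero (hfix.mono fun ε hε => hε.1))
    (varpiCurve_eq_zero (y := nCurve (γ 0) (h 0) 0) (hfix.mono fun ε hε => ?_))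
    (hd.varpiCurve_add_infAct (right_mem_Icc.2 zero_le_one) (hfix.mono fun ε hε => hε.2.2))
  have h1 := hε.2.1
  rwa [hε.1, one_smul] at h1

/-- Fixing both curves at both ends also fixes the images, so this is a restriction to fewer
deformations. -/
theorem HamiltonFixedImages.hamiltonFixedEnds (hH : HamiltonFixedImages (E := E) (F := F) g η L)
    (hg0 : g 0 = 1) : HamiltonFixedEnds g η L := by
  intro γ h hd hfix
  refine hH γ h hd (hfix.mono ?_)
  rintro ε ⟨h1, h2, h3, h4⟩
  exact ⟨h1.trans hg0, by rw [h1, h3]; rfl, by rw [h2, h4]; rfl⟩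

end Principles

/-! ### Deformations supported in a chart. -/

section ChartDeformation

variable {E : Type*} [NormedAddCommGroup E] [NormedSpace ℝ E]
  {M : Type*} [TopologicalSpace M] [ChartedSpace E M] [IsManifold 𝓘(ℝ, E) ∞ M]

open Classical in
/-- The deformation of the curve `c` by `ε φ(t) a` in the chart `e`. -/
def chartDeformation (e : OpenPartialHomeomorph M E) (c : ℝ → M) (φ : ℝ → ℝ) (a : E) (ε t : ℝ) : M :=
  if c t ∈ e.source then e.symm (e (c t) + (ε * φ t) • a) else c t

variable {e : OpenPartialHomeomorph M E} {c : ℝ → M} {φ : ℝ → ℝ} {a : E} {t : ℝ}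

theorem chartDeformation_of_mul_eq_zero {ε : ℝ} (h : ε * φ t = 0) :
    chartDeformation e c φ a ε t = c t := by
  rw [chartDeformation, h, zero_smul, add_zero]
  split_ifs with hs
  · exact e.left_inv hs
  · rfl

variable (e c φ a) in
theorem chartDeformation_zero : chartDeformation e c φ a 0 = c :=
  funext fun _ => chartDeformation_of_mul_eq_zero (zero_mul _)

/-- The two branches of the definition fit together: where the curve has left the chart, `φ`
vanishes on a neighbourhood in time and the deformation is the undeformed curve. -/
theorem contMDiffAt_chartDeformation (he : e ∈ IsManifold.maximalAtlas 𝓘(ℝ, E) ∞ M)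
    (hc : ContMDiffAt 𝓘(ℝ, ℝ) 𝓘(ℝ, E) 2 c t) (hφ : ContDiff ℝ 2 φ)
    (ht : t ∈ tsupport φ → c t ∈ e.source) :
    ContMDiffAt 𝓘(ℝ, ℝ × ℝ) 𝓘(ℝ, E) 2
      (fun p : ℝ × ℝ => chartDeformation e c φ a p.1 p.2) (0, t) := by
  have hc2 : ContMDiffAt 𝓘(ℝ, ℝ × ℝ) 𝓘(ℝ, E) 2 (fun p : ℝ × ℝ => c p.2) (0, t) :=
    ContMDiffAt.comp ((0 : ℝ), t) (f := fun p : ℝ × ℝ => p.2) hc contDiffAt_snd.contMDiffAt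
  by_cases hs : c t ∈ e.source
  · have hx : ContDiffAt ℝ 2 (fun p : ℝ × ℝ => e (c p.2) + (p.1 * φ p.2) • a) (0, t) :=
      (contDiffAt_chart_comp he two_le_infty hc2 hs).add
        ((contDiffAt_fst.mul (hφ.comp contDiff_snd).contDiffAt).smul contDiffAt_const)
    have hy : e (c t) + ((0 : ℝ) * φ t) • a ∈ e.target := by
      rw [zero_mul, zero_smul, add_zero]
      exact e.map_source hs
    have h1 := ContMDiffAt.comp ((0 : ℝ), t)
      (((contMDiffOn_symm_of_mem_maximalAtlas he).contMDiffAt (e.open_target.mem_nhds hy)).of_le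
        two_le_infty) hx.contMDiffAt
    refine h1.congr_of_eventuallyEq ?_
    filter_upwards [eventually_mem_source hc2.continuousAt hs] with p hp
    exact if_pos hp
  · have h1 : t ∉ tsupport φ := fun h => hs (ht h)
    refine hc2.congr_of_eventuallyEq ?_
    have h2 := (notMem_tsupport_iff_eventuallyEq.1 h1)
    have h3 : ∀ᶠ p : ℝ × ℝ in 𝓝 (0, t), φ p.2 = 0 := 
      (continuous_snd.tendsto ((0 : ℝ), t)).eventually h2
    filter_upwards [h3] with p hp
    exact chartDeformation_of_mul_eq_zero (by rw [hp, mul_zero])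

theorem hasDerivAt_chart_chartDeformation (hs : c t ∈ e.source) :
    HasDerivAt (fun ε => e (chartDeformation e c φ a ε t)) (φ t • a) 0 := by
  have h1 : HasDerivAt (fun ε : ℝ => e (c t) + (ε * φ t) • a) (φ t • a) 0 := by
    simpa using (((hasDerivAt_id (0 : ℝ)).mul_const (φ t)).smul_const a).const_add (e (c t))
  refine h1.congr_of_eventuallyEq ?_
  have h2 : e (c t) + ((0 : ℝ) * φ t) • a ∈ e.target := by
    rw [zero_mul, zero_smul, add_zero]
    exact e.map_source hs
  filter_upwards [h1.continuousAt.eventually (e.open_target.mem_nhds h2)] with ε hε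
  rw [chartDeformation, if_pos hs]
  exact e.right_inv hε

theorem fderiv_chart_chartDeformation (he : e ∈ IsManifold.maximalAtlas 𝓘(ℝ, E) ∞ M)
    (hc : ContMDiffAt 𝓘(ℝ, ℝ) 𝓘(ℝ, E) 2 c t) (hφ : ContDiff ℝ 2 φ) (hs : c t ∈ e.source) :
    fderiv ℝ (fun p : ℝ × ℝ => e (chartDeformation e c φ a p.1 p.2)) (0, t) (1, 0) = φ t • a := by
  have h0 : chartDeformation e c φ a 0 t ∈ e.source := by rwa [chartDeformation_zero]
  have h1 := contDiffAt_chart_comp he two_le_infty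
    (contMDiffAt_chartDeformation (a := a) he hc hφ fun _ => hs) h0
  exact (hasDerivAt_slice_left (h1.differentiableAt (by norm_num))).unique
    (hasDerivAt_chart_chartDeformation hs)

/-- A separate chart `e'` is needed because, off the support of `φ`, the curve may have left the
chart `e` of the deformation. -/
theorem fderiv_chart_chartDeformation_of_eq_zero {e' : OpenPartialHomeomorph M E}
    (he : e ∈ IsManifold.maximalAtlas 𝓘(ℝ, E) ∞ M)
    (hc : ContMDiffAt 𝓘(ℝ, ℝ) 𝓘(ℝ, E) 2 c t) (hφ : ContDiff ℝ 2 φ)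
    (ht : t ∈ tsupport φ → c t ∈ e.source) (he' : IsChartAround e' (c t)) (h : φ t = 0) :
    fderiv ℝ (fun p : ℝ × ℝ => e' (chartDeformation e c φ a p.1 p.2)) (0, t) (1, 0) = 0 := by
  have h0 : chartDeformation e c φ a 0 t ∈ e'.source := by
    rw [chartDeformation_zero]
    exact he'.2
  have h1 := contDiffAt_chart_comp he'.1 two_le_infty
    (contMDiffAt_chartDeformation (a := a) he hc hφ ht) h0
  refine (hasDerivAt_slice_left (h1.differentiableAt (by norm_num))).unique
    ((hasDerivAt_const (0 : ℝ) (e' (c t))).congr_of_eventuallyEq (Eventually.of_forall fun ε => ?_))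
  exact congrArg e' (chartDeformation_of_mul_eq_zero (by rw [h, mul_zero]))

theorem vecPart_velocityLift_chartDeformation
    (hc : ContMDiffAt 𝓘(ℝ, ℝ) 𝓘(ℝ, E) 2 c t) (hφ : ContDiff ℝ 2 φ) :
    vecPart (velocityLift (E := E)
      (fun ε => chartDeformation (chartAt E (c t)) c φ a ε t) 0) = φ t • a := by
  obtain ⟨he, hs⟩ : IsChartAround (chartAt E (c t)) (c t) := isChartAround_chartAt _
  have h0 : chartDeformation (chartAt E (c t)) c φ a 0 t = c t := by rw [chartDeformation_zero]
  have h1 : MDifferentiableAt 𝓘(ℝ, ℝ) 𝓘(ℝ, E)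
      (fun ε => chartDeformation (chartAt E (c t)) c φ a ε t) 0 :=
    ((contMDiffAt_chartDeformation (a := a) he hc hφ fun _ => hs).comp (0 : ℝ)
      (contDiffAt_id.prodMk (contDiffAt_const (c := t))).contMDiffAt
      (f := fun ε : ℝ => (ε, t))).mdifferentiableAt (by norm_num)
  rw [← fibreCoord_chartAt_of_eq _ h0]
  refine (fibreCoord_dirLift he h1 (by rwa [h0]) 1).trans ?_
  rw [fderiv_apply_one_eq_deriv]
  exact (hasDerivAt_chart_chartDeformation hs).deriv

theorem isDeformation_chartDeformation {F : Type*} [NormedAddCommGroup F] [NormedSpace ℝ F]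
    {N : Type*} [TopologicalSpace N] [ChartedSpace F N] [IsManifold 𝓘(ℝ, F) ∞ N]
    {η : ℝ → N} {e₂ : OpenPartialHomeomorph N F} {b : F}
    (hc : ∀ t ∈ Icc (0 : ℝ) 1, ContMDiffAt 𝓘(ℝ, ℝ) 𝓘(ℝ, E) 2 c t)
    (hη : ∀ t ∈ Icc (0 : ℝ) 1, ContMDiffAt 𝓘(ℝ, ℝ) 𝓘(ℝ, F) 2 η t)
    (he : e ∈ IsManifold.maximalAtlas 𝓘(ℝ, E) ∞ M) (he₂ : e₂ ∈ IsManifold.maximalAtlas 𝓘(ℝ, F) ∞ N)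
    (hφ : ContDiff ℝ 2 φ) (hs : ∀ t ∈ tsupport φ, c t ∈ e.source)
    (hs₂ : ∀ t ∈ tsupport φ, η t ∈ e₂.source) :
    IsDeformation (E := E) (F := F) c η (chartDeformation e c φ a) (chartDeformation e₂ η φ b) where
  base_g := chartDeformation_zero e c φ a
  base_η := chartDeformation_zero e₂ η φ b
  smooth_g t ht := contMDiffAt_chartDeformation he (hc t ht) hφ (hs t)
  smooth_η t ht := contMDiffAt_chartDeformation he₂ (hη t ht) hφ (hs₂ t)

end ChartDeformation

/-! ### The fundamental lemma and the Euler-Lagrange equations. -/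

section Hamilton

/-- The fundamental lemma of the calculus of variations at a point of `[0,1]`. -/
theorem eq_zero_of_integral_mul_eq_zero {K : ℝ → ℝ} {J : Set ℝ} (hJ : IsOpen J) {t : ℝ}
    (ht : t ∈ J) (ht' : t ∈ Icc (0 : ℝ) 1) (hK : ∀ s ∈ J ∩ Icc 0 1, ContinuousAt K s)
    (h : ∀ φ : ℝ → ℝ, ContDiff ℝ ∞ φ → tsupport φ ⊆ J ∩ Ioo 0 1 →
      ∫ s in (0 : ℝ)..1, φ s * K s = 0) : K t = 0 := by
  have hU : IsOpen (J ∩ Ioo (0 : ℝ) 1) := hJ.inter isOpen_Ioo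
  have hc : ContinuousOn K (J ∩ Ioo (0 : ℝ) 1) := fun s hs =>
    (hK s ⟨hs.1, Ioo_subset_Icc_self hs.2⟩).continuousWithinAt
  have h1 : ∀ᵐ s ∂(MeasureTheory.volume : MeasureTheory.Measure ℝ),
      s ∈ J ∩ Ioo (0 : ℝ) 1 → K s = 0 := by
    refine hU.ae_eq_zero_of_integral_contDiff_smul_eq_zero
      (hc.locallyIntegrableOn hU.measurableSet) fun φ hφ _ hs => ?_
    rw [← h φ hφ hs]
    refine (intervalIntegral.integral_eq_integral_of_support_subset ?_).symm
    intro s hs'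
    have h2 : s ∈ tsupport φ := subset_tsupport φ fun h0 => hs' (by simp [h0])
    exact Ioo_subset_Ioc_self (hs h2).2
  have h2 : EqOn K (fun _ => 0) (J ∩ Ioo 0 1) :=
    MeasureTheory.Measure.eqOn_open_of_ae_eq
      ((MeasureTheory.ae_restrict_iff' hU.measurableSet).2 h1) hU hc continuousOn_const
  -- Since `t` may be an endpoint, vanishing is known only at nearby interior times; continuity of
  -- `K` at `t` carries it over.
  have h3 : t ∈ closure (J ∩ Ioo 0 1) :=
    hJ.inter_closure ⟨ht, by rwa [closure_Ioo zero_ne_one]⟩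
  by_contra hne
  obtain ⟨s, hs, hs'⟩ := ((mem_closure_iff_frequently.1 h3).and_eventually
    ((hK t ⟨ht, ht'⟩).eventually_ne hne)).exists
  exact hs' (h2 hs)

variable {E : Type*} [NormedAddCommGroup E] [NormedSpace ℝ E]
  {F : Type*} [NormedAddCommGroup F] [NormedSpace ℝ F]

section Manifolds

variable
  {G : Type*} [TopologicalSpace G] [ChartedSpace E G] [IsManifold 𝓘(ℝ, E) ∞ G]
  {N : Type*} [TopologicalSpace N] [ChartedSpace F N] [IsManifold 𝓘(ℝ, F) ∞ N]
  {L : TangentBundle 𝓘(ℝ, E) G × TangentBundle 𝓘(ℝ, F) N → ℝ} {g : ℝ → G} {η : ℝ → N}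

theorem boundaryTerm_eq_zero {γ : ℝ → ℝ → G} {h : ℝ → ℝ → N} {s : ℝ} {k : G} {y : N}
    (hγ : ∀ᶠ ε in 𝓝 (0 : ℝ), γ ε s = k) (hh : ∀ᶠ ε in 𝓝 (0 : ℝ), h ε s = y) :
    boundaryTerm L γ h s = 0 := by
  rw [boundaryTerm, vecPart_velocityLift_eq_zero hγ, vecPart_velocityLift_eq_zero hh, map_zero,
    map_zero, add_zero]

theorem hasDerivAt_action
    (hL : ContMDiff (𝓘(ℝ, E).tangent.prod 𝓘(ℝ, F).tangent) 𝓘(ℝ, ℝ) 2 L)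
    {γ : ℝ → ℝ → G} {h : ℝ → ℝ → N} (hd : IsDeformation (E := E) (F := F) g η γ h) :
    HasDerivAt (fun ε => action L (γ ε) (h ε)) (∫ t in (0 : ℝ)..1,
      fderiv ℝ (fun p : ℝ × ℝ => L (velocityLift (γ p.1) p.2, velocityLift (h p.1) p.2))
        (0, t) (1, 0)) 0 :=
  hasDerivAt_integral_of_contDiffAt fun t ht =>
    contDiffAt_lagrangian_deformation hL (hd.smooth_g t ht) (hd.smooth_η t ht)

variable (hL : ContMDiff (𝓘(ℝ, E).tangent.prod 𝓘(ℝ, F).tangent) 𝓘(ℝ, ℝ) 2 L)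
  (hg : ∀ t ∈ Icc (0 : ℝ) 1, ContMDiffAt 𝓘(ℝ, ℝ) 𝓘(ℝ, E) 2 g t)
  (hη : ∀ t ∈ Icc (0 : ℝ) 1, ContMDiffAt 𝓘(ℝ, ℝ) 𝓘(ℝ, F) 2 η t)

include hL hg hη

theorem hasDerivAt_boundaryTerm_chartDeformation {e₁ : OpenPartialHomeomorph G E}
    {e₂ : OpenPartialHomeomorph N F} (he₁ : e₁ ∈ IsManifold.maximalAtlas 𝓘(ℝ, E) ∞ G)
    (he₂ : e₂ ∈ IsManifold.maximalAtlas 𝓘(ℝ, F) ∞ N) {φ : ℝ → ℝ} (hφ : ContDiff ℝ 2 φ)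
    (hs₁ : ∀ t ∈ tsupport φ, g t ∈ e₁.source) (hs₂ : ∀ t ∈ tsupport φ, η t ∈ e₂.source)
    (a : E) (b : F) {t : ℝ} (ht : t ∈ Icc (0 : ℝ) 1) :
    HasDerivAt (boundaryTerm L (chartDeformation e₁ g φ a) (chartDeformation e₂ η φ b))
      (fderiv ℝ (fun p : ℝ × ℝ => L (velocityLift (chartDeformation e₁ g φ a p.1) p.2,
          velocityLift (chartDeformation e₂ η φ b p.1) p.2)) (0, t) (1, 0) +
        φ t * (eulerLagrangeCovector (fun s X => L (X, velocityLift η s)) e₁ g t a +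
          eulerLagrangeCovector (fun s Y => L (velocityLift g s, Y)) e₂ η t b)) t := by
  have hγ := contMDiffAt_chartDeformation (a := a) he₁ (hg t ht) hφ (hs₁ t)
  have hh := contMDiffAt_chartDeformation (a := b) he₂ (hη t ht) hφ (hs₂ t)
  by_cases h : t ∈ tsupport φ
  · have h1 := hasDerivAt_boundaryTerm hL hγ hh (e₁ := e₁) (e₂ := e₂)
      (by rw [chartDeformation_zero]; exact ⟨he₁, hs₁ t h⟩)
      (by rw [chartDeformation_zero]; exact ⟨he₂, hs₂ t h⟩)
    rw [fderiv_chart_chartDeformation he₁ (hg t ht) hφ (hs₁ t h),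
      fderiv_chart_chartDeformation he₂ (hη t ht) hφ (hs₂ t h), chartDeformation_zero,
      chartDeformation_zero, map_smul, map_smul, ← smul_add, smul_eq_mul] at h1
    exact h1
  · have h0 : φ t = 0 := image_eq_zero_of_notMem_tsupport h
    have hc₁ : IsChartAround (chartAt E (g t)) (g t) := isChartAround_chartAt _
    have hc₂ : IsChartAround (chartAt F (η t)) (η t) := isChartAround_chartAt _
    have h1 := hasDerivAt_boundaryTerm hL hγ hh (e₁ := chartAt E (g t)) (e₂ := chartAt F (η t))
      (by rwa [chartDeformation_zero]) (by rwa [chartDeformation_zero])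
    rw [fderiv_chart_chartDeformation_of_eq_zero he₁ (hg t ht) hφ (hs₁ t) hc₁ h0,
      fderiv_chart_chartDeformation_of_eq_zero he₂ (hη t ht) hφ (hs₂ t) hc₂ h0, map_zero, map_zero,
      add_zero] at h1
    rwa [h0, zero_mul]

/-- Deform by `ε φ a` and `ε φ b` with `φ` supported in the open interval. The boundary terms
vanish, so integrating the first variation formula leaves the integral of `φ` times the left side,
and the fundamental lemma applies. -/
theorem HamiltonFixedEnds.eulerLagrangeCovector_eq_zero
    (hH : HamiltonFixedEnds (E := E) (F := F) g η L) {t : ℝ} (ht : t ∈ Icc (0 : ℝ) 1)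
    {e₁ : OpenPartialHomeomorph G E} {e₂ : OpenPartialHomeomorph N F}
    (he₁ : IsChartAround e₁ (g t)) (he₂ : IsChartAround e₂ (η t)) (a : E) (b : F) :
    eulerLagrangeCovector (fun s X => L (X, velocityLift η s)) e₁ g t a +
      eulerLagrangeCovector (fun s Y => L (velocityLift g s, Y)) e₂ η t b = 0 := by
  -- The curves need not be continuous away from `[0,1]`, so the set of times spent in both charts
  -- need not be open; its interior still contains `t`.
  have hJ : t ∈ interior {s | g s ∈ e₁.source ∧ η s ∈ e₂.source} := by
    rw [mem_interior_iff_mem_nhds]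
    filter_upwards [eventually_mem_source (hg t ht).continuousAt he₁.2,
      eventually_mem_source (hη t ht).continuousAt he₂.2] with s h1 h2 using ⟨h1, h2⟩
  have hK : ∀ s ∈ interior {s | g s ∈ e₁.source ∧ η s ∈ e₂.source} ∩ Icc 0 1,
      ContinuousAt (fun s => eulerLagrangeCovector (fun s X => L (X, velocityLift η s)) e₁ g s a +
        eulerLagrangeCovector (fun s Y => L (velocityLift g s, Y)) e₂ η s b) s := by
    intro s hs
    have hs' := interior_subset hs.1
    exact ((continuousAt_eulerLagrangeCovector_left hL (hg s hs.2) (hη s hs.2)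
      ⟨he₁.1, hs'.1⟩).clm_apply continuousAt_const).add
      ((continuousAt_eulerLagrangeCovector_right hL (hg s hs.2) (hη s hs.2)
      ⟨he₂.1, hs'.2⟩).clm_apply continuousAt_const)
  refine eq_zero_of_integral_mul_eq_zero
    (K := fun s => eulerLagrangeCovector (fun s X => L (X, velocityLift η s)) e₁ g s a +
      eulerLagrangeCovector (fun s Y => L (velocityLift g s, Y)) e₂ η s b)
    isOpen_interior hJ ht hK fun φ hφ hsub => ?_
  have hφ2 : ContDiff ℝ 2 φ := hφ.of_le two_le_infty
  have hs₁ : ∀ t ∈ tsupport φ, g t ∈ e₁.source := fun s hs => (interior_subset (hsub hs).1).1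
  have hs₂ : ∀ t ∈ tsupport φ, η t ∈ e₂.source := fun s hs => (interior_subset (hsub hs).1).2
  have hd := isDeformation_chartDeformation (a := a) (b := b) hg hη he₁.1 he₂.1 hφ2 hs₁ hs₂
  have h0 : φ 0 = 0 := image_eq_zero_of_notMem_tsupport fun h => lt_irrefl _ (hsub h).2.1
  have h1 : φ 1 = 0 := image_eq_zero_of_notMem_tsupport fun h => lt_irrefl _ (hsub h).2.2
  have hfix₁ : ∀ s, φ s = 0 → ∀ ε, chartDeformation e₁ g φ a ε s = g s := fun s hs ε =>
    chartDeformation_of_mul_eq_zero (by rw [hs, mul_zero])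
  have hfix₂ : ∀ s, φ s = 0 → ∀ ε, chartDeformation e₂ η φ b ε s = η s := fun s hs ε =>
    chartDeformation_of_mul_eq_zero (by rw [hs, mul_zero])
  have hδ := (hasDerivAt_action hL hd).unique (hH _ _ hd (Eventually.of_forall fun ε =>
    ⟨hfix₁ 0 h0 ε, hfix₁ 1 h1 ε, hfix₂ 0 h0 ε, hfix₂ 1 h1 ε⟩))
  have hc1 := continuousOn_fderiv_slice (fun t ht =>
    contDiffAt_lagrangian_deformation hL (hd.smooth_g t ht) (hd.smooth_η t ht)) (1, 0)
  have hc2 : ContinuousOn (fun s => φ s *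
      (eulerLagrangeCovector (fun s X => L (X, velocityLift η s)) e₁ g s a +
        eulerLagrangeCovector (fun s Y => L (velocityLift g s, Y)) e₂ η s b)) (Icc 0 1) := by
    intro s hs
    refine ContinuousAt.continuousWithinAt ?_
    -- The covectors are controlled only while the curves stay in the two charts; off the support of
    -- `φ` the product vanishes locally anyway.
    by_cases h : s ∈ tsupport φ
    · exact hφ.continuous.continuousAt.mul (hK s ⟨(hsub h).1, hs⟩)
    · refine (continuousAt_const (y := (0 : ℝ))).congr ?_
      filter_upwards [notMem_tsupport_iff_eventuallyEq.1 h] with r hr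
      rw [hr, Pi.zero_apply, zero_mul]
  have hint := integral_eq_sub_of_hasDerivAt_Icc (fun s hs =>
    hasDerivAt_boundaryTerm_chartDeformation hL hg hη he₁.1 he₂.1 hφ2 hs₁ hs₂ a b hs) (hc1.add hc2)
  rw [boundaryTerm_eq_zero (Eventually.of_forall (hfix₁ 1 h1)) (Eventually.of_forall (hfix₂ 1 h1)),
    boundaryTerm_eq_zero (Eventually.of_forall (hfix₁ 0 h0)) (Eventually.of_forall (hfix₂ 0 h0)),
    sub_zero, intervalIntegral.integral_add, hδ, zero_add] at hint
  · exact hint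
  · exact ContinuousOn.intervalIntegrable (by rwa [uIcc_of_le zero_le_one])
  · exact ContinuousOn.intervalIntegrable (by rwa [uIcc_of_le zero_le_one])

theorem HamiltonFixedEnds.eulerLagrangePair
    (hH : HamiltonFixedEnds (E := E) (F := F) g η L) : EulerLagrangePair g η L := by
  constructor
  · intro t ht e he
    have h1 : eulerLagrangeCovector (fun s X => L (X, velocityLift η s)) e g t = 0 := by
      ext a
      have h := hH.eulerLagrangeCovector_eq_zero hL hg hη ht he
        (isChartAround_chartAt (η t)) a (0 : F)
      rwa [map_zero, add_zero] at h
    have h2 := (differentiableAt_momentum_left hL (hg t ht) (hη t ht) he).hasDerivAt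
    rw [sub_eq_zero.1 h1] at h2
    exact h2
  · intro t ht e he
    have h1 : eulerLagrangeCovector (fun s Y => L (velocityLift g s, Y)) e η t = 0 := by
      ext b
      have h := hH.eulerLagrangeCovector_eq_zero hL hg hη ht
        (isChartAround_chartAt (g t)) he (0 : E) b
      rwa [map_zero, zero_add] at h
    have h2 := (differentiableAt_momentum_right hL (hg t ht) (hη t ht) he).hasDerivAt
    rw [sub_eq_zero.1 h1] at h2
    exact h2

end Manifolds

end Hamilton

/-! ### From Euler-Lagrange to Euler-Poincaré, and the endpoint condition. -/

section Equivalence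

variable {E : Type*} [NormedAddCommGroup E] [NormedSpace ℝ E]
  {F : Type*} [NormedAddCommGroup F] [NormedSpace ℝ F]

/-- Every pair of tangent vectors at time `t` is the variation at time `t` of a deformation that
is constant at another given time `s`. -/
theorem exists_isDeformation
    {G : Type*} [TopologicalSpace G] [ChartedSpace E G] [IsManifold 𝓘(ℝ, E) ∞ G]
    {N : Type*} [TopologicalSpace N] [ChartedSpace F N] [IsManifold 𝓘(ℝ, F) ∞ N]
    {g : ℝ → G} {η : ℝ → N}
    (hg : ∀ t ∈ Icc (0 : ℝ) 1, ContMDiffAt 𝓘(ℝ, ℝ) 𝓘(ℝ, E) 2 g t)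
    (hη : ∀ t ∈ Icc (0 : ℝ) 1, ContMDiffAt 𝓘(ℝ, ℝ) 𝓘(ℝ, F) 2 η t)
    {t s : ℝ} (ht : t ∈ Icc (0 : ℝ) 1) (hts : t ≠ s) (a : E) (b : F) :
    ∃ (γ : ℝ → ℝ → G) (h : ℝ → ℝ → N), IsDeformation (E := E) (F := F) g η γ h ∧
      vecPart (velocityLift (E := E) (fun ε => γ ε t) 0) = a ∧
      vecPart (velocityLift (E := F) (fun ε => h ε t) 0) = b ∧
      ∀ ε, γ ε s = g s ∧ h ε s = η s := by
  obtain ⟨he₁, hs₁⟩ : IsChartAround (chartAt E (g t)) (g t) := isChartAround_chartAt _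
  obtain ⟨he₂, hs₂⟩ : IsChartAround (chartAt F (η t)) (η t) := isChartAround_chartAt _
  have hJ : {r | (g r ∈ (chartAt E (g t)).source ∧ η r ∈ (chartAt F (η t)).source) ∧ r ≠ s} ∈ 𝓝 t := by
    filter_upwards [eventually_mem_source (hg t ht).continuousAt hs₁,
      eventually_mem_source (hη t ht).continuousAt hs₂, isOpen_ne.mem_nhds hts] with r h1 h2 h3
    exact ⟨⟨h1, h2⟩, h3⟩
  -- A bump equal to `1` at `t`, whose support keeps both curves in their charts and avoids `s`.
  obtain ⟨φ, hsub, -, hφ, -, h1⟩ := exists_contDiff_tsupport_subset (n := 2) hJ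
  have hφs : φ s = 0 := image_eq_zero_of_notMem_tsupport fun h => (hsub h).2 rfl
  refine ⟨chartDeformation (chartAt E (g t)) g φ a, chartDeformation (chartAt F (η t)) η φ b,
    isDeformation_chartDeformation hg hη he₁ he₂ hφ (fun r hr => (hsub hr).1.1)
      (fun r hr => (hsub hr).1.2), ?_, ?_, fun ε => ⟨?_, ?_⟩⟩
  · rw [vecPart_velocityLift_chartDeformation (hg t ht) hφ, h1, one_smul]
  · rw [vecPart_velocityLift_chartDeformation (hη t ht) hφ, h1, one_smul]
  · exact chartDeformation_of_mul_eq_zero (by rw [hφs, mul_zero])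
  · exact chartDeformation_of_mul_eq_zero (by rw [hφs, mul_zero])

variable
  {G : Type*} [TopologicalSpace G] [ChartedSpace E G] [Group G] [LieGroup 𝓘(ℝ, E) ∞ G]
  {N : Type*} [TopologicalSpace N] [ChartedSpace F N] [IsManifold 𝓘(ℝ, F) ∞ N]
  [MulAction G N] [ContMDiffSMul 𝓘(ℝ, E) 𝓘(ℝ, F) ∞ G N]
  {L : TangentBundle 𝓘(ℝ, E) G × TangentBundle 𝓘(ℝ, F) N → ℝ} {g : ℝ → G} {η : ℝ → N}

theorem EulerLagrange.eulerLagrangeCovector_eq_zero {M : Type*} [TopologicalSpace M]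
    [ChartedSpace E M] {Λ : ℝ → TangentBundle 𝓘(ℝ, E) M → ℝ} {c : ℝ → M} (h : EulerLagrange Λ c)
    {t : ℝ} (ht : t ∈ Icc (0 : ℝ) 1) {e : OpenPartialHomeomorph M E} (he : IsChartAround e (c t)) :
    eulerLagrangeCovector Λ e c t = 0 := by
  have h1 : HasDerivAt (momentum Λ e c) (force Λ e c t) t := h t ht e he
  rw [eulerLagrangeCovector, h1.deriv, sub_self]

/-- Both first variation formulas compute the derivative of the same boundary term, with the same
variation of the integrand. The Euler-Lagrange contribution being zero, so is the (EP) contribution.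
-/
theorem EulerLagrangePair.eulerPoincare_variation {γ : ℝ → ℝ → G} {h : ℝ → ℝ → N}
    (hEL : EulerLagrangePair (γ 0) (h 0) L)
    (hL : ContMDiff (𝓘(ℝ, E).tangent.prod 𝓘(ℝ, F).tangent) 𝓘(ℝ, ℝ) 2 L)
    (hinv : RightInvariant L) (hd : IsDeformation (E := E) (F := F) (γ 0) (h 0) γ h) {t : ℝ}
    (ht : t ∈ Icc (0 : ℝ) 1) {e : OpenPartialHomeomorph N F}
    (he : IsChartAround e (nCurve (γ 0) (h 0) t)) :
    eulerPoincareU (reduced L) (γ 0) (h 0) e t (xiCurve γ t) +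
      eulerPoincareNu (reduced L) (γ 0) (h 0) e t
        (fibreCoord e (⟨nCurve (γ 0) (h 0) t, varpiCurve γ h t⟩ : TangentBundle 𝓘(ℝ, F) N)) = 0 := by
  have h1 := hasDerivAt_boundaryTerm hL (hd.smooth_g t ht) (hd.smooth_η t ht)
    (isChartAround_chartAt (γ 0 t)) (isChartAround_chartAt (h 0 t))
  rw [hEL.1.eulerLagrangeCovector_eq_zero ht (isChartAround_chartAt _),
    hEL.2.eulerLagrangeCovector_eq_zero ht (isChartAround_chartAt _), zero_apply,
    zero_apply, add_zero, add_zero, boundaryTerm_eq hL hinv] at h1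
  have h2 := hd.isReducedVariation.hasDerivAt_reducedBoundaryTerm (contMDiff_reduced hL) ht he
  have h3 : (fun p : ℝ × ℝ => L (velocityLift (γ p.1) p.2, velocityLift (h p.1) p.2)) =
      fun p => reduced L (uCurve (γ p.1) p.2, nuCurve (γ p.1) (h p.1) p.2) :=
    funext fun p => apply_eq_reduced hinv _ _
  rw [h3] at h1
  exact left_eq_add.1 (h1.unique h2)

theorem EulerLagrangePair.eulerPoincare_eq (hEL : EulerLagrangePair g η L)
    (hL : ContMDiff (𝓘(ℝ, E).tangent.prod 𝓘(ℝ, F).tangent) 𝓘(ℝ, ℝ) 2 L) (hinv : RightInvariant L)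
    (hg : ∀ t ∈ Icc (0 : ℝ) 1, ContMDiffAt 𝓘(ℝ, ℝ) 𝓘(ℝ, E) 2 g t)
    (hη : ∀ t ∈ Icc (0 : ℝ) 1, ContMDiffAt 𝓘(ℝ, ℝ) 𝓘(ℝ, F) 2 η t)
    {t : ℝ} (ht : t ∈ Icc (0 : ℝ) 1) {e : OpenPartialHomeomorph N F}
    (he : IsChartAround e (nCurve g η t)) (ζ : E) (w : F) :
    eulerPoincareU (reduced L) g η e t ζ + eulerPoincareNu (reduced L) g η e t w = 0 := by
  obtain ⟨a, rfl⟩ := exists_rightTriv_eq (g t) ζ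
  obtain ⟨b, hb⟩ := exists_mfderiv_const_smul_eq (mdifferentiable_const_smul E F) (g t) (η t)
    (vecPart (ofCoord e (e (nCurve g η t)) w))
  -- Only the variation at time `t` matters; `t + 1` is an arbitrary other time at which the
  -- deformation is constant.
  obtain ⟨γ, h, hd, rfl, rfl, -⟩ := exists_isDeformation hg hη ht (lt_add_one t).ne a b
  obtain rfl := hd.base_g
  obtain rfl := hd.base_η
  have hw : fibreCoord e (⟨nCurve (γ 0) (h 0) t, varpiCurve γ h t⟩ : TangentBundle 𝓘(ℝ, F) N) = w := by
    have h1 : (⟨nCurve (γ 0) (h 0) t, varpiCurve γ h t⟩ : TangentBundle 𝓘(ℝ, F) N) =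
        ofCoord e (e (nCurve (γ 0) (h 0) t)) w :=
      Bundle.TotalSpace.ext (e.left_inv he.2).symm (heq_of_eq hb)
    rw [h1, fibreCoord_ofCoord he.1 (e.map_source he.2)]
  have h2 := hEL.eulerPoincare_variation hL hinv hd ht he
  rw [hw] at h2
  exact h2

theorem EulerLagrangePair.eulerPoincare (hEL : EulerLagrangePair g η L)
    (hL : ContMDiff (𝓘(ℝ, E).tangent.prod 𝓘(ℝ, F).tangent) 𝓘(ℝ, ℝ) 2 L) (hinv : RightInvariant L)
    (hg : ∀ t ∈ Icc (0 : ℝ) 1, ContMDiffAt 𝓘(ℝ, ℝ) 𝓘(ℝ, E) 2 g t)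
    (hη : ∀ t ∈ Icc (0 : ℝ) 1, ContMDiffAt 𝓘(ℝ, ℝ) 𝓘(ℝ, F) 2 η t) :
    EulerPoincare g η (reduced L) := by
  have hU : ∀ t ∈ Icc (0 : ℝ) 1, ∀ e : OpenPartialHomeomorph N F,
      IsChartAround e (nCurve g η t) → ∀ ζ : E, eulerPoincareU (reduced L) g η e t ζ = 0 := by
    intro t ht e he ζ
    have h1 := hEL.eulerPoincare_eq hL hinv hg hη ht he ζ (0 : F)
    rwa [map_zero, add_zero] at h1
  refine ⟨fun t ht => ?_, hU, fun t ht e he => ⟨?_, ?_⟩, fun t ht => ?_⟩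
  · exact differentiableAt_dlu (contMDiff_reduced hL) (contDiffAt_uCurve (hg t ht))
      (contMDiffAt_nuCurve (hg t ht) (hη t ht))
  · exact differentiableAt_dlnu (contMDiff_reduced hL) he.1 (contDiffAt_uCurve (hg t ht))
      (contMDiffAt_nuCurve (hg t ht) (hη t ht)) he.2
  · refine ContinuousLinearMap.ext fun w => ?_
    have h1 := hEL.eulerPoincare_eq hL hinv hg hη ht he 0 w
    rw [hU t ht e he, zero_add] at h1
    exact h1
  · exact velocityLift_nCurve (hg t ht) (hη t ht)

/-- Test with a deformation moving `g₁` in an arbitrary direction. Since (EP) holds, the variation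
of the action is the boundary term at time `1`, and for fixed images this is the endpoint functional
at `ξ₁`. -/
theorem HamiltonFixedImages.endpointCondition
    (hH : HamiltonFixedImages (E := E) (F := F) g η L) (hEP : EulerPoincare g η (reduced L))
    (hL : ContMDiff (𝓘(ℝ, E).tangent.prod 𝓘(ℝ, F).tangent) 𝓘(ℝ, ℝ) 2 L) (hinv : RightInvariant L)
    (hg : ∀ t ∈ Icc (0 : ℝ) 1, ContMDiffAt 𝓘(ℝ, ℝ) 𝓘(ℝ, E) 2 g t)
    (hη : ∀ t ∈ Icc (0 : ℝ) 1, ContMDiffAt 𝓘(ℝ, ℝ) 𝓘(ℝ, F) 2 η t) (hg0 : g 0 = 1) :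
    EndpointCondition g η (reduced L) := by
  refine ContinuousLinearMap.ext fun ζ => ?_
  obtain ⟨a, rfl⟩ := exists_rightTriv_eq (g 1) ζ
  obtain ⟨γ, h₀, hd, rfl, -, hs⟩ := exists_isDeformation hg hη (right_mem_Icc.2 zero_le_one)
    one_ne_zero a (0 : F)
  have : LieGroup 𝓘(ℝ, E) 2 G := LieGroup.of_le two_le_infty
  -- This compensates the motion of `γ` so that `n` is unchanged for all `ε` and all times; the
  -- images are then fixed whatever `γ` does at time `1`.
  let h : ℝ → ℝ → N := fun ε t => (γ ε t)⁻¹ • g t • η t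
  have hh0 : h 0 = η := by
    funext t
    change (γ 0 t)⁻¹ • g t • η t = η t
    rw [hd.base_g, inv_smul_smul]
  have hdef : IsDeformation (E := E) (F := F) g η γ h := by
    refine ⟨hd.base_g, hh0, hd.smooth_g, fun t ht => ?_⟩
    have hsnd : ContMDiffAt 𝓘(ℝ, ℝ × ℝ) 𝓘(ℝ, ℝ) 2 (fun p : ℝ × ℝ => p.2) (0, t) :=
      contDiffAt_snd.contMDiffAt
    exact contMDiffAt_smul E two_le_infty (hd.smooth_g t ht).inv
      (ContMDiffAt.comp ((0 : ℝ), t) (f := fun p : ℝ × ℝ => p.2)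
        (contMDiffAt_smul E two_le_infty (hg t ht) (hη t ht)) hsnd)
  have hn : ∀ ε t, γ ε t • h ε t = nCurve g η t := fun ε t => smul_inv_smul _ _
  have h1 := hH γ h hdef (Eventually.of_forall fun ε =>
    ⟨(hs ε).1.trans hg0, hn ε 0, hn ε 1⟩)
  obtain rfl := hd.base_g
  -- The reduced variation is stated along `(γ 0, h 0)`. Forgetting how `h` was built allows `η` to
  -- be replaced by `h 0`; `hn` retains all that is needed.
  clear_value h
  subst hh0
  simp only [action_eq_reducedAction hinv] at h1
  have h2 := h1.unique (hEP.hasDerivAt_reducedAction (contMDiff_reduced hL) hdef.isReducedVariation)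
  rw [reducedBoundaryTerm_eq_zero (xiCurve_eq_zero (Eventually.of_forall fun ε => (hs ε).1))
    (varpiCurve_eq_zero (y := h 0 0) (Eventually.of_forall fun ε => ?_)), sub_zero,
    reducedBoundaryTerm_eq_of_add_eq_zero (hdef.varpiCurve_add_infAct (right_mem_Icc.2 zero_le_one)
      (Eventually.of_forall fun ε => hn ε 1))] at h2
  · exact h2.symm
  · have h3 := hn ε 0
    rw [(hs ε).1] at h3
    exact MulAction.injective _ h3

end Equivalence

end Metamorphosis

end

/-! ### The reduction identity and the two cycles of implications. -/

theorem mainTheorem2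
    {E : Type*} [NormedAddCommGroup E] [NormedSpace ℝ E] [CompleteSpace E]
    {F : Type*} [NormedAddCommGroup F] [NormedSpace ℝ F] [CompleteSpace F]
    {G : Type*} [TopologicalSpace G] [ChartedSpace E G] [Group G] [LieGroup 𝓘(ℝ, E) ∞ G]
    {N : Type*} [TopologicalSpace N] [ChartedSpace F N] [IsManifold 𝓘(ℝ, F) ∞ N]
    [MulAction G N] [ContMDiffSMul 𝓘(ℝ, E) 𝓘(ℝ, F) ∞ G N]
    (L : TangentBundle 𝓘(ℝ, E) G × TangentBundle 𝓘(ℝ, F) N → ℝ)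
    (hL : ContMDiff (𝓘(ℝ, E).tangent.prod 𝓘(ℝ, F).tangent) 𝓘(ℝ, ℝ) 2 L)
    (hinv : Metamorphosis.RightInvariant L)
    (g : ℝ → G) (η : ℝ → N)
    (hg : ∀ t ∈ Set.Icc (0 : ℝ) 1, ContMDiffAt 𝓘(ℝ, ℝ) 𝓘(ℝ, E) 2 g t)
    (hη : ∀ t ∈ Set.Icc (0 : ℝ) 1, ContMDiffAt 𝓘(ℝ, ℝ) 𝓘(ℝ, F) 2 η t)
    (hg0 : g 0 = 1) :
    -- `L(g, U, η, ζ) = ℓ(U g⁻¹, g η, g ζ)` on `TG × TN`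
    (∀ (X : TangentBundle 𝓘(ℝ, E) G) (Y : TangentBundle 𝓘(ℝ, F) N),
      L (X, Y) = Metamorphosis.reduced L (Metamorphosis.rightTriv X,
        tangentMap 𝓘(ℝ, F) 𝓘(ℝ, F) (fun y : N => X.1 • y) Y)) ∧
    -- variations of `g` and `η` that vanish at both ends
    [Metamorphosis.HamiltonFixedEnds g η L,
      Metamorphosis.EulerLagrangePair g η L,
      Metamorphosis.ReducedFixedEnds g η (Metamorphosis.reduced L),
      Metamorphosis.EulerPoincare g η (Metamorphosis.reduced L)].TFAE ∧
    -- variations with `g₀ = id` and the images `n₀`, `n₁` fixed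
    [Metamorphosis.HamiltonFixedImages g η L,
      Metamorphosis.EulerLagrangePair g η L ∧ Metamorphosis.NaturalBoundary g η L,
      Metamorphosis.ReducedFixedImages g η (Metamorphosis.reduced L),
      Metamorphosis.EulerPoincare g η (Metamorphosis.reduced L) ∧
        Metamorphosis.EndpointCondition g η (Metamorphosis.reduced L)].TFAE := by
  have hl := Metamorphosis.contMDiff_reduced hL
  refine ⟨fun X Y => Metamorphosis.apply_eq_reduced hinv X Y, ?_, ?_⟩
  · tfae_have 1 → 2 := fun h => h.eulerLagrangePair hL hg hη
    tfae_have 2 → 4 := fun h => h.eulerPoincare hL hinv hg hη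
    tfae_have 4 → 3 := fun h => h.reducedFixedEnds hl
    tfae_have 3 → 1 := fun h => h.hamiltonFixedEnds hinv
    tfae_finish
  · tfae_have 1 → 2 := fun h => by
      -- The equations come from deformations with fixed ends. The natural boundary condition is
      -- then obtained through the reduced endpoint condition, which uses (EP).
      have hEL := (h.hamiltonFixedEnds hg0).eulerLagrangePair hL hg hη
      exact ⟨hEL, (Metamorphosis.naturalBoundary_iff_endpointCondition hL hinv).2
        (h.endpointCondition (hEL.eulerPoincare hL hinv hg hη) hL hinv hg hη hg0)⟩
    tfae_have 2 → 4 := fun h => ⟨h.1.eulerPoincare hL hinv hg hη,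
      (Metamorphosis.naturalBoundary_iff_endpointCondition hL hinv).1 h.2⟩
    tfae_have 4 → 3 := fun h => h.1.reducedFixedImages h.2 hl
    tfae_have 3 → 1 := fun h => h.hamiltonFixedImages hinv
    tfae_finish
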